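/- Let $C$ be a smooth projective geometrically irreducible curve over the finite field $\mathbb F_q$, let $\infty\in C(\mathbb F_q)$, $A=\Gamma(C\setminus\{\infty\},\mathcal O_C)$, $Q=\mathbb F_q(C)$, and let $Q_\infty$ be the completion of $Q$ at $\infty$ with its normalized absolute value $|x|=q^{-\operatorname{ord}_\infty(x)}$, extended to an algebraic closure of $Q_\infty$. Let $\mathbb F_s$ be a finite extension of $\mathbb F_q$, $s=q^e$, let $c^*:A\to\mathbb F_s$ be an $\mathbb F_q$-algebra homomorphism, $\chi=\ker c^*$, and put $A_{\mathbb F_s}=A\otimes_{\mathbb F_q}\mathbb F_s$, $\sigma^*=\mathrm{id}_A\otimes \mathrm{Frob}_q$. Let $\underline M=(M,\tau)$ be a pure Anderson motive over $\mathbb F_s$ of rank $r$, dimension $d$ and characteristic $c^*$: $M$ is a locally free $A_{\mathbb F_s}$-module of rank $r$, and $\tau:\sigma^*M\to M$ is an injective $A_{\mathbb F_s}$-linear map whose cokernel has dimension $d$ over $\mathbb F_s$ and is annihilated by $J^d$, $J=(a\otimes 1-1\otimes c^*(a):a\in A)$; moreover $M$ extends to a locally free sheaf $\mathcal M$ on $C_{\mathbb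 F_s}=C\times_{\mathbb F_q}\mathbb F_s$ such that for some integers $k,l>0$ the map $\tau^l$ induces an isomorphism $(\sigma^*)^l\mathcal M_\infty\to\mathcal M(k\cdot\infty)_\infty$ of stalks at $\infty$. For such $k,l$ put $\operatorname{weight}(\underline M)=k/l$. Let $\pi=\tau\circ\sigma^*\tau\circ\dots\circ(\sigma^*)^{e-1}\tau\in\operatorname{End}(\underline M)$ be the Frobenius endomorphism. Let $v\neq\chi$ be a maximal ideal of $A$, let $A_v$ be the completion of $A$ at $v$, $Q_v=\operatorname{Frac}A_v$, let $\mathbb F_s^{\rm sep}$ be a separable closure of $\mathbb F_s$, and let $A_{v,\mathbb F_s^{\rm sep}}$ be the $v$-adic completion of $A\otimes_{\mathbb F_q}\mathbb F_s^{\rm sep}$. Let $T_v\underline M$ be the $A_v$-module of those $x\in M\otimes_{A_{\mathbb F_s}}A_{v,\mathbb F_s^{\rm sep}}$ that are invariant under the $\sigma^*$-semilinear map induced by $\tau$, let $V_v\underline M=T_v\underline M\otimes_{A_v}Q_v$, and let $\pi_v$ be the endomorphism of $V_v\underline M$ induced by $\pi$. **Theorem (Riemann hypothesis).** For every $i\ge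 0$ the space $V_v\underline M$ is finite-dimensional over $Q_v$, the characteristic polynomial of $\wedge^i\pi_v\in\operatorname{End}_{Q_v}(\wedge^iV_v\underline M)$ has coefficients in $A$, and all its roots in an algebraic closure of $Q_\infty$ (the eigenvalues of $\wedge^i\pi_v$) have the same absolute value $s^{\,i\cdot\operatorname{weight}(\underline M)}$. -/

import Mathlib

open CategoryTheory AlgebraicGeometry
open scoped TensorProduct KaehlerDifferential
universe u w

/-- A Noetherian local domain over a field, with residue field equal to the base field and with
module of differentials cyclic and nonzero, is a discrete valuation ring. -/
theorem isDVR_of_kaehler {R O : Type*} [CommRing R] (hR : IsField R) [CommRing O] [IsDomain O]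
    [IsLocalRing O] [IsNoetherianRing O] [Algebra R O] (ε : O →ₐ[R] R)
    (ω : Ω[O⁄R]) (hω : Submodule.span O {ω} = ⊤) [Nontrivial (Ω[O⁄R])] :
    IsDiscreteValuationRing O := by
  let := hR.toField
  have hmem : ∀ x : O, x - algebraMap R O (ε x) ∈ IsLocalRing.maximalIdeal O := by
    intro x hx
    have := hx.map ε
    simp at this
  have hε : ∀ x ∈ IsLocalRing.maximalIdeal O, ε x = 0 := by
    intro x hx
    by_contra h
    have h1 : algebraMap R O (ε x) ∈ IsLocalRing.maximalIdeal O := by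
      simpa using sub_mem hx (hmem x)
    exact h1 ((IsUnit.mk0 _ h).map _)
  let D : Derivation R O (IsLocalRing.maximalIdeal O).Cotangent := Derivation.mk'
    { toFun := fun x => (IsLocalRing.maximalIdeal O).toCotangent ⟨_, hmem x⟩
      map_add' := fun x y => by
        rw [← map_add]; congr 1; ext; simp; ring
      map_smul' := fun r x => by
        rw [RingHom.id_apply, ← algebraMap_smul O r (Ideal.toCotangent _ _), ← map_smul]
        congr 1; ext
        simp [Algebra.smul_def]; ring }
    (fun x y => by
      simp only [LinearMap.coe_mk, AddHom.coe_mk]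
      rw [← map_smul, ← map_smul, ← map_add, Ideal.toCotangent_eq]
      have : (x * y - algebraMap R O (ε (x * y))) - (x * (y - algebraMap R O (ε y))
          + y * (x - algebraMap R O (ε x))) =
          -((x - algebraMap R O (ε x)) * (y - algebraMap R O (ε y))) := by
        simp; ring
      simp only [Submodule.coe_add, Submodule.coe_smul, smul_eq_mul]
      rw [this, pow_two]
      exact neg_mem (Ideal.mul_mem_mul (hmem x) (hmem y)))
  have hsurj : Function.Surjective D.liftKaehlerDifferential := by
    intro z
    obtain ⟨⟨x, hx⟩, rfl⟩ := Ideal.toCotangent_surjective _ z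
    refine ⟨KaehlerDifferential.D R O x, ?_⟩
    rw [Derivation.liftKaehlerDifferential_comp_D]
    change (IsLocalRing.maximalIdeal O).toCotangent ⟨_, hmem x⟩ = _
    rw [Ideal.toCotangent_eq]
    simp [hε x hx]
  have hfield : ¬ IsField O := by
    intro hO
    let := hO.toField
    have hx : ∀ x : O, x = algebraMap R O (ε x) := by
      intro x
      apply ε.toRingHom.injective
      simp
    have hD : ∀ x, KaehlerDifferential.D R O x = 0 := by
      intro x; rw [hx x]; simp
    have : (⊤ : Submodule O (Ω[O⁄R])) = ⊥ := by
      rw [← KaehlerDifferential.span_range_derivation R O, Submodule.span_eq_bot]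
      rintro _ ⟨x, rfl⟩; exact hD x
    exact bot_ne_top this.symm
  refine ((IsDiscreteValuationRing.TFAE O hfield).out 0 4).mpr ?_
  refine ((IsLocalRing.finrank_cotangentSpace_le_one_iff (R := O)).mp ?_)
  refine finrank_le_one (D.liftKaehlerDifferential ω) fun w => ?_
  obtain ⟨y, rfl⟩ := hsurj w
  obtain ⟨a, rfl⟩ := Submodule.mem_span_singleton.mp
    (hω ▸ Submodule.mem_top : y ∈ Submodule.span O {ω})
  exact ⟨IsLocalRing.residue O a, by rw [map_smul]; rfl⟩

/-- The local ring of a smooth integral curve at a rational point is a discrete valuation ring. -/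
theorem isDVR_stalk {C : Scheme.{u}} {Fq : Type u} [Field Fq] [IsIntegral C] (f : C ⟶ Spec (.of Fq))
   [SmoothOfRelativeDimension 1 f] (s : Spec (.of Fq) ⟶ C) (hs : s ≫ f = 𝟙 _) (x : Spec (.of Fq)) :
   IsDiscreteValuationRing (C.presheaf.stalk (s x)) := by
  have : Smooth f := SmoothOfRelativeDimension.smooth 1 f
  have : IsLocallyNoetherian C := LocallyOfFiniteType.isLocallyNoetherian f
  obtain ⟨U, hU, V, hV, hxV, e, hf⟩ :=
    SmoothOfRelativeDimension.exists_isStandardSmoothOfRelativeDimension (n := 1) (f := f) (s x)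
  have hxU : x ∈ U := by
    have := e hxV
    change f (s x) ∈ U at this
    rwa [← Scheme.Hom.comp_apply, hs] at this
  have hUtop : U = ⊤ := by
    ext y; simpa [Subsingleton.elim y x] using hxU
  have hR : IsField Γ(Spec (.of Fq), U) := by
    subst hUtop
    exact (Scheme.ΓSpecIso (.of Fq)).commRingCatIsoToRingEquiv.toMulEquiv.isField
      (Field.toIsField Fq)
  algebraize [(f.appLE U V e).hom]
  let h : Γ(Spec (.of Fq), U) →+* C.presheaf.stalk (s x) := 
    (f.appLE U V e ≫ C.presheaf.germ V (s x) hxV).hom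
  let : Algebra Γ(Spec (.of Fq), U) (C.presheaf.stalk (s x)) := h.toAlgebra
  let : Algebra Γ(C, V) (C.presheaf.stalk (s x)) := (C.presheaf.germ V (s x) hxV).hom.toAlgebra
  have : IsScalarTower Γ(Spec (.of Fq), U) Γ(C, V) (C.presheaf.stalk (s x)) := .of_algebraMap_eq' rfl
  have hloc : IsLocalization.AtPrime (C.presheaf.stalk (s x))
      (hV.primeIdealOf ⟨s x, hxV⟩).asIdeal := hV.isLocalization_stalk ⟨s x, hxV⟩
  have : Algebra.FormallyEtale Γ(C, V) (C.presheaf.stalk (s x)) :=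
    Algebra.FormallyEtale.of_isLocalization (hV.primeIdealOf ⟨s x, hxV⟩).asIdeal.primeCompl
  have : Nonempty V := ⟨⟨s x, hxV⟩⟩
  have hst : Algebra.IsStandardSmoothOfRelativeDimension 1 Γ(Spec (.of Fq), U) Γ(C, V) := hf
  have : Algebra.IsStandardSmooth Γ(Spec (.of Fq), U) Γ(C, V) := hst.isStandardSmooth
  have hrk := hst.rank_kaehlerDifferential
  let E := KaehlerDifferential.tensorKaehlerEquivOfFormallyEtale Γ(Spec (.of Fq), U) Γ(C, V)
    (C.presheaf.stalk (s x))
  have : Module.Free (C.presheaf.stalk (s x)) (Ω[C.presheaf.stalk (s x)⁄Γ(Spec (.of Fq), U)]) :=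
    Module.Free.of_equiv E
  have hrk' : Module.finrank (C.presheaf.stalk (s x))
      (Ω[C.presheaf.stalk (s x)⁄Γ(Spec (.of Fq), U)]) = 1 := by
    rw [← E.finrank_eq, Module.finrank_baseChange]
    exact Module.finrank_eq_of_rank_eq (by simpa using hrk)
  -- the section gives a retraction of the structure map of the local ring
  let j : Γ(Spec (.of Fq), U) →+* (Spec (.of Fq)).presheaf.stalk x :=
    ((Spec (.of Fq)).presheaf.germ U x hxU).hom
  have hj : Function.Bijective j := by
    let : Algebra Γ(Spec (.of Fq), U) ((Spec (.of Fq)).presheaf.stalk x) := j.toAlgebra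
    have := hU.isLocalization_stalk ⟨x, hxU⟩
    exact hR.localization_map_bijective (M := (hU.primeIdealOf ⟨x, hxU⟩).asIdeal.primeCompl)
      (fun h => h (Ideal.zero_mem _))
  let J := RingEquiv.ofBijective j hj
  have hcomp : (s.stalkMap x).hom.comp h = j := by
    have hle : U ≤ s ⁻¹ᵁ V := by
      intro y hy
      rw [Subsingleton.elim y x]; exact hxV
    have hid : ∀ (g : Spec (.of Fq) ⟶ Spec (.of Fq)) (_ : g = 𝟙 _) (e' : U ≤ g ⁻¹ᵁ U),
        g.appLE U U e' = 𝟙 _ := by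
      rintro _ rfl e'
      simp only [Scheme.Hom.appLE, Scheme.Hom.id_app]
      erw [Category.id_comp]
      exact (Spec (.of Fq)).presheaf.map_id _
    have h1 : f.appLE U V e ≫ s.appLE V U hle = 𝟙 _ := by
      rw [Scheme.Hom.appLE_comp_appLE]
      exact hid _ hs _
    have h2 : C.presheaf.germ V (s x) hxV ≫ s.stalkMap x =
        s.appLE V U hle ≫ (Spec (.of Fq)).presheaf.germ U x hxU := by
      rw [Scheme.Hom.germ_stalkMap, Scheme.Hom.appLE, Category.assoc, TopCat.Presheaf.germ_res]
    have h3 : (f.appLE U V e ≫ C.presheaf.germ V (s x) hxV) ≫ s.stalkMap x =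
        (Spec (.of Fq)).presheaf.germ U x hxU := by
      rw [Category.assoc, h2, ← Category.assoc, h1, Category.id_comp]
    exact congr(($h3).hom)
  let ε : C.presheaf.stalk (s x) →ₐ[Γ(Spec (.of Fq), U)] Γ(Spec (.of Fq), U) :=
    { toRingHom := J.symm.toRingHom.comp (s.stalkMap x).hom
      commutes' := fun r => by
        apply J.injective
        exact (J.apply_symm_apply _).trans congr($hcomp r) }
  obtain ⟨ω, -, hω⟩ := (finrank_eq_one_iff' (K := C.presheaf.stalk (s x))
    (V := Ω[C.presheaf.stalk (s x)⁄Γ(Spec (.of Fq), U)])).mp hrk'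
  have : Nontrivial (Ω[C.presheaf.stalk (s x)⁄Γ(Spec (.of Fq), U)]) :=
    Module.nontrivial_of_finrank_pos (R := C.presheaf.stalk (s x)) (by omega)
  exact isDVR_of_kaehler hR ε ω (Submodule.eq_top_iff'.mpr fun w =>
    Submodule.mem_span_singleton.mpr (hω w))

/-- A smooth projective geometrically irreducible curve `C` over `Fq`, with an `Fq`-rational
point `∞`
(a section of the structure morphism). Curves are integral schemes; for curves over a field,
projective means proper. -/
structure PointedCurve (Fq : Type u) [Field Fq] where
  C : Scheme.{u}
  str : C ⟶ Spec (.of Fq)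
  [isIntegral : IsIntegral C]
  [isProper : IsProper str]
  [smooth : SmoothOfRelativeDimension 1 str]
  [geomIrreducible : GeometricallyIrreducible str]
  infty : Spec (.of Fq) ⟶ C
  infty_str : infty ≫ str = 𝟙 _

namespace PointedCurve

variable {Fq : Type u} [Field Fq] (X : PointedCurve Fq)

attribute [instance] isIntegral isProper smooth geomIrreducible

/-- The closed point `∞` of `C`. -/
noncomputable def pt : X.C := X.infty (IsLocalRing.closedPoint Fq)

theorem isClosed_range : IsClosed (Set.range X.infty) := by
  have : IsClosedImmersion (X.infty ≫ X.str) := by rw [X.infty_str]; infer_instance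
  have := IsClosedImmersion.of_comp X.infty X.str
  exact X.infty.isClosedEmbedding.isClosed_range

/-- The open complement `C ∖ {∞}`. -/
def U : X.C.Opens := ⟨(Set.range X.infty)ᶜ, X.isClosed_range.isOpen_compl⟩

/-- `A = Γ(C ∖ {∞}, 𝒪_C)`. -/
def A : Type u := Γ(X.C, X.U)

/-- The local ring `𝒪_{C,∞}`. -/
def O : Type u := X.C.presheaf.stalk X.pt

/-- The function field `Q` of `C`. -/
def Q : Type u := X.C.functionField

noncomputable instance : CommRing X.A := inferInstanceAs (CommRing Γ(X.C, X.U))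
noncomputable instance : CommRing X.O := inferInstanceAs (CommRing (X.C.presheaf.stalk X.pt))
noncomputable instance : Field X.Q := inferInstanceAs (Field X.C.functionField)
instance : IsLocalRing X.O := inferInstanceAs (IsLocalRing (X.C.presheaf.stalk X.pt))
instance : IsDomain X.O := inferInstanceAs (IsDomain (X.C.presheaf.stalk X.pt))
noncomputable instance : Algebra X.O X.Q :=
  inferInstanceAs (Algebra (X.C.presheaf.stalk X.pt) X.C.functionField)
instance : IsFractionRing X.O X.Q :=
  inferInstanceAs (IsFractionRing (X.C.presheaf.stalk X.pt) X.C.functionField)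
instance : IsDiscreteValuationRing X.O := isDVR_stalk X.str X.infty X.infty_str _

theorem genericPoint_mem : genericPoint X.C ∈ X.U := by
  intro h
  obtain ⟨y, hy⟩ := h
  rw [Subsingleton.elim y (IsLocalRing.closedPoint Fq)] at hy
  have key : ∀ z : X.C, z = genericPoint X.C → IsField (X.C.presheaf.stalk z) := by
    rintro _ rfl
    exact Field.toIsField X.C.functionField
  exact IsDiscreteValuationRing.not_isField X.O (key X.pt hy)

instance : Nonempty X.U := ⟨⟨_, X.genericPoint_mem⟩⟩

noncomputable instance : Algebra X.A X.Q :=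
  inferInstanceAs (Algebra Γ(X.C, X.U) X.C.functionField)

noncomputable instance : Algebra Fq X.A :=
  ((Scheme.ΓSpecIso (.of Fq)).inv ≫ X.str.appLE ⊤ X.U le_top).hom.toAlgebra

noncomputable instance : Algebra Fq X.O :=
  ((Scheme.ΓSpecIso (.of Fq)).inv ≫ X.str.appTop ≫
    X.C.presheaf.germ ⊤ X.pt trivial).hom.toAlgebra

noncomputable instance : Algebra Fq X.Q :=
  ((algebraMap X.O X.Q).comp (algebraMap Fq X.O)).toAlgebra

instance : IsScalarTower Fq X.O X.Q := .of_algebraMap_eq' rfl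

instance : IsScalarTower Fq X.A X.Q := by
  refine .of_algebraMap_eq' ?_
  have : ((Scheme.ΓSpecIso (.of Fq)).inv ≫ X.str.appTop ≫ X.C.presheaf.germ ⊤ X.pt trivial) ≫
      X.C.presheaf.stalkSpecializes ((genericPoint_spec X.C).specializes trivial) =
      ((Scheme.ΓSpecIso (.of Fq)).inv ≫ X.str.appLE ⊤ X.U le_top) ≫
        X.C.germToFunctionField X.U := by
    have h := X.C.presheaf.germ_stalkSpecializes (U := ⊤) (y := X.pt) trivial
      ((genericPoint_spec X.C).specializes trivial)
    simp only [Category.assoc, Scheme.Hom.appLE, TopCat.Presheaf.germ_res,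
      Scheme.germToFunctionField, h]
    rfl
  exact congr(($this).hom)

end PointedCurve

namespace AdicCompletion

theorem mapRingHom_compat {R S : Type*} [CommRing R] [CommRing S] (I : Ideal R) (J : Ideal S)
    (f : R →+* S) (hf : ∀ n, I ^ n ≤ (J ^ n).comap f) {m n : ℕ} (hle : m ≤ n) :
    (Ideal.Quotient.factorPow J hle).comp
      ((Ideal.quotientMap (J ^ n) f (hf n)).comp (AdicCompletion.evalₐ I n).toRingHom) =
    (Ideal.quotientMap (J ^ m) f (hf m)).comp (AdicCompletion.evalₐ I m).toRingHom := by
  ext x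
  induction x using AdicCompletion.induction_on with
  | _ a =>
    have h : Ideal.Quotient.mk (I ^ m) (a.1 n) = Ideal.Quotient.mk (I ^ m) (a.1 m) := by
      rw [Ideal.Quotient.eq]
      simpa using SModEq.sub_mem.mp (a.2 hle).symm
    have h' := congrArg (Ideal.quotientMap (J ^ m) f (hf m)) h
    simpa using h'

theorem pow_le_comap_pow {R S : Type*} [CommRing R] [CommRing S] {I : Ideal R} {J : Ideal S}
    {f : R →+* S} (hf : I.map f ≤ J) (n : ℕ) : I ^ n ≤ (J ^ n).comap f :=
  Ideal.map_le_iff_le_comap.mp ((Ideal.map_pow f I n).trans_le (Ideal.pow_right_mono hf n))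

/-- Functoriality of the adic completion of rings. -/
noncomputable def mapRingHom {R S : Type*} [CommRing R] [CommRing S] (I : Ideal R) (J : Ideal S)
    (f : R →+* S) (hf : I.map f ≤ J) : AdicCompletion I R →+* AdicCompletion J S :=
  AdicCompletion.liftRingHom J
    (fun n => (Ideal.quotientMap (J ^ n) f (pow_le_comap_pow hf n)).comp
      (AdicCompletion.evalₐ I n).toRingHom)
    (mapRingHom_compat I J f (pow_le_comap_pow hf))

theorem evalₐ_mapRingHom {R S : Type*} [CommRing R] [CommRing S] (I : Ideal R) (J : Ideal S)
    (f : R →+* S) (hf : I.map f ≤ J) (n : ℕ) (x : AdicCompletion I R) :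
    AdicCompletion.evalₐ J n (mapRingHom I J f hf x) =
      Ideal.quotientMap (J ^ n) f (pow_le_comap_pow hf n) (AdicCompletion.evalₐ I n x) := by
  rw [mapRingHom, AdicCompletion.evalₐ_liftRingHom _ _ (mapRingHom_compat I J f _)]; rfl

theorem mapRingHom_algebraMap {R S : Type*} [CommRing R] [CommRing S] (I : Ideal R) (J : Ideal S)
    (f : R →+* S) (hf : I.map f ≤ J) (x : R) :
    mapRingHom I J f hf (algebraMap R _ x) = algebraMap S _ (f x) := by
  refine AdicCompletion.ext_evalₐ fun n => ?_
  rw [evalₐ_mapRingHom, AlgHom.commutes, AlgHom.commutes]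
  exact Ideal.quotientMap_mk

theorem mapRingHom_comp_apply {R S : Type*} [CommRing R] [CommRing S] (I : Ideal R) (J : Ideal S)
    (f : R →+* S) (g : S →+* S) (hf : I.map f ≤ J) (hg : J.map g ≤ J) (h : g.comp f = f)
    (x : AdicCompletion I R) :
    mapRingHom J J g hg (mapRingHom I J f hf x) = mapRingHom I J f hf x := by
  refine AdicCompletion.ext_evalₐ fun n => ?_
  rw [evalₐ_mapRingHom, evalₐ_mapRingHom]
  obtain ⟨y, hy⟩ := Ideal.Quotient.mk_surjective (AdicCompletion.evalₐ I n x)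
  rw [← hy, Ideal.quotientMap_mk, Ideal.quotientMap_mk]
  exact congrArg _ (congr($h y))

end AdicCompletion

/-- The additive map underlying the semilinear extension. -/
noncomputable def semilinearBaseChangeAux {R S M : Type*} [CommRing R] [CommRing S] [Algebra R S]
    [AddCommGroup M] [Module R M] {σR : R →+* R} (σS : S →+* S)
    (h : ∀ r, σS (algebraMap R S r) = algebraMap R S (σR r)) (τ : M →ₛₗ[σR] M) :
    S ⊗[R] M →+ S ⊗[R] M :=
  TensorProduct.liftAddHom
    (AddMonoidHom.mk' (fun s => AddMonoidHom.mk' (fun m => σS s ⊗ₜ[R] τ m)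
        (fun x y => by rw [map_add, TensorProduct.tmul_add]))
      (fun s t => by ext; simp [TensorProduct.add_tmul]))
    (fun r s m => by
      change σS (r • s) ⊗ₜ[R] τ m = σS s ⊗ₜ[R] τ (r • m)
      rw [Algebra.smul_def, map_mul, h, ← Algebra.smul_def, map_smulₛₗ, TensorProduct.smul_tmul])

/-- Base change along `R → S` of a `σR`-semilinear map `τ : M → M` (that is, of an `R`-linear map
`σR^* M → M`): the `σS`-semilinear map `s ⊗ m ↦ σS s ⊗ τ m`, where `σS` extends `σR`. -/
noncomputable def semilinearBaseChange {R S M : Type*} [CommRing R] [CommRing S] [Algebra R S]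
    [AddCommGroup M] [Module R M] {σR : R →+* R} (σS : S →+* S)
    (h : ∀ r, σS (algebraMap R S r) = algebraMap R S (σR r)) (τ : M →ₛₗ[σR] M) :
    S ⊗[R] M →ₛₗ[σS] S ⊗[R] M where
  toFun := semilinearBaseChangeAux σS h τ
  map_add' := map_add _
  map_smul' := fun s x => by
    induction x with
    | zero => rw [smul_zero, map_zero, smul_zero]
    | add x y hx hy => rw [smul_add, map_add, hx, hy, map_add, smul_add]
    | tmul t m =>
      change σS (s * t) ⊗ₜ[R] τ m = (σS s * σS t) ⊗ₜ[R] τ m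
      rw [map_mul]

@[simp] theorem semilinearBaseChange_tmul {R S M : Type*} [CommRing R] [CommRing S] [Algebra R S]
    [AddCommGroup M] [Module R M] {σR : R →+* R} (σS : S →+* S)
    (h : ∀ r, σS (algebraMap R S r) = algebraMap R S (σR r)) (τ : M →ₛₗ[σR] M) (s : S) (m : M) :
    semilinearBaseChange σS h τ (s ⊗ₜ m) = σS s ⊗ₜ τ m := rfl

/-- The endomorphism `σ^*` of `B_L = L ⊗ B`: the `q`-Frobenius on `L` and the identity on `B`,
where `q = #Fq`. -/
noncomputable def frob (Fq : Type*) [Field Fq] [Fintype Fq] (L B : Type*) [CommRing L] [Algebra Fq L]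
    [CommRing B] [Algebra Fq B] : L ⊗[Fq] B →+* L ⊗[Fq] B :=
  (Algebra.TensorProduct.map (FiniteField.frobeniusAlgHom Fq L) (AlgHom.id Fq B)).toRingHom

@[simp] theorem frob_tmul (Fq : Type*) [Field Fq] [Fintype Fq] (L B : Type*) [CommRing L] [Algebra Fq L]
    [CommRing B] [Algebra Fq B] (x : L) (b : B) :
    frob Fq L B (x ⊗ₜ b) = (x ^ Fintype.card Fq) ⊗ₜ b := rfl

/-- If `#L = q ^ e` then the `e`-th iterate of `σ^*` is the identity. -/
theorem frob_iterate (Fq : Type*) [Field Fq] [Fintype Fq] (L B : Type*) [Field L] [Finite L]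
    [Algebra Fq L] [CommRing B] [Algebra Fq B] (x : L ⊗[Fq] B) :
    (frob Fq L B)^[Module.finrank Fq L] x = x := by
  have key : ∀ (n : ℕ) (x : L) (b : B),
      (frob Fq L B)^[n] (x ⊗ₜ b) = (x ^ (Fintype.card Fq ^ n)) ⊗ₜ b := by
    intro n
    induction n with
    | zero => intro x b; simp
    | succ n ih => intro x b; rw [Function.iterate_succ_apply, frob_tmul, ih, ← pow_mul, pow_succ']
  have := Fintype.ofFinite L
  induction x with
  | zero => exact Function.iterate_fixed (map_zero _) _
  | add x y hx hy => rw [iterate_map_add, hx, hy]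
  | tmul x b => rw [key, ← Module.card_eq_pow_finrank (K := Fq) (V := L), FiniteField.pow_card]

namespace PointedCurve

variable {Fq : Type u} [Field Fq] (X : PointedCurve Fq)

section
variable (L : Type*) [Field L] [Algebra Fq L]

/-- The map `A_L → Q_L`. -/
noncomputable instance : Algebra (L ⊗[Fq] X.A) (L ⊗[Fq] X.Q) :=
  (Algebra.TensorProduct.map (AlgHom.id Fq L)
    (IsScalarTower.toAlgHom Fq X.A X.Q)).toRingHom.toAlgebra

/-- The local ring of `C_L` at the point `∞`, for `L` finite over `Fq`, as a subring of `Q_L = L ⊗ Q`: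
the image of `L ⊗ 𝒪_{C,∞}`. For finite `L` the ring `L ⊗ 𝒪_{C,∞}` is already local, because it is
integral over `𝒪_{C,∞}` and its fibre `L ⊗ κ(∞) = L` over the closed point is a field; so no further
localization is needed. Likewise `Q_L` is then the function field of `C_L`. -/
noncomputable def localRingInfty : Subalgebra Fq (L ⊗[Fq] X.Q) :=
  (Algebra.TensorProduct.map (AlgHom.id Fq L) (IsScalarTower.toAlgHom Fq X.O X.Q)).range

/-- The ideal `v A_L` of `A_L = L ⊗ A`. -/
noncomputable def placeIdeal (v : Ideal X.A) : Ideal (L ⊗[Fq] X.A) :=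
  v.map (Algebra.TensorProduct.includeRight : X.A →ₐ[Fq] L ⊗[Fq] X.A)

/-- The ring `A_{v,L}`: the completion of `A_L` at the ideal `v A_L`. -/
def CompletedCoeff (v : Ideal X.A) : Type _ :=
  AdicCompletion (X.placeIdeal L v) (L ⊗[Fq] X.A)

noncomputable instance (v : Ideal X.A) : CommRing (X.CompletedCoeff L v) :=
  inferInstanceAs (CommRing (AdicCompletion (X.placeIdeal L v) (L ⊗[Fq] X.A)))

/-- The completion `A_v` of `A` at `v`. -/
def Av (v : Ideal X.A) : Type _ := AdicCompletion v X.A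

noncomputable instance (v : Ideal X.A) : CommRing (X.Av v) :=
  inferInstanceAs (CommRing (AdicCompletion v X.A))
noncomputable instance (v : Ideal X.A) : Algebra X.A (X.Av v) :=
  inferInstanceAs (Algebra X.A (AdicCompletion v X.A))

/-- The fraction field `Q_v` of `A_v`. -/
abbrev Qv (v : Ideal X.A) : Type _ := FractionRing (X.Av v)

/-- The map `A_v → A_{v,L}`. -/
noncomputable instance (v : Ideal X.A) : Algebra (X.Av v) (X.CompletedCoeff L v) :=
  (AdicCompletion.mapRingHom v (X.placeIdeal L v)
    (Algebra.TensorProduct.includeRight : X.A →ₐ[Fq] L ⊗[Fq] X.A).toRingHom le_rfl).toAlgebra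

end

section
variable (L Ls : Type*) [Field L] [Algebra Fq L] [Field Ls] [Algebra Fq Ls] [Algebra L Ls]
  [IsScalarTower Fq L Ls]

/-- The map `A_L → A_{v,Ls}` for an extension `Ls` of `L`. -/
noncomputable instance (v : Ideal X.A) : Algebra (L ⊗[Fq] X.A) (X.CompletedCoeff Ls v) :=
  (((algebraMap (Ls ⊗[Fq] X.A) (AdicCompletion (X.placeIdeal Ls v) (Ls ⊗[Fq] X.A))).comp
    (Algebra.TensorProduct.map (IsScalarTower.toAlgHom Fq L Ls) (AlgHom.id Fq X.A)).toRingHom :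
      L ⊗[Fq] X.A →+* AdicCompletion (X.placeIdeal Ls v) (Ls ⊗[Fq] X.A))).toAlgebra

instance (v : Ideal X.A) : SMulCommClass (L ⊗[Fq] X.A) (X.Av v) (X.CompletedCoeff Ls v) :=
  ⟨fun a b x => by simp only [Algebra.smul_def]; ring⟩

variable [Fintype Fq]

theorem placeIdeal_map_frob (v : Ideal X.A) :
    (X.placeIdeal L v).map (frob Fq L X.A) ≤ X.placeIdeal L v := by
  rw [placeIdeal, Ideal.map_le_iff_le_comap, Ideal.map_le_iff_le_comap]
  intro a ha
  have : frob Fq L X.A ((Algebra.TensorProduct.includeRight : X.A →ₐ[Fq] L ⊗[Fq] X.A) a) =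
    (Algebra.TensorProduct.includeRight : X.A →ₐ[Fq] L ⊗[Fq] X.A) a := by simp
  rw [Ideal.mem_comap, Ideal.mem_comap, this]
  exact Ideal.mem_map_of_mem _ ha

/-- The endomorphism `σ^*` of `A_{v,L}`, the completion of `σ^*` on `A_L`. -/
noncomputable def completedFrob (v : Ideal X.A) : X.CompletedCoeff L v →+* X.CompletedCoeff L v :=
  AdicCompletion.mapRingHom _ _ (frob Fq L X.A) (X.placeIdeal_map_frob L v)

end

section
variable {Fq : Type u} [Field Fq] [Fintype Fq] (X : PointedCurve Fq)
  {L : Type*} [Field L] [Finite L] [Algebra Fq L]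

/-- The ideal `J ⊂ A_L` generated by the elements `a ⊗ 1 - 1 ⊗ c(a)` (in our order of the tensor
factors, `1 ⊗ a - c(a) ⊗ 1`). -/
noncomputable def characteristicIdeal (c : X.A →ₐ[Fq] L) : Ideal (L ⊗[Fq] X.A) :=
  Ideal.span (Set.range fun a : X.A => (1 : L) ⊗ₜ[Fq] a - c a ⊗ₜ[Fq] (1 : X.A))

theorem frob_algebraMap (a : L ⊗[Fq] X.A) :
    frob Fq L X.Q (algebraMap (L ⊗[Fq] X.A) (L ⊗[Fq] X.Q) a) =
      algebraMap (L ⊗[Fq] X.A) (L ⊗[Fq] X.Q) (frob Fq L X.A a) := by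
  induction a with
  | zero => simp
  | add x y hx hy => simp only [map_add, hx, hy]
  | tmul x a => rfl

variable {M : Type*} [AddCommGroup M] [Module (L ⊗[Fq] X.A) M]

/-- The semilinear map induced by `τ` on the generic fibre `M ⊗_{A_L} Q_L`. -/
noncomputable def genericTau (τ : M →ₛₗ[frob Fq L X.A] M) :
    (L ⊗[Fq] X.Q) ⊗[L ⊗[Fq] X.A] M →ₛₗ[frob Fq L X.Q] (L ⊗[Fq] X.Q) ⊗[L ⊗[Fq] X.A] M :=
  semilinearBaseChange (frob Fq L X.Q) X.frob_algebraMap τ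

/-- Purity with the integers `m` and `l`. An extension of the locally free sheaf `M` on
`C_L ∖ {∞}` to a locally free sheaf `𝓜` on `C_L` is the same as the choice of the stalk
`N = 𝓜_∞` inside the generic fibre `M ⊗ Q_L`: a finitely generated `𝒪_{C_L,∞}`-submodule that spans
the generic fibre (it is then free, as `𝒪_{C_L,∞}` is a discrete valuation ring). The stalk of
`𝓜(m·∞)` consists of the `x` with `a • x ∈ N` for all `a ∈ 𝔪_∞ ^ m`. As `τ` is injective, `τ ^ l`
induces an isomorphism `(σ^*)^l 𝓜_∞ → 𝓜(m·∞)_∞` if and only if the `𝒪_{C_L,∞}`-module generated by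
`τ^l(N)`, the image of `(σ^*)^l 𝓜_∞`, equals `𝓜(m·∞)_∞`. -/
def IsPureOfType (τ : M →ₛₗ[frob Fq L X.A] M) (m l : ℕ) : Prop :=
  ∃ N : Submodule (X.localRingInfty L) ((L ⊗[Fq] X.Q) ⊗[L ⊗[Fq] X.A] M),
    N.FG ∧ Submodule.span (L ⊗[Fq] X.Q) (N : Set ((L ⊗[Fq] X.Q) ⊗[L ⊗[Fq] X.A] M)) = ⊤ ∧
    ∀ x, x ∈ Submodule.span (X.localRingInfty L) ((X.genericTau τ)^[l] '' N) ↔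
      ∀ a ∈ IsLocalRing.maximalIdeal X.O ^ m,
        ((1 : L) ⊗ₜ[Fq] algebraMap X.O X.Q a) • x ∈ N
end

end PointedCurve

open PointedCurve

/-- A pure Anderson motive `(M, τ)` of rank `r`, dimension `d` and characteristic `c` over the
finite field `L`. The `A_L`-linear map `σ^* M → M` is given as a `σ^*`-semilinear map `τ : M → M`;
its image is then the `A_L`-span of the range of `τ`, and, `σ^*` being bijective on `A_L` for the
finite field `L`, it is injective if and only if `τ` is. -/
structure PureAndersonMotive {Fq : Type u} [Field Fq] [Fintype Fq] (X : PointedCurve Fq)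
    {L : Type*} [Field L] [Finite L] [Algebra Fq L] (c : X.A →ₐ[Fq] L) (r d : ℕ)
    (M : Type*) [AddCommGroup M] [Module (L ⊗[Fq] X.A) M] where
  τ : M →ₛₗ[frob Fq L X.A] M
  finite : Module.Finite (L ⊗[Fq] X.A) M
  projective : Module.Projective (L ⊗[Fq] X.A) M
  rank_eq : ∀ p : PrimeSpectrum (L ⊗[Fq] X.A), Module.rankAtStalk M p = r
  injective : Function.Injective τ
  coker_dim : Module.rank L (RestrictScalars L (L ⊗[Fq] X.A)
    (M ⧸ Submodule.span (L ⊗[Fq] X.A) (Set.range τ))) = d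
  coker_annihilated : ∀ j ∈ X.characteristicIdeal c ^ d, ∀ x : M,
    j • x ∈ Submodule.span (L ⊗[Fq] X.A) (Set.range τ)
  pure : ∃ m l : ℕ, 0 < m ∧ 0 < l ∧ X.IsPureOfType τ m l

namespace PureAndersonMotive

variable {Fq : Type u} [Field Fq] [Fintype Fq] {X : PointedCurve Fq}
  {L : Type*} [Field L] [Finite L] [Algebra Fq L] {c : X.A →ₐ[Fq] L} {r d : ℕ}
  {M : Type*} [AddCommGroup M] [Module (L ⊗[Fq] X.A) M] (𝓜 : PureAndersonMotive X c r d M)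

/-- The rational number `w` is a weight `m / l` of the motive: `m` and `l` are positive integers as in
the purity condition. -/
def IsWeight (w : ℚ) : Prop :=
  ∃ m l : ℕ, 0 < m ∧ 0 < l ∧ X.IsPureOfType 𝓜.τ m l ∧ w = m / l

/-- The Frobenius endomorphism `π = τ ∘ … ∘ (σ^*)^(e-1) τ : (σ^*)^e M = M → M`, where `#L = q ^ e`. As a
map of sets it is the `e`-th iterate of the semilinear map `τ`. -/
noncomputable def frobenius : M →ₗ[L ⊗[Fq] X.A] M where
  toFun := 𝓜.τ^[Module.finrank Fq L]
  map_add' := iterate_map_add 𝓜.τ _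
  map_smul' := fun a x => by
    have key : ∀ (n : ℕ) (a : L ⊗[Fq] X.A) (x : M),
        𝓜.τ^[n] (a • x) = (frob Fq L X.A)^[n] a • 𝓜.τ^[n] x := by
      intro n
      induction n with
      | zero => intro a x; rfl
      | succ n ih => intro a x; simp only [Function.iterate_succ_apply, map_smulₛₗ, ih]
    rw [key, frob_iterate, RingHom.id_apply]

theorem frobenius_tau (x : M) : 𝓜.frobenius (𝓜.τ x) = 𝓜.τ (𝓜.frobenius x) := by
  change 𝓜.τ^[_] (𝓜.τ x) = 𝓜.τ (𝓜.τ^[_] x)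
  rw [← Function.iterate_succ_apply, Function.iterate_succ_apply']

section
variable (Ls : Type*) [Field Ls] [Algebra Fq Ls] [Algebra L Ls] [IsScalarTower Fq L Ls]
  (v : Ideal X.A)

theorem completedFrob_algebraMap (a : L ⊗[Fq] X.A) :
    X.completedFrob Ls v (algebraMap (L ⊗[Fq] X.A) (X.CompletedCoeff Ls v) a) =
      algebraMap (L ⊗[Fq] X.A) (X.CompletedCoeff Ls v) (frob Fq L X.A a) := by
  have h : ∀ a : L ⊗[Fq] X.A, frob Fq Ls X.A
      (Algebra.TensorProduct.map (IsScalarTower.toAlgHom Fq L Ls) (AlgHom.id Fq X.A) a) =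
      Algebra.TensorProduct.map (IsScalarTower.toAlgHom Fq L Ls) (AlgHom.id Fq X.A)
        (frob Fq L X.A a) := by
    intro a
    induction a with
    | zero => simp
    | add x y hx hy => simp only [map_add, hx, hy]
    | tmul x a => simp
  refine (AdicCompletion.mapRingHom_algebraMap _ _ _ (X.placeIdeal_map_frob Ls v) _).trans ?_
  exact congrArg _ (h a)

/-- The endomorphism `φ` of `M ⊗_{A_L} A_{v,Ls}`, which is the base change to `A_{v,Ls}` of the
local shtuka `M ⊗_{A_L} A_{v,L}` of the motive. -/
noncomputable def completedTau :
    X.CompletedCoeff Ls v ⊗[L ⊗[Fq] X.A] M →ₛₗ[X.completedFrob Ls v]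
      X.CompletedCoeff Ls v ⊗[L ⊗[Fq] X.A] M :=
  semilinearBaseChange (X.completedFrob Ls v) (completedFrob_algebraMap Ls v) 𝓜.τ

theorem completedFrob_Av (b : X.Av v) :
    X.completedFrob Ls v (algebraMap (X.Av v) (X.CompletedCoeff Ls v) b) =
      algebraMap (X.Av v) (X.CompletedCoeff Ls v) b := by
  refine AdicCompletion.mapRingHom_comp_apply _ _ _ _ _ _ ?_ b
  ext a
  simp

/-- The Tate module `T_v M`: the `φ`-invariants of `M ⊗_{A_L} A_{v,Ls}`, where `Ls` is a separable
closure of `L`. -/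
noncomputable def tateModule : Submodule (X.Av v) (X.CompletedCoeff Ls v ⊗[L ⊗[Fq] X.A] M) where
  carrier := {x | 𝓜.completedTau Ls v x = x}
  zero_mem' := map_zero _
  add_mem' := fun {x y} hx hy => by
    change _ = _ at hx hy; change _ = _; rw [map_add, hx, hy]
  smul_mem' := fun b x hx => by
    change _ = _ at hx; change _ = _
    rw [← algebraMap_smul (X.CompletedCoeff Ls v) b x, map_smulₛₗ, completedFrob_Av, hx]

theorem completedTau_frobenius (x : X.CompletedCoeff Ls v ⊗[L ⊗[Fq] X.A] M) :
    𝓜.completedTau Ls v (𝓜.frobenius.baseChange (X.CompletedCoeff Ls v) x) =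
      𝓜.frobenius.baseChange (X.CompletedCoeff Ls v) (𝓜.completedTau Ls v x) := by
  induction x with
  | zero => simp
  | add x y hx hy => simp only [map_add, hx, hy]
  | tmul b m =>
    simp only [completedTau, semilinearBaseChange_tmul, LinearMap.baseChange_tmul, frobenius_tau]

/-- The endomorphism of `T_v M` induced by the Frobenius endomorphism `π`. -/
noncomputable def tateFrobenius : 𝓜.tateModule Ls v →ₗ[X.Av v] 𝓜.tateModule Ls v where
  toFun := fun x => ⟨𝓜.frobenius.baseChange (X.CompletedCoeff Ls v) x.1, by
    change 𝓜.completedTau Ls v _ = _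
    rw [completedTau_frobenius, show 𝓜.completedTau Ls v x.1 = x.1 from x.2]⟩
  map_add' := fun x y => Subtype.ext (map_add _ _ _)
  map_smul' := fun b x => Subtype.ext (by
    change 𝓜.frobenius.baseChange _ (b • x.1) = b • 𝓜.frobenius.baseChange _ x.1
    rw [← algebraMap_smul (X.CompletedCoeff Ls v) b x.1, map_smul, algebraMap_smul])

/-- The rational Tate module `V_v M = T_v M ⊗_{A_v} Q_v`. -/
abbrev RationalTateModule : Type _ := X.Qv v ⊗[X.Av v] 𝓜.tateModule Ls v

/-- The endomorphism `π_v` of `V_v M` induced by the Frobenius endomorphism `π`. -/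
noncomputable def rationalTateFrobenius :
    𝓜.RationalTateModule Ls v →ₗ[X.Qv v] 𝓜.RationalTateModule Ls v :=
  (𝓜.tateFrobenius Ls v).baseChange (X.Qv v)

end
end PureAndersonMotive

namespace PointedCurve
variable {Fq : Type u} [Field Fq] [Fintype Fq] (X : PointedCurve Fq)

/-- The completion `Q_∞` of `Q` at `∞`. -/
abbrev Qinfty : Type u :=
  (IsDiscreteValuationRing.maximalIdeal X.O).adicCompletion X.Q

/-- The normalized absolute value `|x| = q ^ (-ord_∞ x)` on `Q_∞`, where `q = #Fq = #κ(∞)`. -/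
noncomputable def absInfty (x : X.Qinfty) : ℝ :=
  WithZeroMulInt.toNNReal (e := (Fintype.card Fq : NNReal))
    (by exact_mod_cast Fintype.card_ne_zero) (Valued.v x)

/-- The embedding `A → Q → Q_∞`. -/
noncomputable def embInfty : X.A →+* X.Qinfty :=
  (algebraMap X.Q X.Qinfty).comp (algebraMap X.A X.Q)
end PointedCurve

/-! ### Frobenius-semilinear maps over a separably closed field and Lang's theorem. -/

section FrobeniusSemilinear

open Polynomial

/-! The characteristic polynomial of `⋀^i π_v` is identified with that of `⋀^i π` on `M` itself; the
latter is then read at `∞`, where purity turns a twist of a power of `π` into an automorphism of a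
lattice.

At `v`: choose `a ∈ v` with `c a ≠ 0`. The element `1 ⊗ a - c a ⊗ 1` of `J` is a unit modulo `v`,
and its `d`-th power kills the cokernel of `τ`, so the linearization of `τ` is surjective modulo
`v`. Lang's theorem (`span_fixed_eq_top`) then produces a basis of `τ`-fixed vectors modulo `v`, and
successive approximation lifts it to a basis of fixed vectors of `M ⊗ A_{v,Ls}`
(`exists_basis_completedTau_fixed`). Since the `σ^*`-invariants of `A_{v,Ls}` are `A_v`, this is
also a basis of the Tate module, and `π` and `π_v` have the same matrix in it.

Descent to `A`: the coefficients of the characteristic polynomial come both from `A_L` and from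
`A_v`. Those from `A_v` are `σ^*`-invariant, and the invariants of `A_L` are `A`. This gives one
polynomial `P` over `A` which is also the characteristic polynomial of `⋀^i π` on `M ⊗ K` for every
field `K` over `A_L` (`exists_charpoly`). As `M` is only projective, it is treated as a direct
summand of a free module, at the price of powers of `X` that cancel at the end.

At `∞`: let `N` be the stalk given by purity with integers `m, l`, and let `ϖ` be a uniformizer.
Then `τ^l N = ϖ^(-m) N`. Iterating `e` times and using `τ^e = π` shows that `ϖ^(m e) π^l` maps `N`
onto itself (`exists_lattice`). The eigenvalues of its exterior powers are integral over the local
ring, and so are their inverses, hence they have absolute value one. An eigenvalue `α` of `⋀^i π`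
therefore satisfies `|ϖ|^(m e i) |α|^l = 1`, and `|ϖ| = 1/q` gives `|α| = q^(e i m / l) = s^(i m /
l)` (`abv_eq_of_isRoot`). -/

theorem FiniteField.mem_range_algebraMap_of_pow_card_eq (k : Type*) {E : Type*} [Field k] [Fintype k]
    [Field E] [Algebra k E] {x : E} (hx : x ^ Fintype.card k = x) :
    x ∈ Set.range (algebraMap k E) := by
  have hsplit : (X ^ Fintype.card k - X : k[X]).Splits := by
    rw [splits_iff_card_roots, FiniteField.roots_X_pow_card_sub_X,
      FiniteField.X_pow_card_sub_X_natDegree_eq k Fintype.one_lt_card]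
    rfl
  have h0 : (X ^ Fintype.card k - X : k[X]) ≠ 0 :=
    FiniteField.X_pow_card_sub_X_ne_zero k Fintype.one_lt_card
  have hroot : x ∈ ((X ^ Fintype.card k - X : k[X]).map (algebraMap k E)).roots := by
    rw [mem_roots (Polynomial.map_ne_zero h0)]
    simp [hx]
  rw [hsplit.roots_map] at hroot
  obtain ⟨y, -, hy⟩ := Multiset.mem_map.mp hroot
  exact ⟨y, hy⟩

variable {E : Type*} [Field E]

/-- The coefficients, as polynomials in the last one, of a vector in the span of
`v, τ v, …, τ ^ m v` that is fixed by a `q`-semilinear map `τ`. -/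
noncomputable def cyclicFixedPolynomial (q : ℕ) (a : ℕ → E) : ℕ → E[X]
  | 0 => C (a 0) * X ^ q
  | i + 1 => cyclicFixedPolynomial q a i ^ q + C (a (i + 1)) * X ^ q

theorem cyclicFixedPolynomial_eval_zero {q : ℕ} (hq : 1 < q) (a : ℕ → E) (i : ℕ) :
    (cyclicFixedPolynomial q a i).eval 0 = 0 := by
  induction i with
  | zero => simp [cyclicFixedPolynomial, show q ≠ 0 by omega]
  | succ i ih => simp [cyclicFixedPolynomial, show q ≠ 0 by omega, ih]

theorem cyclicFixedPolynomial_derivative {q : ℕ} (hq : (q : E) = 0) (a : ℕ → E) (i : ℕ) :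
    derivative (cyclicFixedPolynomial q a i) = 0 := by
  cases i <;> simp [cyclicFixedPolynomial, derivative_pow, hq]

/-- Once a term is nonzero its degree is at least `q`. Its `q`-th power then has degree at least `q
^ 2 > q`, so the next summand `a X ^ q` cannot cancel the leading term. -/
theorem cyclicFixedPolynomial_natDegree {q : ℕ} (hq : 1 < q) (a : ℕ → E) (i : ℕ) :
    (∀ j ≤ i, a j = 0) ∨ q ≤ (cyclicFixedPolynomial q a i).natDegree := by
  induction i with
  | zero =>
    by_cases h : a 0 = 0
    · left; intro j hj; rwa [Nat.le_zero.mp hj]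
    · right; simp [cyclicFixedPolynomial, h]
  | succ i ih =>
    rcases ih with h | h
    · by_cases h' : a (i + 1) = 0
      · left; intro j hj
        rcases Nat.le_succ_iff.mp hj with h1 | h1
        · exact h j h1
        · rwa [h1]
      · right
        have h0 : ∀ j ≤ i, cyclicFixedPolynomial q a j = 0 := by
          intro j hj
          induction j with
          | zero => simp [cyclicFixedPolynomial, h 0 hj]
          | succ j ih =>
            simp [cyclicFixedPolynomial, h _ hj, ih (by omega), show q ≠ 0 by omega]
        simp [cyclicFixedPolynomial, h0 i le_rfl, show q ≠ 0 by omega, h']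
    · right
      have h1 : q * q ≤ (cyclicFixedPolynomial q a i ^ q).natDegree := by
        rw [natDegree_pow]; gcongr
      rw [cyclicFixedPolynomial, natDegree_add_eq_left_of_natDegree_lt]
      · nlinarith
      · refine (natDegree_C_mul_X_pow_le _ _).trans_lt ?_
        nlinarith

/-- In characteristic dividing `q` the polynomial `f_m - X` has derivative `-1`, so it is separable.
Its degree is at least two and zero is a simple root, so the cofactor of `X` has a root, and that
root is not zero. -/
theorem exists_cyclicFixedPolynomial_eval_eq [IsSepClosed E] {q : ℕ} (hq1 : 1 < q)
    (hq : (q : E) = 0) (a : ℕ → E) (m : ℕ) (ha : ∃ j ≤ m, a j ≠ 0) :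
    ∃ b : E, b ≠ 0 ∧ (cyclicFixedPolynomial q a m).eval b = b := by
  set f : E[X] := cyclicFixedPolynomial q a m - X with hf
  have hder : derivative f = -1 := by simp [hf, cyclicFixedPolynomial_derivative hq]
  have hsep : f.Separable := by
    rw [Polynomial.Separable, hder]
    exact isCoprime_one_right.neg_right
  have hdeg : 2 ≤ f.natDegree := by
    have := (cyclicFixedPolynomial_natDegree hq1 a m).resolve_left (by push Not; exact ha)
    rw [hf, natDegree_sub_eq_left_of_natDegree_lt]
    · omega
    · rw [natDegree_X]; omega
  have hX : X ∣ f := by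
    rw [X_dvd_iff, coeff_zero_eq_eval_zero]
    simp [hf, cyclicFixedPolynomial_eval_zero hq1]
  obtain ⟨g, hg⟩ := hX
  have hg0 : g ≠ 0 := by rintro rfl; simp at hg; simp [hg] at hdeg
  have hgdeg : g.degree ≠ 0 := by
    intro h
    have h1 : f.natDegree = 1 + g.natDegree := by rw [hg, natDegree_mul X_ne_zero hg0, natDegree_X]
    have := natDegree_eq_of_degree_eq_some (n := 0) h
    omega
  obtain ⟨b, hb⟩ := IsSepClosed.exists_root g hgdeg (hsep.of_dvd ⟨X, by rw [hg, mul_comm]⟩)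
  refine ⟨b, ?_, ?_⟩
  -- If `0` were a root of `g`, it would be a double root of `f = X g`, against `f' = -1`.
  · rintro rfl
    have h1 := congrArg (eval 0) hder
    rw [hg] at h1
    simp [hb.eq_zero] at h1
  · have : eval b f = 0 := by rw [hg, eval_mul, hb.eq_zero, mul_zero]
    simpa [hf, sub_eq_zero] using this

variable {k : Type*} [Field k] [Fintype k] [Algebra k E]
  {W : Type*} [AddCommGroup W] [Module E W]

theorem FiniteField.cast_card_eq_zero_of_algebra : (Fintype.card k : E) = 0 := by
  rw [← map_natCast (algebraMap k E), FiniteField.cast_card_eq_zero, map_zero]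

/-- An injective Frobenius-semilinear endomorphism of a nonzero finite-dimensional space over a
separably closed field has a nonzero fixed vector. -/
theorem exists_ne_zero_fixed [IsSepClosed E] [Module.Finite E W] [Nontrivial W] (τ : W →+ W)
    (hτ : ∀ (c : E) x, τ (c • x) = c ^ Fintype.card k • τ x) (hinj : Function.Injective τ) :
    ∃ x, x ≠ 0 ∧ τ x = x := by
  obtain ⟨v, hv⟩ := exists_ne (0 : W)
  let S : ℕ →o Submodule E W :=
    ⟨fun n => Submodule.span E ((fun i => τ^[i] v) '' Set.Iio n), fun a b hab =>
      Submodule.span_mono (Set.image_mono (Set.Iio_subset_Iio hab))⟩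
  have hex : ∃ n, τ^[n] v ∈ S n := by
    obtain ⟨n, hn⟩ := monotone_stabilizes_iff_noetherian.mpr (inferInstance : IsNoetherian E W) S
    refine ⟨n, ?_⟩
    rw [hn (n + 1) (Nat.le_succ n)]
    exact Submodule.subset_span ⟨n, by simp, rfl⟩
  classical
  -- The first linear relation among the iterates of `v`. Minimality is used again below, to see
  -- that the fixed vector is not zero.
  obtain ⟨n, hn, hmin⟩ : ∃ n, τ^[n] v ∈ S n ∧ ∀ j < n, τ^[j] v ∉ S j :=
    ⟨Nat.find hex, Nat.find_spec hex, fun j hj => Nat.find_min hex hj⟩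
  have hτ0 : ∀ n, τ^[n] v ≠ 0 := fun n h => hv (hinj.iterate n (by rw [h, iterate_map_zero]))
  obtain ⟨m, rfl⟩ : ∃ m, n = m + 1 := by
    cases n with
    | zero =>
      have : v ∈ Submodule.span E ((fun i => τ^[i] v) '' Set.Iio 0) := hn
      simp at this
      exact absurd this hv
    | succ m => exact ⟨m, rfl⟩
  obtain ⟨a, ha⟩ : ∃ a : ℕ → E, ∑ i ∈ Finset.range (m + 1), a i • τ^[i] v = τ^[m + 1] v := by
    have : τ^[m + 1] v ∈ Submodule.span E ((fun i => τ^[i] v) '' (Finset.range (m + 1) : Set ℕ)) := by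
      have h : (Finset.range (m + 1) : Set ℕ) = Set.Iio (m + 1) := by ext; simp
      rw [h]; exact hn
    obtain ⟨a, ha⟩ := (Submodule.mem_span_image_finset_iff_exists_fun E).mp this
    refine ⟨fun i => if h : i ∈ Finset.range (m + 1) then a ⟨i, h⟩ else 0, ?_⟩
    rw [← ha, ← Finset.sum_coe_sort]
    exact Finset.sum_congr rfl fun i _ => by beta_reduce; rw [dif_pos i.2]
  have ha0 : ∃ j ≤ m, a j ≠ 0 := by
    by_contra! h
    refine hτ0 (m + 1) ?_
    rw [← ha]
    exact Finset.sum_eq_zero fun i hi => by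
      rw [h i (Nat.lt_succ_iff.mp (Finset.mem_range.mp hi)), zero_smul]
  -- For `x = ∑ c i • τ^[i] v`, comparison of coefficients in `τ x = x` reads `c 0 = a 0 * b ^ q`
  -- and `c (i + 1) = c i ^ q + a (i + 1) * b ^ q` with `b = c m`. All coefficients are thus
  -- determined by `b`, and the only remaining condition is that the polynomial for index `m` takes
  -- the value `b` at `b`.
  obtain ⟨b, hb0, hb⟩ := exists_cyclicFixedPolynomial_eval_eq (q := Fintype.card k)
    Fintype.one_lt_card FiniteField.cast_card_eq_zero_of_algebra a m ha0
  set q := Fintype.card k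
  let c : ℕ → E := fun i => (cyclicFixedPolynomial q a i).eval b
  have hc0 : c 0 = a 0 * b ^ q := by simp [c, cyclicFixedPolynomial]
  have hcs : ∀ i, c (i + 1) = c i ^ q + a (i + 1) * b ^ q := by
    intro i; simp [c, cyclicFixedPolynomial]
  refine ⟨∑ i ∈ Finset.range (m + 1), c i • τ^[i] v, fun h => ?_, ?_⟩
  · rw [Finset.sum_range_succ, show c m = b from hb] at h
    refine hmin m (Nat.lt_succ_self m) ?_
    have h1 : τ^[m] v = -(b⁻¹ • ∑ i ∈ Finset.range m, c i • τ^[i] v) := by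
      rw [eq_neg_of_add_eq_zero_left h, smul_neg, neg_neg, smul_smul, inv_mul_cancel₀ hb0, one_smul]
    rw [h1]
    exact neg_mem (Submodule.smul_mem _ _ (Submodule.sum_mem _ fun i hi =>
      Submodule.smul_mem _ _ (Submodule.subset_span ⟨i, Finset.mem_range.mp hi, rfl⟩)))
  · rw [map_sum]
    simp only [hτ, ← Function.iterate_succ_apply' τ]
    rw [Finset.sum_range_succ, show c m = b from hb, ← ha, Finset.sum_range_succ' (fun i => a i • _),
      Finset.sum_range_succ' (fun i => c i • _), hc0, smul_add, ← add_assoc, Finset.smul_sum,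
      ← Finset.sum_add_distrib, smul_smul, mul_comm (b ^ q)]
    congr 1
    refine Finset.sum_congr rfl fun i _ => ?_
    rw [hcs, add_smul, smul_smul, mul_comm (b ^ q)]

/-- The images of a basis span, so by counting they form a basis; `τ` sends coordinates `c i` to
coordinates `c i ^ q` in it, and these vanish only if the `c i` do. -/
theorem injective_of_span_range_eq_top [Module.Finite E W] (τ : W →+ W) {q : ℕ} (hq : q ≠ 0)
    (hτ : ∀ (c : E) x, τ (c • x) = c ^ q • τ x)
    (hspan : Submodule.span E (Set.range τ) = ⊤) : Function.Injective τ := by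
  let b := Module.finBasis E W
  have hsum : ∀ c : Fin (Module.finrank E W) → E, τ (∑ i, c i • b i) = ∑ i, c i ^ q • τ (b i) := by
    intro c; simp only [map_sum, hτ]
  have hb : ⊤ ≤ Submodule.span E (Set.range fun i => τ (b i)) := by
    rw [← hspan, Submodule.span_le]
    rintro _ ⟨x, rfl⟩
    rw [← b.sum_repr x, hsum]
    exact Submodule.sum_mem _ fun i _ =>
      Submodule.smul_mem _ _ (Submodule.subset_span ⟨i, rfl⟩)
  have hli := linearIndependent_of_top_le_span_of_card_eq_finrank hb (by simp)
  rw [injective_iff_map_eq_zero]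
  intro x hx
  rw [← b.sum_repr x, hsum] at hx
  have := Fintype.linearIndependent_iff.mp hli _ hx
  rw [← b.sum_repr x]
  exact Finset.sum_eq_zero fun i _ => by rw [pow_eq_zero_iff hq |>.mp (this i), zero_smul]

theorem IsSepClosed.exists_pow_card_sub_eq (k : Type*) [Field k] [Fintype k] [Algebra k E]
    [IsSepClosed E] (c : E) : ∃ x : E, x ^ Fintype.card k - x = c := by
  obtain ⟨x, hx⟩ := IsSepClosed.exists_root_C_mul_X_pow_add_C_mul_X_add_C (n := Fintype.card k)
    (1 : E) (-1) (-c) FiniteField.cast_card_eq_zero_of_algebra Fintype.one_lt_card (by simp)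
  exact ⟨x, by linear_combination hx⟩

/-- `τ - 1` is surjective on the span of the vectors fixed by a Frobenius-semilinear `τ`. -/
theorem exists_sub_eq_of_mem_span_fixed [IsSepClosed E] (τ : W →+ W)
    (hτ : ∀ (c : E) x, τ (c • x) = c ^ Fintype.card k • τ x) {y : W}
    (hy : y ∈ Submodule.span E {x | τ x = x}) :
    ∃ x ∈ Submodule.span E {x | τ x = x}, τ x - x = y := by
  induction hy using Submodule.span_induction with
  | mem x hx =>
    obtain ⟨d, hd⟩ := IsSepClosed.exists_pow_card_sub_eq k (1 : E)
    refine ⟨d • x, Submodule.smul_mem _ _ (Submodule.subset_span hx), ?_⟩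
    rw [hτ, show τ x = x from hx, ← sub_smul, hd, one_smul]
  | zero => exact ⟨0, zero_mem _, by simp⟩
  | add x y _ _ hx hy =>
    obtain ⟨x', hx', h1⟩ := hx
    obtain ⟨y', hy', h2⟩ := hy
    exact ⟨x' + y', add_mem hx' hy', by rw [map_add, ← h1, ← h2]; abel⟩
  | smul a x hx ih =>
    -- The map `τ - 1` is not `E`-linear, so a preimage of `x` is of no use for `a • x`. A second
    -- induction treats all scalars at once.
    clear ih
    induction hx using Submodule.span_induction generalizing a with
    | mem x hx =>
      obtain ⟨d, hd⟩ := IsSepClosed.exists_pow_card_sub_eq k a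
      refine ⟨d • x, Submodule.smul_mem _ _ (Submodule.subset_span hx), ?_⟩
      rw [hτ, show τ x = x from hx, ← sub_smul, hd]
    | zero => exact ⟨0, zero_mem _, by simp⟩
    | add x y _ _ hx hy =>
      obtain ⟨x', hx', h1⟩ := hx a
      obtain ⟨y', hy', h2⟩ := hy a
      exact ⟨x' + y', add_mem hx' hy', by rw [map_add, smul_add, ← h1, ← h2]; abel⟩
    | smul b x _ ih => rw [smul_smul]; exact ih (a * b)

/-- **Lang's theorem** for the general linear group: a finite-dimensional space over a separably
closed field with a Frobenius-semilinear endomorphism whose linearization is surjective is spanned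
by fixed vectors. -/
theorem span_fixed_eq_top [IsSepClosed E] [Module.Finite E W] (τ : W →+ W)
    (hτ : ∀ (c : E) x, τ (c • x) = c ^ Fintype.card k • τ x)
    (hspan : Submodule.span E (Set.range τ) = ⊤) : Submodule.span E {x | τ x = x} = ⊤ := by
  set F := Submodule.span E {x | τ x = x} with hF
  by_contra hne
  have hstab : ∀ x ∈ F, τ x ∈ F := by
    intro x hx
    induction hx using Submodule.span_induction with
    | mem x hx => rw [show τ x = x from hx]; exact Submodule.subset_span hx
    | zero => rw [map_zero]; exact zero_mem _
    | add x y _ _ hx hy => rw [map_add]; exact add_mem hx hy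
    | smul a x _ hx => rw [hτ]; exact Submodule.smul_mem _ _ hx
  have : Nontrivial (W ⧸ F) := Submodule.Quotient.nontrivial_iff.mpr hne
  let τ' : W ⧸ F →+ W ⧸ F := QuotientAddGroup.map F.toAddSubgroup F.toAddSubgroup τ hstab
  have hmk : ∀ x, τ' (Submodule.Quotient.mk x) = Submodule.Quotient.mk (τ x) := fun x => rfl
  have hτ' : ∀ (c : E) x, τ' (c • x) = c ^ Fintype.card k • τ' x := by
    intro c x
    obtain ⟨x, rfl⟩ := Submodule.Quotient.mk_surjective _ x
    rw [← Submodule.Quotient.mk_smul, hmk, hmk, hτ, Submodule.Quotient.mk_smul]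
  have hspan' : Submodule.span E (Set.range τ') = ⊤ := by
    have h1 : (Submodule.span E (Set.range τ)).map F.mkQ = ⊤ := by
      rw [hspan, Submodule.map_top, Submodule.range_mkQ]
    rw [Submodule.map_span] at h1
    rw [← top_le_iff, ← h1]
    apply Submodule.span_mono
    rintro _ ⟨_, ⟨x, rfl⟩, rfl⟩
    exact ⟨Submodule.Quotient.mk x, rfl⟩
  -- A nonzero fixed vector of the quotient lifts to `x` with `τ x - x` in `F`. Since `τ - 1` is
  -- surjective on `F`, a correction of `x` by an element of `F` is truly fixed, so `x` lies in `F`,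
  -- a contradiction.
  obtain ⟨x, hx0, hx⟩ := exists_ne_zero_fixed τ' hτ'
    (injective_of_span_range_eq_top τ' Fintype.card_ne_zero hτ' hspan')
  obtain ⟨x, rfl⟩ := Submodule.Quotient.mk_surjective _ x
  rw [hmk, Submodule.Quotient.eq] at hx
  obtain ⟨y, hy, hxy⟩ := exists_sub_eq_of_mem_span_fixed τ hτ hx
  refine hx0 ((Submodule.Quotient.mk_eq_zero F).mpr ?_)
  have : x - y ∈ F := Submodule.subset_span (by
    change τ (x - y) = x - y
    rw [map_sub, sub_eq_sub_iff_sub_eq_sub, hxy])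
  simpa using add_mem this hy

end FrobeniusSemilinear

/-! ### Fixed bases over the residue ring at a place. -/

section ResidueFixedBasis

variable {k κ E S W : Type*} [Field k] [Fintype k] [Field κ] [Algebra k κ] [Module.Finite k κ]
  [Field E] [Algebra k E] [IsSepClosed E] [CommRing S] [Algebra E S] [Algebra κ S]
  [AddCommGroup W] [Module S W] [Module E W] [Module κ W] [Module k W]
  [IsScalarTower E S W] [IsScalarTower κ S W] [IsScalarTower k κ W] [IsScalarTower k E W]

/-- An `E`-basis consisting of fixed vectors exists by Lang's theorem. The coordinates of any fixed
vector in it satisfy `x ^ q = x`, hence lie in `k`, so it is a `k`-basis of the fixed space. -/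
theorem finrank_fixed_eq [Module.Finite E W] (τ : W →+ W)
    (hτ : ∀ (c : E) x, τ (c • x) = c ^ Fintype.card k • τ x)
    (hspan : Submodule.span E (Set.range τ) = ⊤)
    (T : Submodule k W) (hT : ∀ x, x ∈ T ↔ τ x = x) :
    Module.Finite k T ∧ Module.finrank k T = Module.finrank E W := by
  let u := Module.Basis.ofSpan (span_fixed_eq_top τ hτ hspan).ge
  have hu : ∀ i, τ (u i) = u i := by
    intro i
    exact Module.Basis.ofSpan_subset (span_fixed_eq_top τ hτ hspan).ge ⟨i, rfl⟩
  have : Fintype ((linearIndepOn_empty E id).extend (Set.empty_subset {x | τ x = x})) :=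
    Fintype.ofFinite _
  let b : Module.Basis _ k T := Module.Basis.mk (v := fun i => (⟨u i, (hT _).mpr (hu i)⟩ : T)) (by
      refine LinearIndependent.of_comp T.subtype ?_
      exact (u.linearIndependent.restrict_scalars' k)) (by
      rintro ⟨x, hx⟩ -
      have hc : ∀ i, ∃ c : k, algebraMap k E c = u.repr x i := by
        intro i
        refine FiniteField.mem_range_algebraMap_of_pow_card_eq k ?_
        have h1 : ∑ j, (u.repr x j) ^ Fintype.card k • u j = ∑ j, u.repr x j • u j := by
          have := (hT x).mp hx
          rw [← u.sum_repr x, map_sum] at this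
          simpa only [hτ, hu, u.sum_repr] using this
        simpa only [u.repr_sum_self] using congrArg (fun y => u.repr y i) h1
      choose c hc using hc
      have : (⟨x, hx⟩ : T) = ∑ i, c i • ⟨u i, (hT _).mpr (hu i)⟩ := by
        ext
        rw [Submodule.coe_sum]
        conv_lhs => rw [show ((⟨x, hx⟩ : T) : W) = x from rfl, ← u.sum_repr x]
        refine Finset.sum_congr rfl fun i _ => ?_
        rw [← hc, algebraMap_smul]; rfl
      rw [this]
      exact Submodule.sum_mem _ fun i _ =>
        Submodule.smul_mem _ _ (Submodule.subset_span ⟨i, rfl⟩))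
  exact ⟨Module.Finite.of_basis b, by
    rw [Module.finrank_eq_card_basis b, Module.finrank_eq_card_basis u]⟩

/-- The ring `S` need not be a field, so `W` is not known to be free beforehand. The fixed vectors
form a `κ`-space `T`, and the map from a free `S`-module of rank `dim_κ T` to `W` is surjective by
Lang's theorem. It is injective by counting: `dim_E S ≤ [κ : k]`, so the source has `E`-dimension at
most `dim_k T = dim_E W`. -/
theorem exists_residue_basis_fixed [Module.Finite S W] (τ : W →+ W)
    (hτ : ∀ (c : E) x, τ (c • x) = c ^ Fintype.card k • τ x)
    (hτκ : ∀ (c : κ) x, τ (c • x) = c • τ x)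
    (hspan : Submodule.span E (Set.range τ) = ⊤)
    (hS : Submodule.span E (Set.range (algebraMap κ S)) = ⊤)
    [Algebra k S] [IsScalarTower k E S] [IsScalarTower k κ S] :
    ∃ (n : ℕ) (b : Module.Basis (Fin n) S W), ∀ i, τ (b i) = b i := by
  let f := Module.finBasis k κ
  have hf : Submodule.span E (Set.range fun j => algebraMap κ S (f j)) = ⊤ := by
    rw [← top_le_iff, ← hS, Submodule.span_le]
    rintro _ ⟨c, rfl⟩
    rw [← f.sum_repr c, map_sum]
    refine Submodule.sum_mem _ fun j _ => ?_
    rw [Algebra.smul_def, map_mul, ← IsScalarTower.algebraMap_apply,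
      IsScalarTower.algebraMap_apply k E S, ← Algebra.smul_def]
    exact Submodule.smul_mem _ _ (Submodule.subset_span ⟨j, rfl⟩)
  have hfinS : Module.Finite E S := ⟨⟨(Set.finite_range fun j => algebraMap κ S (f j)).toFinset, by
    rw [Set.Finite.coe_toFinset, hf]⟩⟩
  have hrankS : Module.finrank E S ≤ Module.finrank k κ := by
    have := finrank_range_le_card (R := E) fun j => algebraMap κ S (f j)
    rwa [Set.finrank, hf, finrank_top, Fintype.card_fin] at this
  have : Module.Finite E W := Module.Finite.trans S W
  let T : Submodule κ W :=
    { carrier := {x | τ x = x}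
      zero_mem' := map_zero τ
      add_mem' := fun {x y} hx hy => by
        change _ = _ at hx hy; change _ = _; rw [map_add, hx, hy]
      smul_mem' := fun c x hx => by
        change _ = _ at hx; change _ = _; rw [hτκ, hx] }
  obtain ⟨hfin, hrank⟩ := finrank_fixed_eq τ hτ hspan (T.restrictScalars k) fun x => Iff.rfl
  have hfin' : Module.Finite k T := hfin
  have hrank' : Module.finrank k T = Module.finrank E W := hrank
  have hTκ : Module.Finite κ T := Module.Finite.of_restrictScalars_finite k κ T
  let t := Module.finBasis κ T
  let g : (Fin (Module.finrank κ T) → S) →ₗ[S] W := Fintype.linearCombination S fun i => (t i : W)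
  have hg : Function.Surjective g := by
    rw [← LinearMap.range_eq_top, ← top_le_iff]
    intro x _
    have hx : x ∈ Submodule.span E {x | τ x = x} := by
      rw [span_fixed_eq_top τ hτ hspan]; trivial
    refine (Submodule.span_le (p := (LinearMap.range g).restrictScalars E)).mpr ?_ hx
    intro y hy
    have h1 : y = ∑ i, t.repr ⟨y, hy⟩ i • (t i : W) := by
      have := congrArg (Subtype.val) (t.sum_repr ⟨y, hy⟩)
      rw [Submodule.coe_sum] at this
      exact this.symm
    refine ⟨fun i => algebraMap κ S (t.repr ⟨y, hy⟩ i), ?_⟩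
    conv_rhs => rw [h1]
    simp [g, Fintype.linearCombination_apply]
  have hle : Module.finrank E (Fin (Module.finrank κ T) → S) ≤ Module.finrank E W := by
    rw [Module.finrank_pi_fintype, Finset.sum_const, Finset.card_univ, Fintype.card_fin, smul_eq_mul,
      ← hrank', ← Module.finrank_mul_finrank k κ T, mul_comm]
    gcongr
  have hinj : Function.Injective g := by
    have h1 := LinearMap.finrank_le_finrank_of_surjective (f := g.restrictScalars E) hg
    exact (LinearMap.injective_iff_surjective_of_finrank_eq_finrank (f := g.restrictScalars E)
      (le_antisymm hle h1)).mpr hg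
  refine ⟨_, Module.Basis.ofEquivFun (LinearEquiv.ofBijective g ⟨hinj, hg⟩).symm, fun i => ?_⟩
  have : Module.Basis.ofEquivFun (LinearEquiv.ofBijective g ⟨hinj, hg⟩).symm i = t i := by
    simp only [Module.Basis.coe_ofEquivFun, LinearEquiv.symm_symm]
    exact (Fintype.linearCombination_apply_single S _ i 1).trans (one_smul _ _)
  rw [this]
  exact (t i).2

end ResidueFixedBasis

/-! ### Lifting fixed vectors by adic approximation. -/

section AdicLift

theorem exists_dual_family (R V : Type*) [CommRing R] [AddCommGroup V] [Module R V]
    [Module.Finite R V] [Module.Projective R V] :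
    ∃ (n : ℕ) (e : Fin n → V) (f : Fin n → V →ₗ[R] R), ∀ x, ∑ i, f i x • e i = x := by
  obtain ⟨n, p, s, -, -, h⟩ := Module.Finite.exists_comp_eq_id_of_projective R V
  refine ⟨n, fun i => p (Pi.single i 1), fun i => LinearMap.proj i ∘ₗ s, fun x => ?_⟩
  have h1 := LinearMap.congr_fun h x
  rw [LinearMap.comp_apply, LinearMap.id_apply] at h1
  conv_rhs => rw [← h1, pi_eq_sum_univ' (s x)]
  simp only [map_sum, map_smul]
  refine Finset.sum_congr rfl fun i _ => ?_
  simp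

/-- A finite projective module is a direct summand of a free one; the coordinate forms carry `I ^ m
V` into `I ^ m`, so limits and separation are checked on coordinates. -/
theorem IsAdicComplete.of_finite_projective {R : Type*} (V : Type*) [CommRing R]
    [AddCommGroup V] [Module R V]
    [Module.Finite R V] [Module.Projective R V] (I : Ideal R) [IsAdicComplete I R] :
    IsAdicComplete I V := by
  obtain ⟨n, e, f, h⟩ := exists_dual_family R V
  have hf : ∀ i m (x : V), x ∈ (I ^ m • ⊤ : Submodule R V) → f i x ∈ (I ^ m • ⊤ : Ideal R) := by
    intro i m x hx
    have := Submodule.mem_map_of_mem (f := f i) hx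
    rw [Submodule.map_smul''] at this
    exact Submodule.smul_mono le_rfl le_top this
  refine { haus' := fun x hx => ?_, prec' := fun x hx => ?_ }
  · rw [← h x]
    refine Finset.sum_eq_zero fun i _ => ?_
    rw [IsHausdorff.haus (inferInstance : IsHausdorff I R) (f i x) fun m => ?_, zero_smul]
    exact SModEq.zero.mpr (hf i m x (SModEq.zero.mp (hx m)))
  · have h1 : ∀ i, ∃ r : R, ∀ m, f i (x m) ≡ r [SMOD (I ^ m • ⊤ : Ideal R)] := fun i =>
      IsPrecomplete.prec (inferInstance : IsPrecomplete I R) fun {m m'} hmm => by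
        rw [SModEq.sub_mem, ← map_sub]
        exact hf i m _ (SModEq.sub_mem.mp (hx hmm))
    choose r hr using h1
    refine ⟨∑ i, r i • e i, fun m => ?_⟩
    rw [SModEq.sub_mem]
    have h1 : x m - ∑ i, r i • e i = ∑ i, (f i (x m) • e i - r i • e i) := by
      rw [Finset.sum_sub_distrib, h]
    rw [h1]
    refine Submodule.sum_mem _ fun i _ => ?_
    rw [← sub_smul]
    refine Submodule.smul_mem_smul ?_ trivial
    simpa using SModEq.sub_mem.mp (hr i m)

variable {A R V : Type*} [CommRing A] [CommRing R] [Algebra A R] [AddCommGroup V] [Module R V]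
  (v : Ideal A)

/-- As the ideal is extended from `A`, additive statements about `I ^ n V` need only be checked on
multiples by elements of `A`. Those scalars are fixed by `φ`, so `τ` commutes with them. -/
theorem map_pow_smul_top_induction (n : ℕ) {p : V → Prop}
    (hadd : ∀ x y, p x → p y → p (x + y))
    (hsmul : ∀ a ∈ v ^ n, ∀ x : V, p (algebraMap A R a • x)) {y : V}
    (hy : y ∈ (v.map (algebraMap A R) ^ n • ⊤ : Submodule R V)) : p y := by
  rw [← Ideal.map_pow] at hy
  refine Submodule.smul_induction_on hy (fun r hr x _ => ?_) hadd
  have h0 : ∀ x : V, p x → p x := fun _ h => h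
  unfold Ideal.map at hr
  induction hr using Submodule.span_induction generalizing x with
  | mem r hr => obtain ⟨a, ha, rfl⟩ := hr; exact hsmul a ha x
  | zero => simpa using hsmul 0 (zero_mem _) x
  | add r s _ _ hr hs => rw [add_smul]; exact hadd _ _ (hr x trivial) (hs x trivial)
  | smul a r _ hr => rw [smul_assoc, smul_comm]; exact hr (a • x) trivial

variable (φ : R →+* R) (hφ : ∀ a, φ (algebraMap A R a) = algebraMap A R a) (τ : V →+ V)
  (hτ : ∀ r x, τ (r • x) = φ r • τ x)
include hφ hτ

theorem semilinear_mem_pow_smul_top {n : ℕ} {y : V}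
    (hy : y ∈ (v.map (algebraMap A R) ^ n • ⊤ : Submodule R V)) :
    τ y ∈ (v.map (algebraMap A R) ^ n • ⊤ : Submodule R V) := by
  refine map_pow_smul_top_induction v n (p := fun y => τ y ∈ _) (fun x y hx hy => ?_) (fun a ha x => ?_) hy
  · rw [map_add]; exact add_mem hx hy
  · rw [hτ, hφ, ← Ideal.map_pow]
    exact Submodule.smul_mem_smul (Ideal.mem_map_of_mem _ ha) trivial

/-- Successive approximation: if `τ - 1` is surjective modulo `v`, then vectors fixed modulo `v`
lift to fixed vectors. -/
theorem exists_fixed_lift [IsAdicComplete (v.map (algebraMap A R)) V]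
    (hH : ∀ y, ∃ x, τ x - x - y ∈ (v.map (algebraMap A R) • ⊤ : Submodule R V)) (x₀ : V)
    (hx₀ : τ x₀ - x₀ ∈ (v.map (algebraMap A R) • ⊤ : Submodule R V)) :
    ∃ x, τ x = x ∧ x - x₀ ∈ (v.map (algebraMap A R) • ⊤ : Submodule R V) := by
  set I := v.map (algebraMap A R) with hI
  -- Surjectivity of `τ - 1` modulo `v` passes to every graded piece: a solution for `y` multiplied
  -- by `a ∈ v ^ n` is a solution for `a • y`.
  have step : ∀ n (y : V), y ∈ (I ^ n • ⊤ : Submodule R V) →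
      ∃ x ∈ (I ^ n • ⊤ : Submodule R V), τ x - x - y ∈ (I ^ (n + 1) • ⊤ : Submodule R V) := by
    intro n y hy
    refine map_pow_smul_top_induction v n (p := fun y => ∃ x ∈ (I ^ n • ⊤ : Submodule R V),
      τ x - x - y ∈ (I ^ (n + 1) • ⊤ : Submodule R V)) ?_ ?_ hy
    · rintro y y' ⟨x, hx, h⟩ ⟨x', hx', h'⟩
      refine ⟨x + x', add_mem hx hx', ?_⟩
      have : τ (x + x') - (x + x') - (y + y') = (τ x - x - y) + (τ x' - x' - y') := by
        rw [map_add]; abel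
      rw [this]; exact add_mem h h'
    · intro a ha y
      obtain ⟨x, hx⟩ := hH y
      have ha' : algebraMap A R a ∈ I ^ n := by
        rw [hI, ← Ideal.map_pow]; exact Ideal.mem_map_of_mem _ ha
      refine ⟨algebraMap A R a • x, Submodule.smul_mem_smul ha' trivial, ?_⟩
      rw [hτ, hφ, ← smul_sub, ← smul_sub, pow_succ, mul_smul]
      exact Submodule.smul_mem_smul ha' hx
  choose! c hc hc' using step
  -- The term `s n` is fixed modulo `I ^ (n + 1)`, whence the shifted index: the correction lies in
  -- `I ^ (n + 1)` and makes the next term fixed modulo `I ^ (n + 2)`.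
  let s : ℕ → V := fun n => Nat.rec x₀ (fun n x => x - c (n + 1) (τ x - x)) n
  have hs0 : s 0 = x₀ := rfl
  have hs1 : ∀ n, s (n + 1) = s n - c (n + 1) (τ (s n) - s n) := fun n => rfl
  have hs : ∀ n, τ (s n) - s n ∈ (I ^ (n + 1) • ⊤ : Submodule R V) := by
    intro n
    induction n with
    | zero => rwa [zero_add, pow_one]
    | succ n ih =>
      have := hc' (n + 1) _ ih
      rw [hs1, map_sub]
      have h1 : τ (s n) - τ (c (n + 1) (τ (s n) - s n)) - (s n - c (n + 1) (τ (s n) - s n)) =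
          -(τ (c (n + 1) (τ (s n) - s n)) - c (n + 1) (τ (s n) - s n) - (τ (s n) - s n)) := by
        abel
      rw [h1]
      exact neg_mem this
  have hcau : ∀ n, s (n + 1) - s n ∈ (I ^ (n + 1) • ⊤ : Submodule R V) := by
    intro n
    rw [hs1, sub_sub_cancel_left]
    exact neg_mem (hc (n + 1) _ (hs n))
  obtain ⟨x, hx⟩ := IsPrecomplete.prec (inferInstance : IsPrecomplete I V) (f := s) (by
    intro m n hmn
    induction n, hmn using Nat.le_induction with
    | base => exact SModEq.rfl
    | succ n hmn ih =>
      refine ih.trans (SModEq.symm (SModEq.sub_mem.mpr ?_))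
      exact Submodule.smul_mono_left (Ideal.pow_le_pow_right (by omega)) (hcau n))
  have hx' : ∀ n, x - s n ∈ (I ^ n • ⊤ : Submodule R V) := fun n =>
    SModEq.sub_mem.mp (hx n).symm
  refine ⟨x, ?_, ?_⟩
  · rw [← sub_eq_zero]
    refine IsHausdorff.haus (inferInstance : IsHausdorff I V) _ fun n => ?_
    rw [SModEq.zero]
    have h1 : τ x - x = (τ (x - s n) - (x - s n)) + (τ (s n) - s n) := by rw [map_sub]; abel
    rw [h1]
    exact add_mem (sub_mem (semilinear_mem_pow_smul_top v φ hφ τ hτ (hx' n)) (hx' n))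
      (Submodule.smul_mono_left (Ideal.pow_le_pow_right (by omega)) (hs n))
  · have h1 : x - x₀ = (x - s 1) + (s 1 - s 0) := by rw [hs0]; abel
    rw [h1]
    have h2 := hx' 1
    have h3 := hcau 0
    rw [zero_add, pow_one] at h3
    rw [pow_one] at h2
    exact add_mem h2 h3

end AdicLift

/-- Elements of a finite projective module that form a basis modulo an ideal contained in the
Jacobson radical form a basis. -/
theorem exists_basis_of_quotient_basis {R V : Type*} [CommRing R] [AddCommGroup V] [Module R V]
    [Module.Finite R V] [Module.Projective R V] (I : Ideal R) (hI : I ≤ Ideal.jacobson ⊥) {n : ℕ}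
    (b : Module.Basis (Fin n) (R ⧸ I) (V ⧸ (I • ⊤ : Submodule R V))) (t : Fin n → V)
    (ht : ∀ i, Submodule.Quotient.mk (t i) = b i) :
    ∃ b' : Module.Basis (Fin n) R V, ∀ i, b' i = t i := by
  let g : (Fin n → R) →ₗ[R] V := Fintype.linearCombination R t
  have hg : ∀ x, (Submodule.Quotient.mk (g x) : V ⧸ (I • ⊤ : Submodule R V)) =
      ∑ i, Ideal.Quotient.mk I (x i) • b i := by
    intro x
    rw [Fintype.linearCombination_apply, ← Submodule.mkQ_apply, map_sum]
    refine Finset.sum_congr rfl fun i _ => ?_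
    rw [← ht]; rfl
  have hsurj : Function.Surjective g := by
    rw [← LinearMap.range_eq_top, ← top_le_iff]
    refine Submodule.le_of_le_smul_of_le_jacobson_bot Module.Finite.fg_top hI ?_
    intro x _
    choose c hc using fun i => Ideal.Quotient.mk_surjective (b.repr (Submodule.Quotient.mk x) i)
    have h1 : x - g c ∈ (I • ⊤ : Submodule R V) := by
      rw [← Submodule.Quotient.eq, hg]
      simp only [hc]
      exact (b.sum_repr _).symm
    rw [← sub_add_cancel x (g c)]
    exact add_mem (Submodule.mem_sup_right h1) (Submodule.mem_sup_left ⟨c, rfl⟩)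
  obtain ⟨s, hs⟩ := Module.projective_lifting_property g LinearMap.id hsurj
  have hgs : ∀ x, g (s x) = x := fun x => LinearMap.congr_fun hs x
  -- By projectivity `g` splits, so its kernel is the image of the projector `id - s ∘ g` and is
  -- finitely generated. A kernel element has coordinates in `I`, because `b` is a basis modulo `I`;
  -- applying the projector writes it as an element of `I · ker g`, and Nakayama's lemma applies.
  have hker : LinearMap.ker g = ⊥ := by
    have hp : LinearMap.range (LinearMap.id - s ∘ₗ g) = LinearMap.ker g := by
      apply le_antisymm
      · rintro _ ⟨x, rfl⟩; simp [hgs]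
      · intro x hx
        exact ⟨x, by simp [LinearMap.mem_ker.mp hx]⟩
    refine Submodule.eq_bot_of_le_smul_of_le_jacobson_bot I _ ?_ ?_ hI
    · rw [← hp, LinearMap.range_eq_map]; exact Module.Finite.fg_top.map _
    · intro x hx
      have hxi : ∀ i, x i ∈ I := by
        have h0 : ∑ i, Ideal.Quotient.mk I (x i) • b i = 0 := by
          rw [← hg, LinearMap.mem_ker.mp hx, Submodule.Quotient.mk_zero]
        intro i
        exact Ideal.Quotient.eq_zero_iff_mem.mp
          (Fintype.linearIndependent_iff.mp b.linearIndependent _ h0 i)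
      have hx' : x = ∑ i, x i • (LinearMap.id - s ∘ₗ g : _ →ₗ[R] _) (Pi.single i 1) := by
        have h1 : x = (LinearMap.id - s ∘ₗ g : _ →ₗ[R] _) x := by simp [LinearMap.mem_ker.mp hx]
        conv_lhs => rw [h1, pi_eq_sum_univ' x, map_sum]
        simp only [map_smul]
      rw [hx']
      exact Submodule.sum_mem _ fun i _ => Submodule.smul_mem_smul (hxi i) (by
        rw [← hp]; exact ⟨_, rfl⟩)
  refine ⟨Module.Basis.ofEquivFun (LinearEquiv.ofBijective g
    ⟨LinearMap.ker_eq_bot.mp hker, hsurj⟩).symm, fun i => ?_⟩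
  simp only [Module.Basis.coe_ofEquivFun, LinearEquiv.symm_symm]
  exact (Fintype.linearCombination_apply_single R t i 1).trans (one_smul _ _)

/-- A finite projective module over an adically complete ring `R` with a semilinear endomorphism `τ`
whose linearization is surjective modulo `v` has a basis of `τ`-fixed vectors, provided that `R ⧸ v`
is generated by the residue field of `v` over a separably closed field on which `τ` is
Frobenius-semilinear. -/
theorem exists_basis_fixed {k E A R V : Type*} [Field k] [Fintype k] [Field E] [Algebra k E]
    [IsSepClosed E] [CommRing A] [Algebra k A] [CommRing R] [Algebra E R] [Algebra A R]
    (hk : (algebraMap E R).comp (algebraMap k E) = (algebraMap A R).comp (algebraMap k A))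
    (φ : R →+* R) (hφE : ∀ c, φ (algebraMap E R c) = algebraMap E R (c ^ Fintype.card k))
    (hφA : ∀ a, φ (algebraMap A R a) = algebraMap A R a)
    (v : Ideal A) [v.IsMaximal] [Module.Finite k (A ⧸ v)]
    (hR : ∀ x : R, ∃ y ∈ Submodule.span E (Set.range (algebraMap A R)),
      x - y ∈ v.map (algebraMap A R))
    [IsAdicComplete (v.map (algebraMap A R)) R] [AddCommGroup V] [Module R V] [Module.Finite R V]
    [Module.Projective R V] (τ : V →+ V) (hτ : ∀ r x, τ (r • x) = φ r • τ x)
    (hspan : Submodule.span R (Set.range τ) ⊔ v.map (algebraMap A R) • ⊤ = ⊤) :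
    ∃ (n : ℕ) (b : Module.Basis (Fin n) R V), ∀ i, τ (b i) = b i := by
  have := IsAdicComplete.of_finite_projective V (v.map (algebraMap A R))
  set I := v.map (algebraMap A R) with hI
  let S := R ⧸ I
  let W := V ⧸ (I • ⊤ : Submodule R V)
  let : Field (A ⧸ v) := Ideal.Quotient.field v
  let iAS : Algebra (A ⧸ v) S :=
    (Ideal.quotientMap I (algebraMap A R) Ideal.le_comap_map).toAlgebra
  let ikS : Algebra k S := ((algebraMap E S).comp (algebraMap k E)).toAlgebra
  let : Module E W := Module.compHom W (algebraMap E S)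
  let : Module (A ⧸ v) W := Module.compHom W (algebraMap (A ⧸ v) S)
  let : Module k W := Module.compHom W (algebraMap k S)
  have t1 : IsScalarTower k E S := .of_algebraMap_eq' rfl
  have t2 : IsScalarTower k (A ⧸ v) S := .of_algebraMap_eq' (RingHom.ext fun c =>
    congrArg (Ideal.Quotient.mk I) (congrArg (fun f : k →+* R => f c) hk))
  have t3 : IsScalarTower E S W := ⟨fun a b x => by rw [Algebra.smul_def, mul_smul]; rfl⟩
  have t4 : IsScalarTower (A ⧸ v) S W := ⟨fun a b x => by rw [Algebra.smul_def, mul_smul]; rfl⟩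
  have t5 : IsScalarTower k (A ⧸ v) W := ⟨fun a b x => by
    change algebraMap (A ⧸ v) S (a • b) • x = algebraMap k S a • algebraMap (A ⧸ v) S b • x
    rw [Algebra.smul_def, map_mul, ← IsScalarTower.algebraMap_apply, mul_smul]⟩
  have t6 : IsScalarTower k E W := ⟨fun a b x => by
    change algebraMap E S (a • b) • x = algebraMap k S a • algebraMap E S b • x
    rw [Algebra.smul_def, map_mul, ← IsScalarTower.algebraMap_apply, mul_smul]⟩
  have hstab : ∀ x ∈ (I • ⊤ : Submodule R V), τ x ∈ (I • ⊤ : Submodule R V) := by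
    intro x hx
    have := semilinear_mem_pow_smul_top v φ hφA τ hτ (n := 1) (y := x)
    rw [pow_one] at this
    exact this hx
  let τ' : W →+ W := QuotientAddGroup.map (I • ⊤ : Submodule R V).toAddSubgroup
    (I • ⊤ : Submodule R V).toAddSubgroup τ hstab
  have hmk : ∀ x, τ' (Submodule.Quotient.mk x) = Submodule.Quotient.mk (τ x) := fun x => rfl
  have hE : ∀ (c : E) (x : V), c • (Submodule.Quotient.mk x : W) =
      Submodule.Quotient.mk (algebraMap E R c • x) := fun c x => rfl
  have hA : ∀ (c : A) (x : V), Ideal.Quotient.mk v c • (Submodule.Quotient.mk x : W) =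
      Submodule.Quotient.mk (algebraMap A R c • x) := fun c x => rfl
  have hτE : ∀ (c : E) (x : W), τ' (c • x) = c ^ Fintype.card k • τ' x := by
    intro c x
    obtain ⟨x, rfl⟩ := Submodule.Quotient.mk_surjective _ x
    rw [hE, hmk, hmk, hE, hτ, hφE]
  have hτA : ∀ (c : A ⧸ v) (x : W), τ' (c • x) = c • τ' x := by
    intro c x
    obtain ⟨x, rfl⟩ := Submodule.Quotient.mk_surjective _ x
    obtain ⟨c, rfl⟩ := Ideal.Quotient.mk_surjective c
    rw [hA, hmk, hmk, hA, hτ, hφA]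
  have hS : Submodule.span E (Set.range (algebraMap (A ⧸ v) S)) = ⊤ := by
    rw [← top_le_iff]
    intro x _
    obtain ⟨x, rfl⟩ := Ideal.Quotient.mk_surjective x
    obtain ⟨y, hy, hxy⟩ := hR x
    rw [show Ideal.Quotient.mk I x = Ideal.Quotient.mk I y from Ideal.Quotient.eq.mpr hxy]
    clear hxy
    induction hy using Submodule.span_induction with
    | mem y hy =>
      obtain ⟨a, rfl⟩ := hy
      exact Submodule.subset_span ⟨Ideal.Quotient.mk v a, rfl⟩
    | zero => rw [map_zero]; exact zero_mem _
    | add y z _ _ hy hz => rw [map_add]; exact add_mem hy hz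
    | smul c y _ hy =>
      have : Ideal.Quotient.mk I (c • y) = c • Ideal.Quotient.mk I y := by
        rw [Algebra.smul_def, Algebra.smul_def, map_mul]; rfl
      rw [this]; exact Submodule.smul_mem _ _ hy
  have hspan' : Submodule.span E (Set.range τ') = ⊤ := by
    -- the span is stable under `R`, because `R` is spanned by `E` and `A`
    have hstabA : ∀ (c : A ⧸ v) (x : W), x ∈ Submodule.span E (Set.range τ') →
        c • x ∈ Submodule.span E (Set.range τ') := by
      intro c x hx
      induction hx using Submodule.span_induction with
      | mem x hx => obtain ⟨x, rfl⟩ := hx; exact Submodule.subset_span ⟨c • x, hτA c x⟩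
      | zero => rw [smul_zero]; exact zero_mem _
      | add x y _ _ hx hy => rw [smul_add]; exact add_mem hx hy
      | smul a x _ hx =>
        have : c • a • x = a • c • x := by
          change algebraMap (A ⧸ v) S c • algebraMap E S a • x =
            algebraMap E S a • algebraMap (A ⧸ v) S c • x
          rw [smul_comm]
        rw [this]; exact Submodule.smul_mem _ _ hx
    have hstabS : ∀ (s : S) (x : W), x ∈ Submodule.span E (Set.range τ') →
        s • x ∈ Submodule.span E (Set.range τ') := by
      intro s x hx
      have hs : s ∈ Submodule.span E (Set.range (algebraMap (A ⧸ v) S)) := by rw [hS]; trivial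
      induction hs using Submodule.span_induction with
      | mem s hs => obtain ⟨c, rfl⟩ := hs; exact hstabA c x hx
      | zero => rw [zero_smul]; exact zero_mem _
      | add s t _ _ hs ht => rw [add_smul]; exact add_mem hs ht
      | smul a s _ hs => rw [smul_assoc]; exact Submodule.smul_mem _ _ hs
    rw [← top_le_iff]
    intro x _
    obtain ⟨x, rfl⟩ := Submodule.Quotient.mk_surjective _ x
    have hx : x ∈ Submodule.span R (Set.range τ) ⊔ I • ⊤ := by rw [hspan]; trivial
    obtain ⟨y, hy, z, hz, rfl⟩ := Submodule.mem_sup.mp hx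
    rw [Submodule.Quotient.mk_add, (Submodule.Quotient.mk_eq_zero _).mpr hz, add_zero]
    clear hx hz
    induction hy using Submodule.span_induction with
    | mem y hy => obtain ⟨y, rfl⟩ := hy; exact Submodule.subset_span ⟨Submodule.Quotient.mk y, rfl⟩
    | zero => rw [Submodule.Quotient.mk_zero]; exact zero_mem _
    | add x y _ _ hx hy => rw [Submodule.Quotient.mk_add]; exact add_mem (hx trivial) (hy trivial)
    | smul a x _ hx => exact hstabS (Ideal.Quotient.mk I a) _ (hx trivial)
  have hfinW : Module.Finite S W :=
    Module.Finite.of_restrictScalars_finite R S W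
  obtain ⟨n, b, hb⟩ := exists_residue_basis_fixed (k := k) (κ := A ⧸ v) τ' hτE hτA hspan' hS
  have hfE : Module.Finite E W := by
    have hfS : Module.Finite E S := by
      let f := Module.finBasis k (A ⧸ v)
      refine ⟨⟨(Set.finite_range fun j => algebraMap (A ⧸ v) S (f j)).toFinset, ?_⟩⟩
      rw [Set.Finite.coe_toFinset, ← top_le_iff, ← hS, Submodule.span_le]
      rintro _ ⟨c, rfl⟩
      rw [← f.sum_repr c, map_sum]
      refine Submodule.sum_mem _ fun j _ => ?_
      rw [Algebra.smul_def, map_mul, ← IsScalarTower.algebraMap_apply,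
        IsScalarTower.algebraMap_apply k E S, ← Algebra.smul_def]
      exact Submodule.smul_mem _ _ (Submodule.subset_span ⟨j, rfl⟩)
    exact Module.Finite.trans S W
  -- By Lang's theorem the reduction is spanned by fixed vectors, and on such a span `τ - 1` is
  -- surjective; this is the input of the approximation.
  have hH : ∀ y, ∃ x, τ x - x - y ∈ (I • ⊤ : Submodule R V) := by
    intro y
    obtain ⟨x, -, hx⟩ := exists_sub_eq_of_mem_span_fixed (k := k) τ' hτE
      (y := Submodule.Quotient.mk y) (by rw [span_fixed_eq_top τ' hτE hspan']; trivial)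
    obtain ⟨x, rfl⟩ := Submodule.Quotient.mk_surjective _ x
    exact ⟨x, (Submodule.Quotient.eq _).mp hx⟩
  choose t₀ ht₀ using fun i => Submodule.Quotient.mk_surjective _ (b i)
  choose t ht ht' using fun i => exists_fixed_lift v φ hφA τ hτ hH (t₀ i) (by
    rw [← Submodule.Quotient.eq, ← hmk, ht₀]; exact hb i)
  obtain ⟨b', hb'⟩ := exists_basis_of_quotient_basis I (IsAdicComplete.le_jacobson_bot I) b t
    fun i => by rw [← ht₀ i]; exact (Submodule.Quotient.eq _).mpr (ht' i)
  exact ⟨n, b', fun i => by rw [hb', ht]⟩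

/-- Sections of an integral scheme that agree in the function field glue. -/
theorem AlgebraicGeometry.Scheme.exists_section_of_germToFunctionField_eq {C : Scheme.{u}}
    [IsIntegral C] {U W : C.Opens} [Nonempty U] [Nonempty W] (hcov : ⊤ ≤ U ⊔ W) (a : Γ(C, U))
    (s : Γ(C, W)) (h : C.germToFunctionField U a = C.germToFunctionField W s) :
    ∃ t : Γ(C, ⊤), C.presheaf.map (homOfLE (le_top : U ≤ ⊤)).op t = a := by
  have hU : genericPoint C ∈ U := ((genericPoint_spec C).mem_open_set_iff U.isOpen).mpr
    (by simpa using (inferInstance : Nonempty U))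
  have hW : genericPoint C ∈ W := ((genericPoint_spec C).mem_open_set_iff W.isOpen).mpr
    (by simpa using (inferInstance : Nonempty W))
  have : Nonempty (U ⊓ W : C.Opens) := ⟨⟨_, hU, hW⟩⟩
  have h2 : C.presheaf.map (homOfLE (inf_le_left : U ⊓ W ≤ U)).op a =
      C.presheaf.map (homOfLE (inf_le_right : U ⊓ W ≤ W)).op s := by
    apply C.germToFunctionField_injective (U ⊓ W)
    rw [Scheme.germToFunctionField, TopCat.Presheaf.germ_res_apply,
      TopCat.Presheaf.germ_res_apply]
    exact h
  let t : Γ(C, U ⊔ W) := (C.sheaf.objSupIsoProdEqLocus U W).inv ⟨(a, s), h2⟩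
  have ht : C.presheaf.map (homOfLE (le_sup_left : U ≤ U ⊔ W)).op t = a :=
    C.sheaf.objSupIsoProdEqLocus_inv_fst U W ⟨(a, s), h2⟩
  refine ⟨C.presheaf.map (homOfLE hcov).op t, ?_⟩
  rw [← ConcreteCategory.comp_apply, ← Functor.map_comp]
  exact ht

/-! ### Global sections and the residue field at infinity. -/

namespace PointedCurve

variable {Fq : Type u} [Field Fq] (X : PointedCurve Fq)

theorem algebraMap_A_Q_injective : Function.Injective (algebraMap X.A X.Q) :=
  X.C.germToFunctionField_injective X.U

instance : IsDomain X.A := X.algebraMap_A_Q_injective.isDomain _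

theorem pt_eq (y : Spec (.of Fq)) : X.infty y = X.pt := by
  rw [Subsingleton.elim y (IsLocalRing.closedPoint Fq)]; rfl

/-- The ring of global sections of `C`. -/
def globalSections : Type u := Γ(X.C, ⊤)

noncomputable instance : CommRing X.globalSections := inferInstanceAs (CommRing Γ(X.C, ⊤))

noncomputable instance : Algebra Fq X.globalSections :=
  ((Scheme.ΓSpecIso (.of Fq)).inv ≫ X.str.appTop).hom.toAlgebra

theorem finite_globalSections : Module.Finite Fq X.globalSections := by
  have h := finite_appTop_of_universallyClosed Fq X.str
  have h1 : (X.str.appTop.hom.comp (Scheme.ΓSpecIso (.of Fq)).inv.hom).Finite :=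
    h.comp (RingHom.Finite.of_surjective _
      (Scheme.ΓSpecIso (.of Fq)).commRingCatIsoToRingEquiv.symm.surjective)
  exact h1

/-- Restriction of global sections to `C ∖ {∞}`. -/
noncomputable def restrictGlobal : X.globalSections →ₐ[Fq] X.A where
  toRingHom := (X.C.presheaf.map (homOfLE (le_top : X.U ≤ ⊤)).op).hom
  commutes' := fun _ => rfl

/-- A function on `C ∖ {∞}` that is regular at `∞` is a global section. -/
theorem mem_range_restrictGlobal {a : X.A} {o : X.O}
    (h : algebraMap X.A X.Q a = algebraMap X.O X.Q o) : a ∈ X.restrictGlobal.range := by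
  obtain ⟨W, hW, s, hs⟩ := X.C.presheaf.exists_germ_eq (x := X.pt) o
  have : Nonempty W := ⟨⟨_, hW⟩⟩
  have hcov : (⊤ : X.C.Opens) ≤ X.U ⊔ W := by
    intro x _
    by_cases hx : x ∈ Set.range X.infty
    · obtain ⟨y, rfl⟩ := hx
      right
      rw [X.pt_eq]; exact hW
    · left; exact hx
  have h1 : X.C.germToFunctionField X.U a = X.C.germToFunctionField W s := by
    rw [← Scheme.algebraMap_germ_eq_germToFunctionField X.C hW, hs]
    exact h
  exact Scheme.exists_section_of_germToFunctionField_eq hcov a s h1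

/-- The residue field at `∞` is the base field. -/
theorem exists_sub_mem_maximalIdeal (x : X.O) :
    ∃ c : Fq, x - algebraMap Fq X.O c ∈ IsLocalRing.maximalIdeal X.O := by
  let p : Spec (.of Fq) := IsLocalRing.closedPoint Fq
  let j : Γ(Spec (.of Fq), ⊤) →+* (Spec (.of Fq)).presheaf.stalk p :=
    ((Spec (.of Fq)).presheaf.germ ⊤ p trivial).hom
  have hR : IsField Γ(Spec (.of Fq), ⊤) :=
    (Scheme.ΓSpecIso (.of Fq)).commRingCatIsoToRingEquiv.toMulEquiv.isField (Field.toIsField Fq)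
  have hj : Function.Surjective j := by
    let : Algebra Γ(Spec (.of Fq), ⊤) ((Spec (.of Fq)).presheaf.stalk p) := j.toAlgebra
    have hU := isAffineOpen_top (Spec (.of Fq))
    have := hU.isLocalization_stalk ⟨p, trivial⟩
    exact (hR.localization_map_bijective (M := (hU.primeIdealOf ⟨p, trivial⟩).asIdeal.primeCompl)
      (fun h => h (Ideal.zero_mem _))).2
  have hcomp : X.str.appTop ≫ X.C.presheaf.germ ⊤ X.pt trivial ≫ X.infty.stalkMap p =
      (Spec (.of Fq)).presheaf.germ ⊤ p trivial := by
    have h2 : X.C.presheaf.germ ⊤ X.pt trivial ≫ X.infty.stalkMap p =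
        X.infty.appTop ≫ (Spec (.of Fq)).presheaf.germ ⊤ p trivial := by
      exact X.infty.germ_stalkMap ⊤ p trivial
    have h1 : X.str.appTop ≫ X.infty.appTop = 𝟙 _ := by
      rw [← Scheme.Hom.comp_appTop, X.infty_str]; rfl
    rw [h2, ← Category.assoc, h1, Category.id_comp]
  -- Evaluation at `∞`. Since `∞` is a section of the structure morphism, every value is already
  -- taken by a constant.
  let ψ : X.O →+* (Spec (.of Fq)).presheaf.stalk p := (X.infty.stalkMap p).hom
  obtain ⟨y, hy⟩ := hj (ψ x)
  have h1 : ψ (algebraMap Fq X.O ((Scheme.ΓSpecIso (.of Fq)).hom y)) = j y := by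
    have h2 : (Scheme.ΓSpecIso (.of Fq)).inv ((Scheme.ΓSpecIso (.of Fq)).hom y) = y := by simp
    exact (congrArg (fun z => ψ ((X.C.presheaf.germ ⊤ X.pt trivial).hom (X.str.appTop.hom z)))
      h2).trans congr(($hcomp).hom y)
  refine ⟨(Scheme.ΓSpecIso (.of Fq)).hom y, ?_⟩
  rw [IsLocalRing.mem_maximalIdeal, mem_nonunits_iff]
  intro hu
  have h3 := hu.map ψ
  rw [map_sub, h1, hy, sub_self] at h3
  exact not_isUnit_zero h3

end PointedCurve

/-! ### The filtration of `A` by pole order and finite generation. -/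

namespace PointedCurve

variable {Fq : Type u} [Field Fq] (X : PointedCurve Fq)

/-- `x ∈ A` has a pole of order at most `n` at `∞`, where `ϖ` is a uniformizer. -/
def PoleOrderLE (ϖ : X.O) (n : ℕ) (x : X.A) : Prop :=
  ∃ o : X.O, algebraMap X.O X.Q (ϖ ^ n) * algebraMap X.A X.Q x = algebraMap X.O X.Q o

/-- `x ∈ A` has a pole of order exactly `n` at `∞`, where `ϖ` is a uniformizer. -/
def PoleOrderEq (ϖ : X.O) (n : ℕ) (x : X.A) : Prop :=
  ∃ u : X.Oˣ, algebraMap X.O X.Q (ϖ ^ n) * algebraMap X.A X.Q x = algebraMap X.O X.Q u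

variable {X} {ϖ : X.O}

theorem poleOrderLE_of_mem_maximalIdeal (hϖ : Irreducible ϖ) {n : ℕ} {x : X.A} {o : X.O}
    (h : algebraMap X.O X.Q (ϖ ^ (n + 1)) * algebraMap X.A X.Q x = algebraMap X.O X.Q o)
    (ho : o ∈ IsLocalRing.maximalIdeal X.O) : X.PoleOrderLE ϖ n x := by
  rw [hϖ.maximalIdeal_eq, Ideal.mem_span_singleton] at ho
  obtain ⟨o', rfl⟩ := ho
  refine ⟨o', ?_⟩
  have h0 : algebraMap X.O X.Q ϖ ≠ 0 := by
    rw [Ne, FaithfulSMul.algebraMap_eq_zero_iff]; exact hϖ.ne_zero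
  apply mul_left_cancel₀ h0
  rw [← map_mul, ← h, ← mul_assoc, ← map_mul, ← pow_succ']

theorem PoleOrderLE.zero_or_eq (hϖ : Irreducible ϖ) {n : ℕ} {x : X.A} (h : X.PoleOrderLE ϖ n x) :
    X.PoleOrderLE ϖ 0 x ∨ ∃ j, 1 ≤ j ∧ j ≤ n ∧ X.PoleOrderEq ϖ j x := by
  induction n with
  | zero => exact Or.inl h
  | succ n ih =>
    obtain ⟨o, ho⟩ := h
    by_cases hu : IsUnit o
    · exact Or.inr ⟨n + 1, by omega, le_rfl, hu.unit, ho⟩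
    · rcases ih (poleOrderLE_of_mem_maximalIdeal hϖ ho hu) with h | ⟨j, h1, h2, h3⟩
      · exact Or.inl h
      · exact Or.inr ⟨j, h1, by omega, h3⟩

theorem exists_poleOrderLE (hϖ : Irreducible ϖ) (x : X.A) : ∃ n, X.PoleOrderLE ϖ n x := by
  obtain ⟨p, q, hq, h⟩ := IsFractionRing.div_surjective X.O (algebraMap X.A X.Q x)
  obtain ⟨n, u, rfl⟩ := IsDiscreteValuationRing.eq_unit_mul_pow_irreducible
    (nonZeroDivisors.ne_zero hq) hϖ
  refine ⟨n, ↑u⁻¹ * p, ?_⟩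
  have h0 : algebraMap X.O X.Q (↑u * ϖ ^ n) ≠ 0 := by
    rw [Ne, FaithfulSMul.algebraMap_eq_zero_iff]; exact nonZeroDivisors.ne_zero hq
  have h1 : algebraMap X.O X.Q p = algebraMap X.O X.Q (↑u * ϖ ^ n) * algebraMap X.A X.Q x := by
    rw [← h]; field_simp
  rw [map_mul, h1, ← mul_assoc, ← map_mul, Units.inv_mul_cancel_left]

theorem PoleOrderEq.mul {m n : ℕ} {x y : X.A} (hx : X.PoleOrderEq ϖ m x)
    (hy : X.PoleOrderEq ϖ n y) : X.PoleOrderEq ϖ (m + n) (x * y) := by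
  obtain ⟨u, hu⟩ := hx
  obtain ⟨u', hu'⟩ := hy
  refine ⟨u * u', ?_⟩
  rw [Units.val_mul, map_mul (algebraMap X.O X.Q) (u : X.O), ← hu, ← hu', pow_add, map_mul, map_mul]
  ring

theorem PoleOrderEq.pow {m : ℕ} {x : X.A} (hx : X.PoleOrderEq ϖ m x) (t : ℕ) :
    X.PoleOrderEq ϖ (t * m) (x ^ t) := by
  induction t with
  | zero => exact ⟨1, by simp⟩
  | succ t ih => rw [pow_succ, Nat.succ_mul]; exact ih.mul hx

/-- The residue field at `∞` is `Fq`, so the ratio of the two leading units is congruent to a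
constant, and subtracting that multiple of `y` cancels the leading term. -/
theorem PoleOrderEq.exists_sub_smul (hϖ : Irreducible ϖ) {n : ℕ} {x y : X.A}
    (hx : X.PoleOrderEq ϖ (n + 1) x) (hy : X.PoleOrderEq ϖ (n + 1) y) :
    ∃ c : Fq, X.PoleOrderLE ϖ n (x - c • y) := by
  obtain ⟨u, hu⟩ := hx
  obtain ⟨u', hu'⟩ := hy
  obtain ⟨c, hc⟩ := X.exists_sub_mem_maximalIdeal (u * ↑u'⁻¹)
  refine ⟨c, poleOrderLE_of_mem_maximalIdeal hϖ (o := u - algebraMap Fq X.O c * u') ?_ ?_⟩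
  · rw [map_sub, mul_sub, hu, map_sub, map_mul, ← hu', Algebra.smul_def, map_mul,
      ← IsScalarTower.algebraMap_apply, ← IsScalarTower.algebraMap_apply]
    ring
  · have h1 : (u : X.O) - algebraMap Fq X.O c * u' = (u * ↑u'⁻¹ - algebraMap Fq X.O c) * u' := by
      rw [sub_mul, Units.inv_mul_cancel_right]
    rw [h1]
    exact Ideal.mul_mem_right _ _ hc

variable (X)

/-- The coordinate ring of a curve with one point removed is of finite type: this follows from the
filtration by the pole order, whose graded pieces are at most one-dimensional. -/
instance finiteType_A : Algebra.FiniteType Fq X.A := by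
  obtain ⟨ϖ, hϖ⟩ := IsDiscreteValuationRing.exists_irreducible X.O
  have hfin := X.finite_globalSections
  obtain ⟨s, hs⟩ : X.restrictGlobal.range.FG := by
    rw [← Algebra.map_top]
    exact (Algebra.FiniteType.out (R := Fq) (A := X.globalSections)).map X.restrictGlobal
  have hzero : ∀ (B : Subalgebra Fq X.A), X.restrictGlobal.range ≤ B → ∀ x,
      X.PoleOrderLE ϖ 0 x → x ∈ B := by
    rintro B hB x ⟨o, ho⟩
    exact hB (X.mem_range_restrictGlobal (o := o) (by simpa using ho))
  classical
  by_cases ha : ∃ m a, X.PoleOrderEq ϖ (m + 1) a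
  · obtain ⟨m, a, ha⟩ := ha
    -- As for numerical semigroups: `g` realizes the least pole order in the residue class `j`
    -- modulo the pole order `m + 1` of `a`, and the powers of `a` reach all larger orders in that
    -- class. An empty class gets the default `0`.
    have hg : ∀ j, ∃ g : X.A, ∀ n, n % (m + 1) = j → (∃ x, X.PoleOrderEq ϖ n x) →
        ∃ t, X.PoleOrderEq ϖ n (g * a ^ t) := by
      intro j
      by_cases hj : ∃ n, n % (m + 1) = j ∧ ∃ x, X.PoleOrderEq ϖ n x
      · obtain ⟨h1, g, h2⟩ := Nat.find_spec hj
        refine ⟨g, fun n hn hx => ?_⟩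
        have hle : Nat.find hj ≤ n := Nat.find_min' hj ⟨hn, hx⟩
        have hmod : Nat.find hj ≡ n [MOD m + 1] := h1.trans hn.symm
        obtain ⟨t, ht⟩ := (Nat.modEq_iff_dvd' hle).mp hmod
        refine ⟨t, ?_⟩
        have := h2.mul (ha.pow t)
        rwa [mul_comm t, ← ht, Nat.add_sub_cancel' hle] at this
      · exact ⟨0, fun n hn hx => absurd ⟨n, hn, hx⟩ hj⟩
    choose g hg using hg
    let G : Finset X.A := s ∪ insert a ((Finset.range (m + 1)).image g)
    let B := Algebra.adjoin Fq (G : Set X.A)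
    have hsB : X.restrictGlobal.range ≤ B := by
      rw [← hs]; exact Algebra.adjoin_mono (by
        rw [Finset.coe_subset]; exact Finset.subset_union_left)
    have haB : a ∈ B := Algebra.subset_adjoin (by simp [G])
    have hgB : ∀ j < m + 1, g j ∈ B := fun j hj => Algebra.subset_adjoin (by
      simp only [G, Finset.coe_union, Finset.coe_insert, Finset.coe_image]
      exact Or.inr (Or.inr ⟨j, by simpa using hj, rfl⟩))
    refine ⟨⟨G, ?_⟩⟩
    rw [← top_le_iff]
    intro x _
    obtain ⟨n, hn⟩ := exists_poleOrderLE hϖ x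
    induction n using Nat.strong_induction_on generalizing x with
    | _ n ih =>
      rcases hn.zero_or_eq hϖ with h0 | ⟨j, hj1, hjn, hj⟩
      · exact hzero B hsB x h0
      · obtain ⟨t, ht⟩ := hg _ j rfl ⟨x, hj⟩
        obtain ⟨j, rfl⟩ : ∃ i, j = i + 1 := ⟨j - 1, by omega⟩
        obtain ⟨c, hc⟩ := hj.exists_sub_smul hϖ ht
        have h1 := ih j (by omega) Algebra.mem_top hc
        have h2 : c • (g ((j + 1) % (m + 1)) * a ^ t) ∈ B :=
          B.smul_mem (B.mul_mem (hgB _ (Nat.mod_lt _ (by omega))) (B.pow_mem haB t)) c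
        simpa using B.add_mem h1 h2
  · refine ⟨⟨s, ?_⟩⟩
    rw [hs, ← top_le_iff]
    intro x _
    obtain ⟨n, hn⟩ := exists_poleOrderLE hϖ x
    rcases hn.zero_or_eq hϖ with h0 | ⟨j, hj1, -, hj⟩
    · exact hzero _ le_rfl x h0
    · exact absurd ⟨j - 1, x, by rwa [Nat.sub_add_cancel hj1]⟩ ha

instance : IsNoetherianRing X.A := Algebra.FiniteType.isNoetherianRing Fq X.A

/-- Zariski's lemma for the finitely generated algebra `A`. Finiteness of the residue field of `v`
over `Fq` is what the dimension count for fixed vectors requires. -/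
theorem finite_quotient (v : Ideal X.A) [v.IsMaximal] : Module.Finite Fq (X.A ⧸ v) := by
  let : Field (X.A ⧸ v) := Ideal.Quotient.field v
  have : Algebra.FiniteType Fq (X.A ⧸ v) :=
    .of_surjective (Ideal.Quotient.mkₐ Fq v) Ideal.Quotient.mk_surjective
  exact finite_of_finite_type_of_isJacobsonRing Fq (X.A ⧸ v)

end PointedCurve

/-! ### Frobenius invariants and contraction in `E ⊗ B`. -/

section FrobeniusInvariants

variable {k E B : Type*} [Field k] [Field E] [Algebra k E] [CommRing B] [Algebra k B]

/-- In coordinates with respect to a `k`-basis of `B`, `frob` raises each coordinate to the `q`-th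
power, so the coordinates of an invariant lie in `k`. -/
theorem exists_eq_one_tmul_of_frob_eq [Fintype k] {z : E ⊗[k] B} (hz : frob k E B z = z) :
    ∃ b : B, z = 1 ⊗ₜ b := by
  let 𝓑 := Module.Free.chooseBasis k B
  let e := TensorProduct.equivFinsuppOfBasisRight (M := E) 𝓑
  have hfrob : ∀ (z : E ⊗[k] B) i, e (frob k E B z) i = e z i ^ Fintype.card k := by
    intro z i
    induction z with
    | zero => simp [Fintype.card_ne_zero]
    | add x y hx hy =>
      rw [map_add, map_add, Finsupp.add_apply, hx, hy, map_add, Finsupp.add_apply]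
      exact (map_add (FiniteField.frobeniusAlgHom k E) _ _).symm
    | tmul x b =>
      simp only [frob_tmul, e, TensorProduct.equivFinsuppOfBasisRight_apply_tmul_apply]
      rw [Algebra.smul_def, Algebra.smul_def, mul_pow, ← map_pow, FiniteField.pow_card]
  have hc : ∀ i, ∃ c : k, algebraMap k E c = e z i := fun i =>
    FiniteField.mem_range_algebraMap_of_pow_card_eq k (by rw [← hfrob, hz])
  choose c hc using hc
  refine ⟨∑ i ∈ (e z).support, c i • 𝓑 i, ?_⟩
  conv_lhs => rw [← e.symm_apply_apply z]
  rw [TensorProduct.equivFinsuppOfBasisRight_symm_apply, TensorProduct.tmul_sum, Finsupp.sum]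
  refine Finset.sum_congr rfl fun i _ => ?_
  rw [← hc, TensorProduct.tmul_smul, TensorProduct.smul_tmul', Algebra.smul_def, mul_one]

/-- The extended ideal is the kernel of `E ⊗ B → E ⊗ (B ⧸ 𝔞)`, so this is the description of
invariants applied to `B ⧸ 𝔞`. -/
theorem exists_sub_one_tmul_mem_of_frob_sub_mem [Fintype k] (𝔞 : Ideal B) {z : E ⊗[k] B}
    (hz : frob k E B z - z ∈
      𝔞.map (Algebra.TensorProduct.includeRight : B →ₐ[k] E ⊗[k] B)) :
    ∃ b : B, z - 1 ⊗ₜ b ∈ 𝔞.map (Algebra.TensorProduct.includeRight : B →ₐ[k] E ⊗[k] B) := by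
  let g := Ideal.Quotient.mkₐ k 𝔞
  have hg : Function.Surjective g := Ideal.Quotient.mk_surjective
  have hker := Algebra.TensorProduct.lTensor_ker (A := E) g hg
  rw [show RingHom.ker g = 𝔞 from Ideal.Quotient.mkₐ_ker k 𝔞] at hker
  let G := Algebra.TensorProduct.map (AlgHom.id k E) g
  have hfrob : ∀ z, G (frob k E B z) = frob k E (B ⧸ 𝔞) (G z) := by
    intro z
    induction z with
    | zero => simp
    | add x y hx hy => simp only [map_add, hx, hy]
    | tmul x b => rfl
  rw [← hker, RingHom.mem_ker, map_sub, sub_eq_zero] at hz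
  obtain ⟨b, hb⟩ := exists_eq_one_tmul_of_frob_eq ((hfrob z).symm.trans hz)
  obtain ⟨b, rfl⟩ := hg b
  refine ⟨b, ?_⟩
  rw [← hker, RingHom.mem_ker, map_sub, sub_eq_zero]
  exact hb

/-- A linear form on `E` induces a `B`-linear map `E ⊗ B → B`. -/
noncomputable def TensorProduct.contractLeft (l : E →ₗ[k] k) : E ⊗[k] B →ₗ[k] B :=
  TensorProduct.lid k B ∘ₗ LinearMap.rTensor B l

theorem TensorProduct.contractLeft_tmul (l : E →ₗ[k] k) (x : E) (b : B) :
    TensorProduct.contractLeft l (x ⊗ₜ[k] b) = l x • b := by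
  simp [TensorProduct.contractLeft]

theorem TensorProduct.contractLeft_mem (l : E →ₗ[k] k) (𝔞 : Ideal B) {z : E ⊗[k] B}
    (hz : z ∈ 𝔞.map (Algebra.TensorProduct.includeRight : B →ₐ[k] E ⊗[k] B)) :
    TensorProduct.contractLeft l z ∈ 𝔞 := by
  have key : ∀ (b : B) (z : E ⊗[k] B), TensorProduct.contractLeft l (z * 1 ⊗ₜ b) =
      b * TensorProduct.contractLeft l z := by
    intro b z
    induction z with
    | zero => simp
    | add x y hx hy => rw [add_mul, map_add, hx, hy, map_add, mul_add]
    | tmul x c =>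
      rw [Algebra.TensorProduct.tmul_mul_tmul, contractLeft_tmul, contractLeft_tmul, mul_one,
        mul_smul_comm, mul_comm]
  -- Contraction is linear over `B` but not over `E ⊗ B`; the arbitrary factor `w` makes the claim
  -- stable under multiplication in the extended ideal.
  have h : ∀ w, TensorProduct.contractLeft l (w * z) ∈ 𝔞 := by
    unfold Ideal.map at hz
    induction hz using Submodule.span_induction with
    | mem z hz =>
      obtain ⟨b, hb, rfl⟩ := hz
      intro w
      rw [Algebra.TensorProduct.includeRight_apply, key]
      exact Ideal.mul_mem_right _ _ hb
    | zero => intro w; rw [mul_zero, map_zero]; exact zero_mem _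
    | add x y _ _ hx hy => intro w; rw [mul_add, map_add]; exact add_mem (hx w) (hy w)
    | smul a z _ hz => intro w; rw [smul_eq_mul, ← mul_assoc]; exact hz (w * a)
  simpa using h 1

/-- Contraction along a linear form that does not vanish at `1` recovers `b` up to a nonzero
constant. -/
theorem mem_of_one_tmul_mem_map (𝔞 : Ideal B) {b : B}
    (hb : (1 : E) ⊗ₜ[k] b ∈ 𝔞.map (Algebra.TensorProduct.includeRight : B →ₐ[k] E ⊗[k] B)) :
    b ∈ 𝔞 := by
  obtain ⟨l, hl⟩ := Module.Projective.exists_dual_ne_zero k (one_ne_zero : (1 : E) ≠ 0)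
  have h := TensorProduct.contractLeft_mem l 𝔞 hb
  rw [TensorProduct.contractLeft_tmul] at h
  have := 𝔞.smul_of_tower_mem (l 1)⁻¹ h
  rwa [smul_smul, inv_mul_cancel₀ hl, one_smul] at this

theorem eq_zero_of_contractLeft_eq_zero {z : E ⊗[k] B}
    (hz : ∀ l : E →ₗ[k] k, TensorProduct.contractLeft l z = 0) : z = 0 := by
  let 𝓑 := Module.Free.chooseBasis k E
  let e := TensorProduct.equivFinsuppOfBasisLeft (N := B) 𝓑
  have he : ∀ z i, e z i = TensorProduct.contractLeft (𝓑.coord i) z := by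
    intro z i
    induction z with
    | zero => simp
    | add x y hx hy => rw [map_add, map_add, Finsupp.add_apply, hx, hy]
    | tmul x b =>
      rw [TensorProduct.contractLeft_tmul]
      simp [e]
  rw [← e.map_eq_zero_iff]
  ext i
  rw [he, hz, Finsupp.zero_apply]

end FrobeniusInvariants

/-! ### The completed coefficient ring and its invariants. -/

namespace PointedCurve

variable {Fq : Type u} [Field Fq] (X : PointedCurve Fq)
  (E : Type*) [Field E] [Algebra Fq E] (v : Ideal X.A)

/-- The map `A_E → A_{v,E}`. -/
noncomputable def toCompletedCoeff : E ⊗[Fq] X.A →+* X.CompletedCoeff E v :=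
  algebraMap (E ⊗[Fq] X.A) (AdicCompletion (X.placeIdeal E v) (E ⊗[Fq] X.A))

/-- The projection `A_{v,E} → A_E / v ^ n A_E`. -/
noncomputable def evalCompletedCoeff (n : ℕ) :
    X.CompletedCoeff E v →+* (E ⊗[Fq] X.A) ⧸ X.placeIdeal E v ^ n :=
  (AdicCompletion.evalₐ (X.placeIdeal E v) n).toRingHom

theorem evalCompletedCoeff_toCompletedCoeff (n : ℕ) (z : E ⊗[Fq] X.A) :
    X.evalCompletedCoeff E v n (X.toCompletedCoeff E v z) = Ideal.Quotient.mk _ z :=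
  AlgHom.commutes (AdicCompletion.evalₐ (X.placeIdeal E v) n) z

variable {X E v} in
theorem completedCoeff_ext {x y : X.CompletedCoeff E v}
    (h : ∀ n, X.evalCompletedCoeff E v n x = X.evalCompletedCoeff E v n y) : x = y :=
  AdicCompletion.ext_evalₐ h

theorem factorPow_evalCompletedCoeff {m n : ℕ} (h : m ≤ n) (x : X.CompletedCoeff E v) :
    Ideal.Quotient.factorPow (X.placeIdeal E v) h (X.evalCompletedCoeff E v n x) =
      X.evalCompletedCoeff E v m x := by
  change Ideal.Quotient.factorPow _ h (AdicCompletion.evalₐ (X.placeIdeal E v) n x) =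
    AdicCompletion.evalₐ (X.placeIdeal E v) m x
  induction x using AdicCompletion.induction_on with
  | _ f =>
    rw [AdicCompletion.evalₐ_mk, AdicCompletion.evalₐ_mk]
    exact AdicCompletion.Ideal.mk_eq_mk _ h f

theorem placeIdeal_pow (n : ℕ) : X.placeIdeal E v ^ n =
    (v ^ n).map (Algebra.TensorProduct.includeRight : X.A →ₐ[Fq] E ⊗[Fq] X.A) :=
  (Ideal.map_pow _ _ _).symm

theorem evalCompletedCoeff_algebraMap (n : ℕ) (b : X.Av v) (a : X.A)
    (h : AdicCompletion.evalₐ v n b = Ideal.Quotient.mk _ a) :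
    X.evalCompletedCoeff E v n (algebraMap (X.Av v) (X.CompletedCoeff E v) b) =
      Ideal.Quotient.mk _ (1 ⊗ₜ a) := by
  refine (AdicCompletion.evalₐ_mapRingHom v (X.placeIdeal E v) _ le_rfl n b).trans ?_
  rw [h]
  exact Ideal.quotientMap_mk

theorem algebraMap_completedCoeff_injective :
    Function.Injective (algebraMap (X.Av v) (X.CompletedCoeff E v)) := by
  rw [injective_iff_map_eq_zero]
  intro b hb
  refine AdicCompletion.ext_evalₐ fun n => ?_
  obtain ⟨a, ha⟩ := Ideal.Quotient.mk_surjective (AdicCompletion.evalₐ v n b)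
  have h := X.evalCompletedCoeff_algebraMap E v n b a ha.symm
  rw [hb, map_zero, eq_comm, Ideal.Quotient.eq_zero_iff_mem, placeIdeal_pow] at h
  refine Eq.trans ?_ (map_zero (AdicCompletion.evalₐ v n)).symm
  refine ha.symm.trans ?_
  exact Ideal.Quotient.eq_zero_iff_mem.mpr (mem_of_one_tmul_mem_map _ h)

theorem algebraMap_algebraMap_completedCoeff (a : X.A) :
    algebraMap (X.Av v) (X.CompletedCoeff E v) (algebraMap X.A (X.Av v) a) =
      X.toCompletedCoeff E v (1 ⊗ₜ a) :=
  AdicCompletion.mapRingHom_algebraMap _ _ _ _ _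

/-- Contraction sends the kernel into `⋂ v ^ n`, which is zero by Krull's theorem in the Noetherian
domain `A`; and linear forms on `E` separate the elements of `E ⊗ A`. -/
theorem toCompletedCoeff_injective (hv : v ≠ ⊤) :
    Function.Injective (X.toCompletedCoeff E v) := by
  rw [injective_iff_map_eq_zero]
  intro z hz
  refine eq_zero_of_contractLeft_eq_zero fun l => ?_
  have h : TensorProduct.contractLeft l z ∈ (⨅ n, v ^ n : Ideal X.A) := by
    rw [Ideal.mem_iInf]
    intro n
    refine TensorProduct.contractLeft_mem l _ ?_
    rw [← placeIdeal_pow, ← Ideal.Quotient.eq_zero_iff_mem,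
      ← evalCompletedCoeff_toCompletedCoeff, hz, map_zero]
  rwa [Ideal.iInf_pow_eq_bot_of_isDomain v hv] at h

variable [Fintype Fq]

theorem completedFrob_toCompletedCoeff (z : E ⊗[Fq] X.A) :
    X.completedFrob E v (X.toCompletedCoeff E v z) = X.toCompletedCoeff E v (frob Fq E X.A z) :=
  AdicCompletion.mapRingHom_algebraMap _ _ _ (X.placeIdeal_map_frob E v) _

variable {E v} in
/-- The ring of `σ^*`-invariants of `A_{v,E}` is `A_v`. -/
theorem mem_range_algebraMap_of_completedFrob_eq {x : X.CompletedCoeff E v}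
    (hx : X.completedFrob E v x = x) :
    ∃ b, algebraMap (X.Av v) (X.CompletedCoeff E v) b = x := by
  have h : ∀ n, ∃ a : X.A, X.evalCompletedCoeff E v n x = Ideal.Quotient.mk _ (1 ⊗ₜ a) := by
    intro n
    obtain ⟨z, hz⟩ := Ideal.Quotient.mk_surjective (X.evalCompletedCoeff E v n x)
    have h1 : X.evalCompletedCoeff E v n (X.completedFrob E v x) =
        Ideal.Quotient.mk _ (frob Fq E X.A z) := by
      refine (AdicCompletion.evalₐ_mapRingHom _ _ _ (X.placeIdeal_map_frob E v) n x).trans ?_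
      change Ideal.quotientMap _ _ _ (X.evalCompletedCoeff E v n x) = _
      rw [← hz]
      exact Ideal.quotientMap_mk
    rw [hx, ← hz, eq_comm, Ideal.Quotient.eq, placeIdeal_pow] at h1
    obtain ⟨a, ha⟩ := exists_sub_one_tmul_mem_of_frob_sub_mem _ h1
    refine ⟨a, ?_⟩
    rw [← hz, Ideal.Quotient.eq, placeIdeal_pow]
    exact ha
  choose a ha using h
  -- The difference `1 ⊗ (a n - a (n + 1))` lies in the extension of `v ^ n`, hence `a n - a (n +
  -- 1)` lies in `v ^ n`, so the representatives converge in `A_v`.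
  let c : AdicCompletion.AdicCauchySequence v X.A := AdicCompletion.AdicCauchySequence.mk v X.A a
    (by
      intro n
      rw [SModEq.sub_mem, smul_eq_mul, Ideal.mul_top]
      apply mem_of_one_tmul_mem_map (k := Fq) (E := E)
      rw [← placeIdeal_pow, TensorProduct.tmul_sub, ← Ideal.Quotient.eq, ← ha]
      rw [← X.factorPow_evalCompletedCoeff E v (Nat.le_succ n), ha (n + 1)]
      exact Ideal.Quotient.factor_mk _ _)
  refine ⟨AdicCompletion.mk v X.A c, ?_⟩
  refine completedCoeff_ext fun n => ?_
  rw [ha]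
  exact X.evalCompletedCoeff_algebraMap E v n _ _ (AdicCompletion.evalₐ_mk _ n c)

end PointedCurve

/-- For a finitely generated ideal the kernel of reduction modulo `I` is the ideal that `I`
generates in the completion. This makes `A_{v,Ls}` modulo `v` generated by `Ls` and `A`. -/
theorem AdicCompletion.exists_sub_algebraMap_mem {S : Type*} [CommRing S] {I : Ideal S} (hI : I.FG)
    (x : AdicCompletion I S) : ∃ z, x - algebraMap S _ z ∈ I.map (algebraMap S (AdicCompletion I S)) := by
  obtain ⟨z, hz⟩ := Ideal.Quotient.mk_surjective (AdicCompletion.evalOneₐ I x)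
  refine ⟨z, ?_⟩
  rw [← AdicCompletion.ker_evalOneₐ_eq_map _ hI, RingHom.mem_ker]
  refine (map_sub (AdicCompletion.evalOneₐ I) _ _).trans ?_
  rw [sub_eq_zero, ← hz]
  exact (AlgHom.commutes (AdicCompletion.evalOneₐ I) z).symm

/-! ### The Tate module at `v`. -/

namespace PureAndersonMotive

variable {Fq : Type u} [Field Fq] [Fintype Fq] {X : PointedCurve Fq}
  {L : Type*} [Field L] [Finite L] [Algebra Fq L] {c : X.A →ₐ[Fq] L} {r d : ℕ}
  {M : Type*} [AddCommGroup M] [Module (L ⊗[Fq] X.A) M] (𝓜 : PureAndersonMotive X c r d M)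
  (Ls : Type*) [Field Ls] [Algebra Fq Ls] [Algebra L Ls] [IsScalarTower Fq L Ls]
  (v : Ideal X.A)

omit [Fintype Fq] [Finite L] in
theorem algebraMap_completedCoeff_eq (z : L ⊗[Fq] X.A) :
    algebraMap (L ⊗[Fq] X.A) (X.CompletedCoeff Ls v) z = X.toCompletedCoeff Ls v
      (Algebra.TensorProduct.map (IsScalarTower.toAlgHom Fq L Ls) (AlgHom.id Fq X.A) z) := rfl

omit [Fintype Fq] [Finite L] in
theorem algebraMap_completedCoeff_injective (hv : v ≠ ⊤) :
    Function.Injective (algebraMap (L ⊗[Fq] X.A) (X.CompletedCoeff Ls v)) := by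
  refine (X.toCompletedCoeff_injective Ls v hv).comp ?_
  exact Module.Flat.rTensor_preserves_injective_linearMap (M := X.A)
    (IsScalarTower.toAlgHom Fq L Ls).toLinearMap (algebraMap L Ls).injective

/-- The place `v` differs from the characteristic, so some `a ∈ v` has `c a ≠ 0`. Modulo `v` the
element `1 ⊗ a - c a ⊗ 1` becomes the unit `-c a ⊗ 1`. Its `d`-th power kills the cokernel of `τ`,
so that cokernel vanishes modulo `v`, as `exists_basis_fixed` demands. -/
theorem exists_basis_completedTau_fixed [IsSepClosed Ls] (hv : v.IsMaximal)
    (hvc : v ≠ RingHom.ker c) :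
    ∃ (n : ℕ) (b : Module.Basis (Fin n) (X.CompletedCoeff Ls v)
      (X.CompletedCoeff Ls v ⊗[L ⊗[Fq] X.A] M)), ∀ i, 𝓜.completedTau Ls v (b i) = b i := by
  have := 𝓜.finite
  have := 𝓜.projective
  have := X.finite_quotient v
  let R := X.CompletedCoeff Ls v
  let : Algebra Ls R := ((X.toCompletedCoeff Ls v).comp
    (Algebra.TensorProduct.includeLeft (R := Fq) (S := Fq) : Ls →ₐ[Fq] Ls ⊗[Fq] X.A).toRingHom).toAlgebra
  let : Algebra X.A R := ((X.toCompletedCoeff Ls v).comp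
    (Algebra.TensorProduct.includeRight : X.A →ₐ[Fq] Ls ⊗[Fq] X.A).toRingHom).toAlgebra
  have hI : v.map (algebraMap X.A R) = (X.placeIdeal Ls v).map (X.toCompletedCoeff Ls v) :=
    (Ideal.map_map _ _).symm
  have hfg : (X.placeIdeal Ls v).FG := Ideal.FG.map (IsNoetherian.noetherian v) _
  have hcomplete : IsAdicComplete (v.map (algebraMap X.A R)) R := by
    rw [hI]
    have h := AdicCompletion.isAdicComplete (M := Ls ⊗[Fq] X.A) hfg
    rw [← IsAdicComplete.map_algebraMap_iff
      (S := AdicCompletion (X.placeIdeal Ls v) (Ls ⊗[Fq] X.A))] at h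
    exact h
  refine exists_basis_fixed (k := Fq) (E := Ls) (A := X.A) ?_ (X.completedFrob Ls v) ?_ ?_ v ?_
    (𝓜.completedTau Ls v).toAddMonoidHom (fun r x => LinearMap.map_smulₛₗ (𝓜.completedTau Ls v) r x) ?_
  · refine RingHom.ext fun a => congrArg (X.toCompletedCoeff Ls v) ?_
    change algebraMap Fq Ls a ⊗ₜ 1 = 1 ⊗ₜ algebraMap Fq X.A a
    rw [Algebra.algebraMap_eq_smul_one, Algebra.algebraMap_eq_smul_one, TensorProduct.smul_tmul]
  · intro a
    refine (X.completedFrob_toCompletedCoeff Ls v (a ⊗ₜ 1)).trans ?_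
    rw [frob_tmul]; rfl
  · intro a
    refine (X.completedFrob_toCompletedCoeff Ls v (1 ⊗ₜ a)).trans ?_
    rw [frob_tmul, one_pow]; rfl
  · intro x
    obtain ⟨z, hz⟩ := AdicCompletion.exists_sub_algebraMap_mem hfg x
    refine ⟨X.toCompletedCoeff Ls v z, ?_, ?_⟩
    · clear hz
      induction z with
      | zero => rw [map_zero]; exact zero_mem _
      | add x y hx hy => rw [map_add]; exact add_mem hx hy
      | tmul e a =>
        have : X.toCompletedCoeff Ls v (e ⊗ₜ a) = e • algebraMap X.A R a := by
          rw [Algebra.smul_def]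
          change _ = X.toCompletedCoeff Ls v (e ⊗ₜ 1) * X.toCompletedCoeff Ls v (1 ⊗ₜ a)
          rw [← map_mul, Algebra.TensorProduct.tmul_mul_tmul, mul_one, one_mul]
        rw [this]
        exact Submodule.smul_mem _ _ (Submodule.subset_span ⟨a, rfl⟩)
    · rw [hI]; exact hz
  · set I := v.map (algebraMap X.A R)
    set S := Submodule.span R (Set.range (𝓜.completedTau Ls v).toAddMonoidHom)
    obtain ⟨a, hav, hac⟩ : ∃ a ∈ v, c a ≠ 0 := by
      by_contra! h
      exact hvc (hv.eq_of_le (RingHom.ker_ne_top c) h)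
    have hspan : ∀ x ∈ Submodule.span (L ⊗[Fq] X.A) (Set.range 𝓜.τ),
        (1 : R) ⊗ₜ[L ⊗[Fq] X.A] x ∈ S := by
      intro x hx
      induction hx using Submodule.span_induction with
      | mem x hx =>
        obtain ⟨x, rfl⟩ := hx
        refine Submodule.subset_span ⟨1 ⊗ₜ x, ?_⟩
        change 𝓜.completedTau Ls v (1 ⊗ₜ x) = _
        rw [completedTau, semilinearBaseChange_tmul, map_one]
      | zero => rw [TensorProduct.tmul_zero]; exact zero_mem _
      | add x y _ _ hx hy => rw [TensorProduct.tmul_add]; exact add_mem hx hy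
      | smul b x _ hx =>
        rw [← TensorProduct.smul_tmul, Algebra.smul_def, mul_one]
        have := Submodule.smul_mem _ (algebraMap (L ⊗[Fq] X.A) R b) hx
        rwa [TensorProduct.smul_tmul', smul_eq_mul, mul_one] at this
    set j : L ⊗[Fq] X.A := 1 ⊗ₜ a - c a ⊗ₜ 1
    have hj : j ∈ X.characteristicIdeal c := Ideal.subset_span ⟨a, rfl⟩
    set γ : R := algebraMap (L ⊗[Fq] X.A) R (c a ⊗ₜ 1)
    have hγ : IsUnit γ :=
      ((IsUnit.mk0 _ hac).map (Algebra.TensorProduct.includeLeft (R := Fq) (S := Fq) :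
        L →ₐ[Fq] L ⊗[Fq] X.A)).map (algebraMap (L ⊗[Fq] X.A) R)
    have hα : algebraMap (L ⊗[Fq] X.A) R (1 ⊗ₜ a) ∈ I := by
      have : algebraMap (L ⊗[Fq] X.A) R (1 ⊗ₜ a) = algebraMap X.A R a := by
        rw [algebraMap_completedCoeff_eq, Algebra.TensorProduct.map_tmul, map_one]; rfl
      rw [this]; exact Ideal.mem_map_of_mem _ hav
    have hI : algebraMap (L ⊗[Fq] X.A) R j ^ d - (-γ) ^ d ∈ I := by
      rw [← Ideal.Quotient.eq, map_pow, map_pow]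
      congr 1
      rw [Ideal.Quotient.eq, map_sub, sub_neg_eq_add, sub_add_cancel]
      exact hα
    rw [← top_le_iff]
    intro x _
    induction x with
    | zero => exact zero_mem _
    | add x y hx hy => exact add_mem (hx trivial) (hy trivial)
    | tmul s m =>
      have h1 := 𝓜.coker_annihilated _ (Ideal.pow_mem_pow hj d) m
      have h2 := hspan _ h1
      rw [← TensorProduct.smul_tmul, Algebra.smul_def, mul_one, map_pow] at h2
      obtain ⟨g, hg⟩ := (hγ.neg.pow d)
      -- With `g = (-γ) ^ d`, this is `s = s g⁻¹ j ^ d - s g⁻¹ (j ^ d - g)`: the first term lies in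
      -- the span of the image of `τ`, the second is divisible by `v`.
      have h3 : s ⊗ₜ[L ⊗[Fq] X.A] m = (s * ↑g⁻¹) • ((algebraMap (L ⊗[Fq] X.A) R j ^ d) ⊗ₜ[L ⊗[Fq] X.A] m) +
          (algebraMap (L ⊗[Fq] X.A) R j ^ d - (-γ) ^ d) •
            ((-(s * ↑g⁻¹)) ⊗ₜ[L ⊗[Fq] X.A] m) := by
        rw [TensorProduct.smul_tmul', TensorProduct.smul_tmul', ← TensorProduct.add_tmul, ← hg]
        congr 1
        simp only [smul_eq_mul]
        linear_combination (-s) * g.mul_inv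
      rw [h3]
      exact add_mem (Submodule.mem_sup_left (Submodule.smul_mem _ _ h2))
        (Submodule.mem_sup_right (Submodule.smul_mem_smul hI trivial))

/-- A basis of `φ`-invariants is a basis of the Tate module. -/
theorem exists_basis_tateModule {n : ℕ} (b : Module.Basis (Fin n) (X.CompletedCoeff Ls v)
      (X.CompletedCoeff Ls v ⊗[L ⊗[Fq] X.A] M)) (hb : ∀ i, 𝓜.completedTau Ls v (b i) = b i) :
    ∃ b' : Module.Basis (Fin n) (X.Av v) (𝓜.tateModule Ls v), ∀ i, (b' i).1 = b i := by
  let t : Fin n → 𝓜.tateModule Ls v := fun i => ⟨b i, hb i⟩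
  have hli : LinearIndependent (X.Av v) t := by
    refine LinearIndependent.of_comp (𝓜.tateModule Ls v).subtype ?_
    rw [Fintype.linearIndependent_iff]
    intro g hg i
    have h := Fintype.linearIndependent_iff.mp b.linearIndependent
      (fun i => algebraMap (X.Av v) (X.CompletedCoeff Ls v) (g i)) (by
        simp only [algebraMap_smul]; exact hg) i
    exact (map_eq_zero_iff _ (X.algebraMap_completedCoeff_injective Ls v)).mp h
  have hsp : ⊤ ≤ Submodule.span (X.Av v) (Set.range t) := by
    rintro ⟨x, hx⟩ -
    have hx' : 𝓜.completedTau Ls v x = x := hx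
    -- Since `τ` is semilinear and fixes the basis, the coordinates of an invariant vector are
    -- `σ^*`-invariant, hence in `A_v`.
    have hfix : ∀ i, X.completedFrob Ls v (b.repr x i) = b.repr x i := by
      intro i
      have h : ∑ j, X.completedFrob Ls v (b.repr x j) • b j = x := by
        conv_rhs => rw [← hx', ← b.sum_repr x]
        simp only [map_sum, map_smulₛₗ, hb]
      have := congrArg (fun y => b.repr y i) h
      simpa only [b.repr_sum_self] using this
    choose g hg using fun i => X.mem_range_algebraMap_of_completedFrob_eq (hfix i)
    have : (⟨x, hx⟩ : 𝓜.tateModule Ls v) = ∑ i, g i • t i := by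
      ext
      rw [Submodule.coe_sum]
      conv_lhs => rw [show ((⟨x, hx⟩ : 𝓜.tateModule Ls v) : _ ⊗[_] M) = x from rfl, ← b.sum_repr x]
      refine Finset.sum_congr rfl fun i _ => ?_
      rw [← hg, algebraMap_smul]; rfl
    rw [this]
    exact Submodule.sum_mem _ fun i _ =>
      Submodule.smul_mem _ _ (Submodule.subset_span ⟨i, rfl⟩)
  exact ⟨Module.Basis.mk hli hsp, fun i => by rw [Module.Basis.mk_apply]⟩

/-- The matrix of the Frobenius endomorphism of the Tate module is also its matrix over
`A_{v,Ls}`. -/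
theorem toMatrix_frobenius_baseChange {n : ℕ} (b : Module.Basis (Fin n) (X.CompletedCoeff Ls v)
      (X.CompletedCoeff Ls v ⊗[L ⊗[Fq] X.A] M))
    (b' : Module.Basis (Fin n) (X.Av v) (𝓜.tateModule Ls v)) (hb : ∀ i, (b' i).1 = b i) :
    LinearMap.toMatrix b b (𝓜.frobenius.baseChange (X.CompletedCoeff Ls v)) =
      (LinearMap.toMatrix b' b' (𝓜.tateFrobenius Ls v)).map
        (algebraMap (X.Av v) (X.CompletedCoeff Ls v)) := by
  ext i j
  rw [Matrix.map_apply, LinearMap.toMatrix_apply, LinearMap.toMatrix_apply]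
  have h : 𝓜.frobenius.baseChange (X.CompletedCoeff Ls v) (b j) =
      ∑ i, algebraMap (X.Av v) (X.CompletedCoeff Ls v)
        (b'.repr (𝓜.tateFrobenius Ls v (b' j)) i) • b i := by
    rw [← hb]
    have := congrArg Subtype.val (b'.sum_repr (𝓜.tateFrobenius Ls v (b' j)))
    rw [Submodule.coe_sum] at this
    refine Eq.trans this.symm ?_
    refine Finset.sum_congr rfl fun i _ => ?_
    rw [algebraMap_smul, ← hb]; rfl
  rw [h, b.repr_sum_self]

end PureAndersonMotive

/-! ### Compound matrices and characteristic polynomials of exterior powers. -/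

section Compound

open Polynomial Set

/-- The `i`-th compound matrix, whose entries are the minors of size `i`. -/
noncomputable def Matrix.compound {R : Type*} [CommRing R] {n : ℕ} (i : ℕ)
    (A : Matrix (Fin n) (Fin n) R) :
    Matrix (powersetCard (Fin n) i) (powersetCard (Fin n) i) R :=
  Matrix.of fun s t =>
    (A.submatrix (powersetCard.ofFinEmbEquiv.symm s) (powersetCard.ofFinEmbEquiv.symm t)).det

theorem Matrix.compound_map {R S : Type*} [CommRing R] [CommRing S] {n : ℕ} (i : ℕ)
    (A : Matrix (Fin n) (Fin n) R) (f : R →+* S) :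
    (A.map f).compound i = (A.compound i).map f := by
  ext s t
  simp only [Matrix.compound, Matrix.of_apply, Matrix.map_apply, RingHom.map_det]
  rfl

/-- The characteristic polynomial of an exterior power is carried along ring maps through matrices
of minors, so that exterior powers need be compared only over rings where the modules are free. -/
theorem Matrix.charpoly_compound_map {R S : Type*} [CommRing R] [CommRing S] {n : ℕ} (i : ℕ)
    (A : Matrix (Fin n) (Fin n) R) (f : R →+* S) :
    ((A.map f).compound i).charpoly = (A.compound i).charpoly.map f := by
  rw [Matrix.compound_map, Matrix.charpoly_map]

variable {R P : Type*} [CommRing R] [AddCommGroup P] [Module R P]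

theorem LinearMap.toMatrix_exteriorPower_map {n : ℕ} (b : Module.Basis (Fin n) R P) (i : ℕ)
    (f : P →ₗ[R] P) :
    LinearMap.toMatrix (b.exteriorPower i) (b.exteriorPower i) (exteriorPower.map i f) =
      (LinearMap.toMatrix b b f).compound i := by
  ext s t
  rw [LinearMap.toMatrix_apply, exteriorPower.basis_repr_apply, exteriorPower.basis_apply,
    exteriorPower.map_apply_ιMulti_family, exteriorPower.ιMulti_family,
    exteriorPower.ιMultiDual_apply_ιMulti, Matrix.compound, Matrix.of_apply, ← Matrix.det_transpose]
  congr 1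
  ext a c
  simp [LinearMap.toMatrix_apply]

theorem LinearMap.charpoly_exteriorPower_map [Module.Finite R P] [Module.Free R P] {n : ℕ}
    (b : Module.Basis (Fin n) R P) (i : ℕ) (f : P →ₗ[R] P) :
    (exteriorPower.map i f).charpoly = ((LinearMap.toMatrix b b f).compound i).charpoly := by
  rw [← LinearMap.toMatrix_exteriorPower_map, LinearMap.charpoly_toMatrix]

/-- The polynomials of `g ∘ f` and `f ∘ g` agree up to a power of `X`; with a factor on both sides
no comparison of the two ranks is needed. -/
theorem LinearMap.charpoly_comp_comm {P' ι ι' : Type*} [AddCommGroup P'] [Module R P']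
    [Module.Finite R P] [Module.Free R P] [Module.Finite R P'] [Module.Free R P']
    [Fintype ι] [Fintype ι'] (b : Module.Basis ι R P) (b' : Module.Basis ι' R P')
    (f : P →ₗ[R] P') (g : P' →ₗ[R] P) :
    X ^ Fintype.card ι' * (g ∘ₗ f).charpoly = X ^ Fintype.card ι * (f ∘ₗ g).charpoly := by
  classical
  rw [← LinearMap.charpoly_toMatrix (g ∘ₗ f) b, ← LinearMap.charpoly_toMatrix (f ∘ₗ g) b',
    LinearMap.toMatrix_comp b b' b, LinearMap.toMatrix_comp b' b b']
  exact Matrix.charpoly_mul_comm' _ _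

theorem card_powersetCard_fin (n i : ℕ) : Fintype.card (powersetCard (Fin n) i) = n.choose i := by
  rw [Fintype.card_eq_nat_card, powersetCard.card, Nat.card_fin]

/-- The characteristic polynomial of an exterior power of an endomorphism of a direct summand of
a free module, after a base change that makes the summand free. -/
theorem charpoly_exteriorPower_baseChange {M : Type*} [AddCommGroup M] [Module R M] {N : ℕ}
    (e : Fin N → M) (f : Fin N → M →ₗ[R] R) (hef : ∀ x, ∑ j, f j x • e j = x) (π : M →ₗ[R] M)
    {S : Type*} [CommRing S] [Algebra R S] {n : ℕ} (b : Module.Basis (Fin n) S (S ⊗[R] M)) (i : ℕ) :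
    X ^ N.choose i * ((LinearMap.toMatrix b b (π.baseChange S)).compound i).charpoly =
      X ^ n.choose i * ((Matrix.of fun j l => f j (π (e l))).compound i).charpoly.map
        (algebraMap R S) := by
  let F : M →ₗ[R] (Fin N → R) := LinearMap.pi f
  let G : (Fin N → R) →ₗ[R] M := Fintype.linearCombination R e
  have hGF : G ∘ₗ F = LinearMap.id := by
    ext x; simp [F, G, Fintype.linearCombination_apply, hef]
  let c := Algebra.TensorProduct.basis S (Pi.basisFun R (Fin N))
  have := Module.Free.of_basis b
  have := Module.Finite.of_basis b
  have h1 : LinearMap.toMatrix c c ((F ∘ₗ π ∘ₗ G).baseChange S) =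
      (Matrix.of fun j l => f j (π (e l))).map (algebraMap R S) := by
    rw [LinearMap.toMatrix_baseChange]
    congr 1
    ext j l
    simp [F, G]
  rw [← Matrix.charpoly_compound_map, ← h1, ← LinearMap.charpoly_exteriorPower_map,
    ← LinearMap.charpoly_exteriorPower_map]
  have h2 : (F ∘ₗ π ∘ₗ G).baseChange S =
      F.baseChange S ∘ₗ (π.baseChange S ∘ₗ G.baseChange S) := by
    rw [LinearMap.baseChange_comp, LinearMap.baseChange_comp]
  -- As `G ∘ F = id`, the maps `π` and `F π G` are the two products of `π G` and `F`, and the same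
  -- holds after exterior powers.
  have h3 : π.baseChange S = (π.baseChange S ∘ₗ G.baseChange S) ∘ₗ F.baseChange S := by
    rw [LinearMap.comp_assoc, ← LinearMap.baseChange_comp, hGF, LinearMap.baseChange_id,
      LinearMap.comp_id]
  rw [h2, exteriorPower.map_comp]
  conv_lhs => rw [h3, exteriorPower.map_comp]
  have h4 := LinearMap.charpoly_comp_comm (b.exteriorPower i) (c.exteriorPower i)
    (exteriorPower.map i (F.baseChange S)) (exteriorPower.map i (π.baseChange S ∘ₗ G.baseChange S))
  rwa [card_powersetCard_fin, card_powersetCard_fin] at h4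

/-- Used with `A₀ = A`, `A₁ = A_L`, `A₂ = A_v` and `R = A_{v,Ls}`. Up to the shift by `a`, each
coefficient of `q` has the same image in `R` as a coefficient of `p`, and such a common image comes
from `A₀`. -/
theorem exists_polynomial_descent {A₀ A₁ A₂ R : Type*} [CommRing A₀] [CommRing A₁] [CommRing A₂]
    [CommRing R] (j : A₀ →+* A₁) (θ : A₀ →+* A₂) (ι : A₁ →+* R) (κ : A₂ →+* R)
    (hι : Function.Injective ι) (hκ : Function.Injective κ) (hcomm : ι.comp j = κ.comp θ)
    (h : ∀ x y, ι x = κ y → ∃ a, j a = x) {p : A₁[X]} {q : A₂[X]} {a : ℕ}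
    (hpq : p.map ι = X ^ a * q.map κ) :
    ∃ P : A₀[X], P.map θ = q ∧ p = X ^ a * P.map j := by
  have hcoeff : ∀ n, ∃ y, θ y = q.coeff n := by
    intro n
    have h1 : ι (p.coeff (n + a)) = κ (q.coeff n) := by
      rw [← coeff_map, hpq, coeff_X_pow_mul, coeff_map]
    obtain ⟨y, hy⟩ := h _ _ h1
    refine ⟨y, hκ ?_⟩
    rw [← h1, ← hy]
    exact congr($hcomm y).symm
  obtain ⟨P, hP⟩ := (mem_map_range θ (p := q)).mpr fun n => hcoeff n
  refine ⟨P, hP, map_injective ι hι ?_⟩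
  rw [hpq, Polynomial.map_mul, Polynomial.map_pow, map_X, map_map, hcomm, ← map_map]
  exact congrArg _ (congrArg _ hP.symm)

end Compound

/-! ### Descent of the characteristic polynomial to `A`. -/

namespace PureAndersonMotive

variable {Fq : Type u} [Field Fq] [Fintype Fq] {X : PointedCurve Fq}
  {L : Type*} [Field L] [Finite L] [Algebra Fq L] {c : X.A →ₐ[Fq] L} {r d : ℕ}
  {M : Type*} [AddCommGroup M] [Module (L ⊗[Fq] X.A) M]

theorem finrank_baseChange (𝓜 : PureAndersonMotive X c r d M) (S : Type*) [CommRing S]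
    [Nontrivial S] [Algebra (L ⊗[Fq] X.A) S] [Module.Free S (S ⊗[L ⊗[Fq] X.A] M)] :
    Module.finrank S (S ⊗[L ⊗[Fq] X.A] M) = r := by
  have := 𝓜.finite
  have := 𝓜.projective
  obtain ⟨p⟩ : Nonempty (PrimeSpectrum S) := inferInstance
  rw [← 𝓜.rank_eq (p.comap (algebraMap _ S)), ← Module.rankAtStalk_baseChange,
    Module.rankAtStalk_eq_finrank_of_free]
  rfl

/-- The polynomial is computed once over `A_L`, from the matrix of `π` on a free module containing
`M` as a summand. Base change to `A_{v,Ls}` compares it with the Tate module, base change to `K`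
with `M ⊗ K`. The second comparison lets the same `P` be examined at `∞`. -/
theorem exists_charpoly [Module.Finite (L ⊗[Fq] X.A) M] (𝓜 : PureAndersonMotive X c r d M)
    (Ls : Type*) [Field Ls] [Algebra Fq Ls] [Algebra L Ls]
    [IsScalarTower Fq L Ls] [IsSepClosed Ls] (v : Ideal X.A) (hv : v.IsMaximal)
    (hvc : v ≠ RingHom.ker c) (i : ℕ) :
    ∃ (_ : Module.Finite (X.Qv v) (𝓜.RationalTateModule Ls v))
      (_ : Module.Free (X.Qv v) (𝓜.RationalTateModule Ls v)) (P : Polynomial X.A),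
      P.map (algebraMap X.A (X.Qv v)) =
        (exteriorPower.map i (𝓜.rationalTateFrobenius Ls v)).charpoly ∧
      ∀ (K : Type w) [Field K] [Algebra (L ⊗[Fq] X.A) K],
        P.map ((algebraMap (L ⊗[Fq] X.A) K).comp
          (Algebra.TensorProduct.includeRight : X.A →ₐ[Fq] L ⊗[Fq] X.A).toRingHom) =
          (exteriorPower.map i (𝓜.frobenius.baseChange K)).charpoly := by
  have := 𝓜.projective
  obtain ⟨n, b, hb⟩ := 𝓜.exists_basis_completedTau_fixed Ls v hv hvc
  obtain ⟨b', hb'⟩ := 𝓜.exists_basis_tateModule Ls v b hb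
  have hfree := Module.Free.of_basis b'
  have hfin := Module.Finite.of_basis b'
  have hfreeR := Module.Free.of_basis b
  have hinj := algebraMap_completedCoeff_injective (L := L) Ls v hv.ne_top
  have hnt : Nontrivial (X.CompletedCoeff Ls v) := hinj.nontrivial
  -- The ranks over `A_{v,Ls}` and over `K` must coincide for the factors `X ^ n.choose i` to match,
  -- and for the extra powers of `X` to cancel at the end.
  have hn : n = r := by
    rw [← 𝓜.finrank_baseChange (X.CompletedCoeff Ls v), Module.finrank_eq_card_basis b,
      Fintype.card_fin]
  subst hn
  obtain ⟨N, e, f, hef⟩ := exists_dual_family (L ⊗[Fq] X.A) M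
  set p := Polynomial.X ^ n.choose i * ((Matrix.of fun j l => f j (𝓜.frobenius (e l))).compound i).charpoly
  set D := LinearMap.toMatrix b' b' (𝓜.tateFrobenius Ls v)
  have hp : p.map (algebraMap _ (X.CompletedCoeff Ls v)) =
      Polynomial.X ^ N.choose i * (D.compound i).charpoly.map (algebraMap (X.Av v) _) := by
    rw [← Matrix.charpoly_compound_map, ← 𝓜.toMatrix_frobenius_baseChange Ls v b b' hb',
      charpoly_exteriorPower_baseChange e f hef, Polynomial.map_mul, Polynomial.map_pow, Polynomial.map_X]
  obtain ⟨P, hP, hpP⟩ := exists_polynomial_descent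
    (Algebra.TensorProduct.includeRight : X.A →ₐ[Fq] L ⊗[Fq] X.A).toRingHom
    (algebraMap X.A (X.Av v)) _ _ hinj (X.algebraMap_completedCoeff_injective Ls v) (by
      refine RingHom.ext fun a => Eq.trans ?_ (X.algebraMap_algebraMap_completedCoeff Ls v a).symm
      change algebraMap (L ⊗[Fq] X.A) _ (1 ⊗ₜ a) = _
      rw [algebraMap_completedCoeff_eq, Algebra.TensorProduct.map_tmul, map_one]; rfl) (by
      intro x y hxy
      -- An element of `A_L` whose image comes from `A_v` is `σ^*`-invariant, since `A_L` embeds in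
      -- the completion; hence it is of the form `1 ⊗ a`.
      have h1 := completedFrob_algebraMap (X := X) Ls v x
      rw [hxy, completedFrob_Av, ← hxy] at h1
      obtain ⟨a, ha⟩ := exists_eq_one_tmul_of_frob_eq (hinj h1).symm
      exact ⟨a, ha.symm⟩) hp
  refine ⟨inferInstance, inferInstance, P, ?_, ?_⟩
  · rw [LinearMap.charpoly_exteriorPower_map (Algebra.TensorProduct.basis (X.Qv v) b'),
      rationalTateFrobenius, LinearMap.toMatrix_baseChange, Matrix.charpoly_compound_map, ← hP, Polynomial.map_map,
      ← IsScalarTower.algebraMap_eq]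
  · intro K _ _
    let bK := Module.finBasisOfFinrankEq K _ (𝓜.finrank_baseChange K)
    have h := charpoly_exteriorPower_baseChange e f hef 𝓜.frobenius bK i
    rw [← LinearMap.charpoly_exteriorPower_map] at h
    have h2 : p.map (algebraMap _ K) = Polynomial.X ^ N.choose i *
        (exteriorPower.map i (𝓜.frobenius.baseChange K)).charpoly := by
      rw [h, Polynomial.map_mul, Polynomial.map_pow, Polynomial.map_X]
    rw [hpP, Polynomial.map_mul, Polynomial.map_pow, Polynomial.map_X, Polynomial.map_map] at h2
    exact mul_left_cancel₀ (pow_ne_zero _ Polynomial.X_ne_zero) h2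

end PureAndersonMotive

/-! ### Lattices and eigenvalues of absolute value one. -/

section Lattice

/-- An element of a field that is integral over a ring whose elements have absolute value at most
one has itself absolute value at most one. -/
theorem AbsoluteValue.le_one_of_isIntegral {O K : Type*} [CommRing O] [Field K] [Algebra O K]
    (abv : AbsoluteValue K ℝ) (hO : ∀ a : O, abv (algebraMap O K a) ≤ 1) {β : K}
    (hβ : IsIntegral O β) : abv β ≤ 1 := by
  obtain ⟨s, hs⟩ := hβ.fg_adjoin_singleton
  -- All powers of `β` lie in one finitely generated `O`-module, on which `abv` is bounded. Only the
  -- triangle inequality enters, so `abv` need not be assumed ultrametric.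
  have hbound : ∀ x ∈ Submodule.span O (s : Set K), abv x ≤ ∑ y ∈ s, abv y := by
    intro x hx
    obtain ⟨g, -, rfl⟩ := Submodule.mem_span_finset.mp hx
    refine (abv.sum_le _ _).trans (Finset.sum_le_sum fun y _ => ?_)
    rw [Algebra.smul_def, map_mul]
    exact mul_le_of_le_one_left (abv.nonneg _) (hO _)
  by_contra! h
  obtain ⟨n, hn⟩ := pow_unbounded_of_one_lt (∑ y ∈ s, abv y) h
  refine hn.not_ge ?_
  rw [← map_pow]
  refine hbound _ ?_
  rw [hs]
  exact pow_mem (Algebra.subset_adjoin (Set.mem_singleton β)) n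

variable {O K V : Type*} [CommRing O] [Field K] [Algebra O K] [AddCommGroup V] [Module K V]
  [Module O V] [IsScalarTower O K V]

/-- The eigenvalues of an endomorphism that preserves a finitely generated spanning submodule are
integral. -/
theorem Module.End.isIntegral_of_hasEigenvalue {P : Type*} [AddCommGroup P] [Module O P]
    [Module.Finite O P] (Φ : P →ₗ[O] V) (hΦ : Submodule.span K (Set.range Φ) = ⊤) (h : P →ₗ[O] P)
    (H : Module.End K V) (hH : ∀ x, H (Φ x) = Φ (h x)) {β : K} (hβ : H.HasEigenvalue β) :
    IsIntegral O β := by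
  -- Cayley–Hamilton for a finitely generated module: `F` kills `h`, hence `H` on the spanning image
  -- of `Φ`, hence its eigenvalue `β`. Neither freeness of `P` nor injectivity of `Φ` matters.
  obtain ⟨F, hF, hFh⟩ := LinearMap.exists_monic_and_aeval_eq_zero O h
  refine ⟨F, hF, ?_⟩
  have key : ∀ (G : Polynomial O) (x : P),
      Polynomial.aeval H (G.map (algebraMap O K)) (Φ x) = Φ (Polynomial.aeval h G x) := by
    intro G x
    have hpow : ∀ n : ℕ, (H ^ n) (Φ x) = Φ ((h ^ n) x) := by
      intro n
      induction n with
      | zero => rfl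
      | succ n ih => rw [pow_succ', pow_succ', Module.End.mul_apply, ih, hH, Module.End.mul_apply]
    induction G using Polynomial.induction_on' with
    | add p q hp hq =>
      rw [Polynomial.map_add, map_add, map_add, LinearMap.add_apply, LinearMap.add_apply, map_add,
        hp, hq]
    | monomial n a =>
      rw [Polynomial.map_monomial, Polynomial.aeval_monomial, Polynomial.aeval_monomial,
        Module.algebraMap_end_eq_smul_id, Module.algebraMap_end_eq_smul_id,
        Module.End.mul_apply, Module.End.mul_apply, hpow, LinearMap.smul_apply,
        LinearMap.smul_apply, map_smul, algebraMap_smul]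
      rfl
  have hzero : Polynomial.aeval H (F.map (algebraMap O K)) = 0 := by
    refine LinearMap.ext_on_range (v := Φ) hΦ fun x => ?_
    rw [key, hFh, LinearMap.zero_apply, map_zero, LinearMap.zero_apply]
  obtain ⟨x, hx⟩ := hβ.exists_hasEigenvector
  have h1 := Module.End.aeval_apply_of_hasEigenvector (p := F.map (algebraMap O K)) hx
  rw [hzero, LinearMap.zero_apply] at h1
  have h2 := (smul_eq_zero.mp h1.symm).resolve_right hx.2
  rwa [Polynomial.eval_map] at h2

/-- The `i`-th exterior power of `N` over `O` is finitely generated, and its natural map to `⋀[K]^i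
V` is equivariant with image spanning over `K`. -/
theorem exteriorPower.isIntegral_of_hasEigenvalue (N : Submodule O V) (hN : N.FG)
    (hspan : Submodule.span K (N : Set V) = ⊤) (H : Module.End K V) (hH : ∀ x ∈ N, H x ∈ N)
    (i : ℕ) {β : K} (hβ : Module.End.HasEigenvalue (exteriorPower.map i H) β) :
    IsIntegral O β := by
  have : Module.Finite O N := Module.Finite.iff_fg.mpr hN
  have hval : ∀ [DecidableEq (Fin i)] (x : Fin i → N) (j : Fin i) (z : N),
      (fun k => (Function.update x j z k : V)) = Function.update (fun k => (x k : V)) j z :=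
    fun x j z => Function.comp_update (fun y : N => (y : V)) x j z
  let a : N [⋀^Fin i]→ₗ[O] ⋀[K]^i V :=
    { toFun := fun x => exteriorPower.ιMulti K i fun j => (x j : V)
      map_update_add' := fun x j y z => by
        simp only [hval, Submodule.coe_add]
        exact (exteriorPower.ιMulti K i (M := V)).map_update_add _ j _ _
      map_update_smul' := fun x j y z => by
        simp only [hval, Submodule.coe_smul]
        rw [← algebraMap_smul K y (z : V), ← algebraMap_smul K y (exteriorPower.ιMulti K i _)]
        exact (exteriorPower.ιMulti K i (M := V)).map_update_smul _ j _ _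
      map_eq_zero_of_eq' := fun x j k hjk hne =>
        (exteriorPower.ιMulti K i).map_eq_zero_of_eq _ (by simp [hjk]) hne }
  have ha : ∀ x, a x = exteriorPower.ιMulti K i fun j => (x j : V) := fun _ => rfl
  refine Module.End.isIntegral_of_hasEigenvalue (exteriorPower.alternatingMapLinearEquiv a) ?_
    (exteriorPower.map i ((H.restrictScalars O).restrict hH)) (exteriorPower.map i H) ?_ hβ
  · rw [← top_le_iff, ← exteriorPower.ιMulti_span_of_span K i V hspan, Submodule.span_le]
    rintro _ ⟨x, hx, rfl⟩
    refine Submodule.subset_span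
      ⟨exteriorPower.ιMulti O i fun j => (⟨x j, hx ⟨j, rfl⟩⟩ : N), ?_⟩
    rw [exteriorPower.alternatingMapLinearEquiv_apply_ιMulti, ha]
  · intro x
    have : (exteriorPower.map i H).restrictScalars O ∘ₗ exteriorPower.alternatingMapLinearEquiv a =
        exteriorPower.alternatingMapLinearEquiv a ∘ₗ
          exteriorPower.map i ((H.restrictScalars O).restrict hH) := by
      refine exteriorPower.linearMap_ext ?_
      ext x
      simp [ha]
      rfl
    exact congr($this x)

/-- The eigenvalues of the exterior powers of an endomorphism that stabilizes a lattice have absolute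
value one. -/
theorem exteriorPower.abv_eq_one_of_hasEigenvalue (abv : AbsoluteValue K ℝ)
    (hO : ∀ a : O, abv (algebraMap O K a) ≤ 1) (N : Submodule O V) (hN : N.FG)
    (hspan : Submodule.span K (N : Set V) = ⊤) (H : Module.End K V) (hH : ∀ x ∈ N, H x ∈ N)
    (hH' : ∀ x ∈ N, ∃ y ∈ N, H y = x) (i : ℕ) {β : K}
    (hβ : Module.End.HasEigenvalue (exteriorPower.map i H) β) : abv β = 1 := by
  have hfin : Module.Finite K V := by
    obtain ⟨s, hs⟩ := hN
    refine ⟨s, ?_⟩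
    rw [← hspan, ← hs, Submodule.span_span_of_tower]
  have hsurj : Function.Surjective H := by
    rw [← LinearMap.range_eq_top, ← top_le_iff, ← hspan, Submodule.span_le]
    intro x hx
    obtain ⟨y, -, rfl⟩ := hH' x hx
    exact ⟨y, rfl⟩
  -- The inverse of `H` also preserves `N`, so integrality applies to `β⁻¹` as well.
  let E := LinearEquiv.ofBijective H ⟨LinearMap.injective_iff_surjective.mpr hsurj, hsurj⟩
  have hE : exteriorPower.map i (E.symm : V →ₗ[K] V) ∘ₗ exteriorPower.map i H = LinearMap.id := by
    rw [← exteriorPower.map_comp, ← exteriorPower.map_id]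
    congr 1
    ext x
    exact E.symm_apply_apply x
  obtain ⟨x, hx⟩ := hβ.exists_hasEigenvector
  have h1 : β • exteriorPower.map i (E.symm : V →ₗ[K] V) x = x := by
    rw [← map_smul, ← hx.apply_eq_smul]
    exact congr($hE x)
  have hβ0 : β ≠ 0 := by
    rintro rfl
    exact hx.2 (by rw [← h1, zero_smul])
  have hβ' : Module.End.HasEigenvalue (exteriorPower.map i (E.symm : V →ₗ[K] V)) β⁻¹ := by
    refine Module.End.hasEigenvalue_of_hasEigenvector (x := x)
      ⟨Module.End.mem_eigenspace_iff.mpr ?_, hx.2⟩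
    conv_rhs => rw [← h1, inv_smul_smul₀ hβ0]
  refine le_antisymm (abv.le_one_of_isIntegral hO
    (exteriorPower.isIntegral_of_hasEigenvalue N hN hspan H hH i hβ)) ?_
  have h2 := abv.le_one_of_isIntegral hO (exteriorPower.isIntegral_of_hasEigenvalue N hN hspan
    (E.symm : V →ₗ[K] V) (fun y hy => by
      obtain ⟨z, hz, rfl⟩ := hH' y hy
      have : (E.symm : V →ₗ[K] V) (H z) = z := E.symm_apply_apply z
      rwa [this]) i hβ')
  rw [map_inv₀] at h2
  exact (inv_le_one₀ (abv.pos hβ0)).mp h2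

theorem exteriorPower.map_smul_pow_apply (g : Module.End K V) (a α : K) (l i : ℕ) {x : ⋀[K]^i V}
    (hx : exteriorPower.map i g x = α • x) :
    exteriorPower.map i (a • g ^ l) x = (a ^ i * α ^ l) • x := by
  have h1 : exteriorPower.map i (a • g ^ l) = a ^ i • exteriorPower.map i (g ^ l) := by
    refine exteriorPower.linearMap_ext ?_
    ext x
    have := (exteriorPower.ιMulti K i (M := V)).toMultilinearMap.map_smul_univ (fun _ => a)
      (fun j => (g ^ l) (x j))
    rw [Finset.prod_const, Finset.card_univ, Fintype.card_fin] at this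
    simp only [LinearMap.compAlternatingMap_apply, exteriorPower.map_apply_ιMulti,
      LinearMap.smul_apply]
    exact congrArg Subtype.val this
  have h2 : ∀ l : ℕ, exteriorPower.map i (g ^ l) x = α ^ l • x := by
    intro l
    induction l with
    | zero => rw [pow_zero, pow_zero, one_smul]; exact congr($(exteriorPower.map_id) x)
    | succ l ih =>
      rw [pow_succ, pow_succ, mul_smul, Module.End.mul_eq_comp, exteriorPower.map_comp,
        LinearMap.comp_apply, hx, map_smul, ih, smul_comm]
  rw [h1, LinearMap.smul_apply, h2, smul_smul]

end Lattice

/-! ### The lattice at infinity and powers of Frobenius. -/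

namespace PureAndersonMotive

variable {Fq : Type u} [Field Fq] [Fintype Fq] {X : PointedCurve Fq}
  {L : Type*} [Field L] [Finite L] [Algebra Fq L] {c : X.A →ₐ[Fq] L} {r d : ℕ}
  {M : Type*} [AddCommGroup M] [Module (L ⊗[Fq] X.A) M]

/-- The `e`-th iterate of `σ^*` is the identity, so its `(e - 1)`-st iterate inverts it on the local
ring. Images of lattices under `τ` are therefore already submodules. -/
theorem exists_frob_eq (x : X.localRingInfty L) :
    ∃ y ∈ X.localRingInfty L, frob Fq L X.Q y = x := by
  obtain ⟨x, t, rfl⟩ := x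
  have hcomm : ∀ t, frob Fq L X.Q (Algebra.TensorProduct.map (AlgHom.id Fq L)
      (IsScalarTower.toAlgHom Fq X.O X.Q) t) = Algebra.TensorProduct.map (AlgHom.id Fq L)
      (IsScalarTower.toAlgHom Fq X.O X.Q) (frob Fq L X.O t) := by
    intro t
    induction t with
    | zero => simp
    | add x y hx hy => simp only [map_add, hx, hy]
    | tmul x a => rfl
  refine ⟨_, ⟨(frob Fq L X.O)^[Module.finrank Fq L - 1] t, rfl⟩, ?_⟩
  refine (hcomm _).trans ?_
  rw [← Function.iterate_succ_apply' (frob Fq L X.O), Nat.succ_eq_add_one,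
    Nat.sub_add_cancel Module.finrank_pos, frob_iterate]
  rfl

omit [Finite L] in
theorem frob_one_tmul (a : X.Q) : frob Fq L X.Q (1 ⊗ₜ a) = 1 ⊗ₜ a := by
  rw [frob_tmul, one_pow]

variable (𝓜 : PureAndersonMotive X c r d M)

/-- After `e` steps the twist of the coefficients is trivial, so the iterate is the linear base
change of `π`. -/
theorem genericTau_iterate_finrank (x : (L ⊗[Fq] X.Q) ⊗[L ⊗[Fq] X.A] M) :
    (X.genericTau 𝓜.τ)^[Module.finrank Fq L] x = 𝓜.frobenius.baseChange (L ⊗[Fq] X.Q) x := by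
  have key : ∀ (n : ℕ) (s : L ⊗[Fq] X.Q) (x : M), (X.genericTau 𝓜.τ)^[n] (s ⊗ₜ x) =
      (frob Fq L X.Q)^[n] s ⊗ₜ 𝓜.τ^[n] x := by
    intro n
    induction n with
    | zero => intro s x; rfl
    | succ n ih =>
      intro s x
      simp only [Function.iterate_succ_apply]
      rw [PointedCurve.genericTau, semilinearBaseChange_tmul]
      exact ih _ _
  induction x with
  | zero => rw [iterate_map_zero, map_zero]
  | add x y hx hy => rw [iterate_map_add, hx, hy, map_add]
  | tmul s x => rw [key, frob_iterate]; rfl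

/-- The stalk at infinity is stable under a twist of a power of Frobenius. -/
theorem exists_lattice {ϖ : X.O} (hϖ : Irreducible ϖ) {m l : ℕ} (h : X.IsPureOfType 𝓜.τ m l) :
    ∃ N : Submodule (X.localRingInfty L) ((L ⊗[Fq] X.Q) ⊗[L ⊗[Fq] X.A] M),
      N.FG ∧ Submodule.span (L ⊗[Fq] X.Q) (N : Set ((L ⊗[Fq] X.Q) ⊗[L ⊗[Fq] X.A] M)) = ⊤ ∧
      (∀ x, (∃ y ∈ N, (𝓜.frobenius.baseChange (L ⊗[Fq] X.Q) ^ l) y = x) ↔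
        ((1 : L) ⊗ₜ[Fq] algebraMap X.O X.Q ϖ) ^ (m * Module.finrank Fq L) • x ∈ N) := by
  obtain ⟨N, hfg, hspan, hN⟩ := h
  refine ⟨N, hfg, hspan, ?_⟩
  set T := X.genericTau 𝓜.τ
  set Z : L ⊗[Fq] X.Q := (1 : L) ⊗ₜ[Fq] algebraMap X.O X.Q ϖ
  have hZpow : ∀ n, Z ^ n = (1 : L) ⊗ₜ[Fq] algebraMap X.O X.Q (ϖ ^ n) := by
    intro n
    rw [Algebra.TensorProduct.tmul_pow, one_pow, map_pow]
  have hZ : IsUnit Z := by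
    refine (IsUnit.mk0 (algebraMap X.O X.Q ϖ) ?_).map
      (Algebra.TensorProduct.includeRight : X.Q →ₐ[Fq] L ⊗[Fq] X.Q)
    rw [Ne, map_eq_zero_iff _ (IsFractionRing.injective X.O X.Q)]
    exact hϖ.ne_zero
  have hmax : ∀ x, (∀ a ∈ IsLocalRing.maximalIdeal X.O ^ m,
      ((1 : L) ⊗ₜ[Fq] algebraMap X.O X.Q a) • x ∈ N) ↔ Z ^ m • x ∈ N := by
    intro x
    rw [hϖ.maximalIdeal_eq, Ideal.span_singleton_pow]
    constructor
    · intro h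
      rw [hZpow]
      exact h _ (Ideal.mem_span_singleton_self _)
    · intro h a ha
      obtain ⟨b, rfl⟩ := Ideal.mem_span_singleton'.mp ha
      have hb : (1 : L) ⊗ₜ[Fq] algebraMap X.O X.Q b ∈ X.localRingInfty L := ⟨1 ⊗ₜ b, rfl⟩
      have := N.smul_mem ⟨_, hb⟩ h
      rw [map_mul, ← one_mul (1 : L), ← Algebra.TensorProduct.tmul_mul_tmul, ← hZpow, mul_smul]
      exact this
  have hTZ : ∀ n k x, T^[n] (Z ^ k • x) = Z ^ k • T^[n] x := by
    intro n k x
    induction n generalizing x with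
    | zero => rfl
    | succ n ih =>
      rw [Function.iterate_succ_apply, map_smulₛₗ, hZpow, frob_one_tmul, ← hZpow, ih]; rfl
  have hsmul : ∀ n (b : X.localRingInfty L), ∀ y ∈ N, ∃ y' ∈ N, T^[n] y' = b • T^[n] y := by
    intro n
    induction n with
    | zero => intro b y hy; exact ⟨_, N.smul_mem b hy, rfl⟩
    | succ n ih =>
      intro b y hy
      obtain ⟨b', hb', hbb⟩ := exists_frob_eq b
      obtain ⟨y', hy', h⟩ := ih ⟨b', hb'⟩ y hy
      refine ⟨y', hy', ?_⟩
      rw [Function.iterate_succ_apply', h, Function.iterate_succ_apply']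
      refine (map_smulₛₗ T b' _).trans ?_
      rw [hbb]; rfl
  -- The span in the purity condition is superfluous: scalars of the local ring can be moved through
  -- `T`.
  have himage : ∀ x, x ∈ Submodule.span (X.localRingInfty L) (T^[l] '' N) ↔
      ∃ y ∈ N, T^[l] y = x := by
    intro x
    refine ⟨fun hx => ?_, fun hx => Submodule.subset_span hx⟩
    induction hx using Submodule.span_induction with
    | mem x hx => exact hx
    | zero => exact ⟨0, zero_mem _, iterate_map_zero _ _⟩
    | add x y _ _ hx hy =>
      obtain ⟨x', hx', rfl⟩ := hx
      obtain ⟨y', hy', rfl⟩ := hy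
      exact ⟨_, add_mem hx' hy', iterate_map_add _ _ _ _⟩
    | smul b x _ hx =>
      obtain ⟨x', hx', rfl⟩ := hx
      exact hsmul l b x' hx'
  have hone : ∀ x, (∃ y ∈ N, T^[l] y = x) ↔ Z ^ m • x ∈ N := fun x => by
    rw [← himage, hN, hmax]
  -- `T` commutes with `Z`, because `σ^*` fixes `1 ⊗ ϖ`. Hence `T^l N = Z^(-m) N` iterates to `T^(l
  -- j) N = Z^(-m j) N`; for `j = e` the map on the left is `π^l`.
  have hiter : ∀ j x, (∃ y ∈ N, T^[l * j] y = x) ↔ Z ^ (m * j) • x ∈ N := by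
    intro j
    induction j with
    | zero => intro x; simp
    | succ j ih =>
      intro x
      rw [mul_add, mul_one, mul_add, mul_one, pow_add]
      obtain ⟨u, hu⟩ := hZ.pow (m * j)
      constructor
      · rintro ⟨y, hy, rfl⟩
        rw [Nat.add_comm, Function.iterate_add_apply, mul_comm, mul_smul, ← hTZ]
        exact (hone _).mp ⟨_, (ih _).mp ⟨y, hy, rfl⟩, rfl⟩
      · intro hx
        rw [mul_comm, mul_smul] at hx
        obtain ⟨y, hy, hyx⟩ := (hone _).mpr hx
        obtain ⟨y', hy', hyy⟩ := (ih ((↑u⁻¹ : L ⊗[Fq] X.Q) • y)).mpr (by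
          rw [← hu, smul_smul, Units.mul_inv, one_smul]; exact hy)
        refine ⟨y', hy', ?_⟩
        rw [Nat.add_comm, Function.iterate_add_apply, hyy]
        have h1 : Z ^ (m * j) • T^[l] ((↑u⁻¹ : L ⊗[Fq] X.Q) • y) = Z ^ (m * j) • x := by
          rw [← hTZ, ← hyx, ← hu, smul_smul, Units.mul_inv, one_smul]
        have h2 := congrArg ((↑u⁻¹ : L ⊗[Fq] X.Q) • ·) h1
        simpa only [← hu, smul_smul, Units.inv_mul, one_smul] using h2
  intro x
  rw [← hiter]
  have hpow : ∀ y, (𝓜.frobenius.baseChange (L ⊗[Fq] X.Q) ^ l) y =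
      T^[l * Module.finrank Fq L] y := by
    intro y
    rw [Module.End.pow_apply, mul_comm, Function.iterate_mul]
    congr 1
    ext y
    exact (𝓜.genericTau_iterate_finrank y).symm
  simp only [hpow]

end PureAndersonMotive

/-! ### The normalized absolute value at infinity. -/

namespace PointedCurve

variable {Fq : Type u} [Field Fq] [Fintype Fq] (X : PointedCurve Fq)

omit [Fintype Fq] in
theorem valued_algebraMap (a : X.O) : Valued.v (algebraMap X.Q X.Qinfty (algebraMap X.O X.Q a)) =
    (IsDiscreteValuationRing.maximalIdeal X.O).intValuation a := by
  rw [← IsDedekindDomain.HeightOneSpectrum.valuation_of_algebraMap (K := X.Q)]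
  exact IsDedekindDomain.HeightOneSpectrum.valuedAdicCompletion_eq_valuation' _ _

theorem absInfty_le_one (a : X.O) :
    X.absInfty (algebraMap X.Q X.Qinfty (algebraMap X.O X.Q a)) ≤ 1 := by
  have h : (1 : NNReal) < Fintype.card Fq := by exact_mod_cast Fintype.one_lt_card
  rw [absInfty, valued_algebraMap]
  exact_mod_cast (WithZeroMulInt.toNNReal_le_one_iff h).mpr
    (IsDedekindDomain.HeightOneSpectrum.intValuation_le_one _ a)

theorem absInfty_uniformizer {ϖ : X.O} (hϖ : Irreducible ϖ) :
    X.absInfty (algebraMap X.Q X.Qinfty (algebraMap X.O X.Q ϖ)) = (Fintype.card Fq : ℝ)⁻¹ := by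
  rw [absInfty, valued_algebraMap,
    IsDedekindDomain.HeightOneSpectrum.intValuation_singleton _ hϖ.ne_zero hϖ.maximalIdeal_eq,
    WithZeroMulInt.toNNReal_neg_apply _ WithZero.exp_ne_zero]
  change (((Fintype.card Fq : NNReal) ^ (-1 : ℤ) : NNReal) : ℝ) = _
  simp

end PointedCurve

/-! ### Absolute values of the Frobenius eigenvalues. -/

namespace PureAndersonMotive

variable {Fq : Type u} [Field Fq] [Fintype Fq] {X : PointedCurve Fq}
  {L : Type*} [Field L] [Finite L] [Algebra Fq L] {c : X.A →ₐ[Fq] L} {r d : ℕ}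
  {M : Type*} [AddCommGroup M] [Module (L ⊗[Fq] X.A) M] (𝓜 : PureAndersonMotive X c r d M)

/-- The lattice at infinity transported to a field `K` over `Q_L`. -/
theorem exists_lattice_baseChange {ϖ : X.O} (hϖ : Irreducible ϖ) {m l : ℕ}
    (h : X.IsPureOfType 𝓜.τ m l) (K : Type*) [Field K] [Algebra (L ⊗[Fq] X.Q) K]
    [Algebra (L ⊗[Fq] X.A) K] [IsScalarTower (L ⊗[Fq] X.A) (L ⊗[Fq] X.Q) K] [Algebra X.O K]
    (hO : ∀ a : X.O, algebraMap X.O K a =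
      algebraMap (L ⊗[Fq] X.Q) K ((1 : L) ⊗ₜ[Fq] algebraMap X.O X.Q a)) :
    ∃ N : Submodule X.O (K ⊗[L ⊗[Fq] X.A] M),
      N.FG ∧ Submodule.span K (N : Set (K ⊗[L ⊗[Fq] X.A] M)) = ⊤ ∧
      (∀ x ∈ N, (algebraMap X.O K ϖ ^ (m * Module.finrank Fq L) •
        𝓜.frobenius.baseChange K ^ l) x ∈ N) ∧
      ∀ x ∈ N, ∃ y ∈ N, (algebraMap X.O K ϖ ^ (m * Module.finrank Fq L) •
        𝓜.frobenius.baseChange K ^ l) y = x := by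
  set n := m * Module.finrank Fq L
  set G := (L ⊗[Fq] X.Q) ⊗[L ⊗[Fq] X.A] M
  obtain ⟨N, ⟨s, hs⟩, hspan, hN⟩ := 𝓜.exists_lattice hϖ h
  let J : G →ₗ[L ⊗[Fq] X.Q] K ⊗[L ⊗[Fq] X.A] M :=
    TensorProduct.AlgebraTensorModule.map (Algebra.linearMap (L ⊗[Fq] X.Q) K) LinearMap.id
  have hJO : ∀ (a : X.O) (x : G),
      J (((1 : L) ⊗ₜ[Fq] algebraMap X.O X.Q a) • x) = a • J x := by
    intro a x
    rw [map_smul, ← algebraMap_smul K a, hO, algebraMap_smul]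
  have hJπ : ∀ x, J (𝓜.frobenius.baseChange _ x) = 𝓜.frobenius.baseChange K (J x) := by
    intro x
    induction x with
    | zero => simp
    | add x y hx hy => simp only [map_add, hx, hy]
    | tmul b x => rfl
  have hJH : ∀ x, (algebraMap X.O K ϖ ^ n • 𝓜.frobenius.baseChange K ^ l) (J x) =
      J (((1 : L) ⊗ₜ[Fq] algebraMap X.O X.Q ϖ) ^ n • (𝓜.frobenius.baseChange _ ^ l) x) := by
    intro x
    have hpow : ∀ k, (𝓜.frobenius.baseChange K ^ k) (J x) =
        J ((𝓜.frobenius.baseChange _ ^ k) x) := by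
      intro k
      induction k with
      | zero => rfl
      | succ k ih => rw [pow_succ', pow_succ', Module.End.mul_apply, ih, Module.End.mul_apply, hJπ]
    rw [LinearMap.smul_apply, hpow, map_smul, hO, ← map_pow, algebraMap_smul]
  -- Generators of `N` over `L ⊗ 𝒪_∞` generate over `𝒪_∞` only together with their `L`-multiples; as
  -- `L` is finite, these are still finitely many.
  let t : Set (K ⊗[L ⊗[Fq] X.A] M) :=
    Set.image2 (fun (a : L) (x : G) => J ((a ⊗ₜ[Fq] (1 : X.Q)) • x)) Set.univ s
  have ht : t.Finite := Set.Finite.image2 _ Set.finite_univ s.finite_toSet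
  let P := Submodule.span X.O t
  have hmem : ∀ x ∈ N, ∀ a : L, J ((a ⊗ₜ[Fq] (1 : X.Q)) • x) ∈ P := by
    intro x hx
    rw [← hs] at hx
    induction hx using Submodule.span_induction with
    | mem x hx => exact fun a => Submodule.subset_span ⟨a, trivial, x, hx, rfl⟩
    | zero => intro a; rw [smul_zero, map_zero]; exact zero_mem _
    | add x y _ _ hx hy => intro a; rw [smul_add, map_add]; exact add_mem (hx a) (hy a)
    | smul b x _ hx =>
      obtain ⟨_, b, rfl⟩ := b
      intro a
      change J (_ • (Algebra.TensorProduct.map (AlgHom.id Fq L)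
        (IsScalarTower.toAlgHom Fq X.O X.Q) b) • x) ∈ P
      induction b with
      | zero => rw [map_zero, zero_smul, smul_zero, map_zero]; exact zero_mem _
      | add b b' hb hb' =>
        rw [map_add, add_smul, smul_add, map_add]; exact add_mem hb hb'
      | tmul a' b =>
        have : (a ⊗ₜ[Fq] (1 : X.Q)) • (Algebra.TensorProduct.map (AlgHom.id Fq L)
            (IsScalarTower.toAlgHom Fq X.O X.Q) (a' ⊗ₜ b)) • x =
            ((1 : L) ⊗ₜ[Fq] algebraMap X.O X.Q b) • ((a * a') ⊗ₜ[Fq] (1 : X.Q)) • x := by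
          rw [smul_smul, smul_smul, Algebra.TensorProduct.map_tmul,
            Algebra.TensorProduct.tmul_mul_tmul, Algebra.TensorProduct.tmul_mul_tmul, one_mul,
            one_mul, mul_one]
          rfl
        rw [this, hJO]
        exact P.smul_mem _ (hx _)
  have hmem' : ∀ x ∈ N, J x ∈ P := by
    intro x hx
    have := hmem x hx 1
    rwa [← Algebra.TensorProduct.one_def, one_smul] at this
  have hgen : ∀ x ∈ t, ∃ y ∈ N, J y = x := by
    rintro _ ⟨a, -, x, hx, rfl⟩
    have ha : a ⊗ₜ[Fq] (1 : X.Q) ∈ X.localRingInfty L :=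
      ⟨a ⊗ₜ 1, by rw [AlgHom.toRingHom_eq_coe]; simp⟩
    exact ⟨_, N.smul_mem ⟨_, ha⟩ (hs ▸ Submodule.subset_span hx), rfl⟩
  have hPmap : ∀ f : Module.End K (K ⊗[L ⊗[Fq] X.A] M), ∀ Q : Submodule X.O (K ⊗[L ⊗[Fq] X.A] M),
      (∀ x ∈ t, f x ∈ Q) → ∀ x ∈ P, f x ∈ Q := by
    intro f Q hf x hx
    have : P ≤ Q.comap (f.restrictScalars X.O) := Submodule.span_le.mpr hf
    exact this hx
  refine ⟨P, ⟨ht.toFinset, by rw [Set.Finite.coe_toFinset]⟩, ?_, ?_, ?_⟩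
  · rw [← top_le_iff]
    intro x _
    have hJ : ∀ y : G, J y ∈ Submodule.span K (P : Set (K ⊗[L ⊗[Fq] X.A] M)) := by
      intro y
      have hy : y ∈ Submodule.span (L ⊗[Fq] X.Q) (N : Set G) := hspan ▸ Submodule.mem_top
      induction hy using Submodule.span_induction with
      | mem y hy => exact Submodule.subset_span (hmem' y hy)
      | zero => rw [map_zero]; exact zero_mem _
      | add y z _ _ hy hz => rw [map_add]; exact add_mem hy hz
      | smul b y _ hy =>
        rw [map_smul, ← algebraMap_smul K b]
        exact Submodule.smul_mem _ _ hy
    induction x with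
    | zero => exact zero_mem _
    | add x y hx hy => exact add_mem (hx trivial) (hy trivial)
    | tmul b x =>
      have : b ⊗ₜ[L ⊗[Fq] X.A] x = b • J (1 ⊗ₜ x) := by
        rw [TensorProduct.AlgebraTensorModule.map_tmul, TensorProduct.smul_tmul',
          Algebra.linearMap_apply, map_one, smul_eq_mul, mul_one]
        rfl
      rw [this]
      exact Submodule.smul_mem _ _ (hJ _)
  · refine hPmap _ P fun x hx => ?_
    obtain ⟨y, hy, rfl⟩ := hgen x hx
    rw [hJH]
    exact hmem' _ ((hN _).mp ⟨y, hy, rfl⟩)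
  · have : P ≤ P.map ((algebraMap X.O K ϖ ^ n • 𝓜.frobenius.baseChange K ^ l :
        Module.End K (K ⊗[L ⊗[Fq] X.A] M)).restrictScalars X.O) := by
      refine Submodule.span_le.mpr fun x hx => ?_
      obtain ⟨y, hy, rfl⟩ := hgen x hx
      obtain ⟨u, hu⟩ : IsUnit ((1 : L) ⊗ₜ[Fq] algebraMap X.O X.Q ϖ) := by
        refine (IsUnit.mk0 (algebraMap X.O X.Q ϖ) ?_).map
          (Algebra.TensorProduct.includeRight : X.Q →ₐ[Fq] L ⊗[Fq] X.Q)
        rw [Ne, map_eq_zero_iff _ (IsFractionRing.injective X.O X.Q)]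
        exact hϖ.ne_zero
      -- For `y` in `N` the vector `ϖ^(-n) y` lies in `π^l N`, so `y` has a preimage in `N` under
      -- the twisted power of Frobenius.
      obtain ⟨z, hz, hzy⟩ := (hN ((↑(u⁻¹ ^ n) : L ⊗[Fq] X.Q) • y)).mpr (by
        rwa [← hu, smul_smul, ← Units.val_pow_eq_pow_val, ← Units.val_mul, ← mul_pow,
          mul_inv_cancel, one_pow, Units.val_one, one_smul])
      refine ⟨J z, hmem' z hz, (hJH z).trans ?_⟩
      rw [hzy, ← hu, smul_smul, ← Units.val_pow_eq_pow_val, ← Units.val_mul, ← mul_pow,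
          mul_inv_cancel, one_pow, Units.val_one, one_smul]
    exact fun x hx => this hx

/-- The absolute value of the roots of the characteristic polynomials of the exterior powers of the
Frobenius endomorphism, over a field over `Q_L`. -/
theorem abv_eq_of_isRoot [Module.Finite (L ⊗[Fq] X.A) M] {w : ℚ} (hw : 𝓜.IsWeight w) (K : Type*)
    [Field K] [Algebra (L ⊗[Fq] X.Q) K] [Algebra (L ⊗[Fq] X.A) K]
    [IsScalarTower (L ⊗[Fq] X.A) (L ⊗[Fq] X.Q) K] (abv : AbsoluteValue K ℝ)
    (habv : ∀ x : X.Q, abv (algebraMap (L ⊗[Fq] X.Q) K (1 ⊗ₜ x)) =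
      X.absInfty (algebraMap X.Q X.Qinfty x)) (i : ℕ) (α : K)
    (hα : (exteriorPower.map i (𝓜.frobenius.baseChange K)).charpoly.IsRoot α) :
    abv α = (Nat.card L : ℝ) ^ ((i * w : ℚ) : ℝ) := by
  obtain ⟨m, l, -, hl, hpure, rfl⟩ := hw
  obtain ⟨ϖ, hϖ⟩ := IsDiscreteValuationRing.exists_irreducible X.O
  let : Algebra X.O K := ((algebraMap (L ⊗[Fq] X.Q) K).comp
    ((Algebra.TensorProduct.includeRight : X.Q →ₐ[Fq] L ⊗[Fq] X.Q).toRingHom.comp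
      (algebraMap X.O X.Q))).toAlgebra
  obtain ⟨N, hfg, hspan, hN, hN'⟩ := 𝓜.exists_lattice_baseChange hϖ hpure K fun _ => rfl
  obtain ⟨x, hx⟩ :=
    ((Module.End.hasEigenvalue_iff_isRoot_charpoly _ _).mpr hα).exists_hasEigenvector
  have hev : Module.End.HasEigenvalue (exteriorPower.map i
      (algebraMap X.O K ϖ ^ (m * Module.finrank Fq L) • 𝓜.frobenius.baseChange K ^ l))
      ((algebraMap X.O K ϖ ^ (m * Module.finrank Fq L)) ^ i * α ^ l) :=
    Module.End.hasEigenvalue_of_hasEigenvector (x := x) ⟨Module.End.mem_eigenspace_iff.mpr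
      (exteriorPower.map_smul_pow_apply _ _ _ _ _ hx.apply_eq_smul), hx.2⟩
  have hone := exteriorPower.abv_eq_one_of_hasEigenvalue abv
    (fun a => (habv _).trans_le (X.absInfty_le_one a)) N hfg hspan _ hN hN' i hev
  have hϖK : abv (algebraMap X.O K ϖ) = (Fintype.card Fq : ℝ)⁻¹ :=
    (habv _).trans (X.absInfty_uniformizer hϖ)
  have hq : (0 : ℝ) < Fintype.card Fq := by exact_mod_cast Fintype.card_pos
  have hcard : (Nat.card L : ℝ) = (Fintype.card Fq : ℝ) ^ Module.finrank Fq L := by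
    have := Fintype.ofFinite L
    rw [Nat.card_eq_fintype_card, Module.card_eq_pow_finrank (K := Fq)]
    push_cast; rfl
  have hs : (0 : ℝ) < Nat.card L := by rw [hcard]; positivity
  -- The relation `|ϖ|^(m e i) |α|^l = 1` with `|ϖ| = 1/q` and `q^e = #L`.
  have hpow : abv α ^ l = (Nat.card L : ℝ) ^ (m * i) := by
    rw [map_mul, map_pow, map_pow, map_pow, hϖK, inv_pow, inv_pow, inv_mul_eq_one₀ (by positivity)]
      at hone
    rw [← hone, hcard, ← pow_mul, ← pow_mul]
    congr 1
    ring
  have hl' : (l : ℝ) ≠ 0 := by exact_mod_cast hl.ne'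
  refine (pow_left_inj₀ (abv.nonneg _) (Real.rpow_nonneg hs.le _) hl.ne').mp ?_
  rw [hpow, ← Real.rpow_natCast, ← Real.rpow_natCast, ← Real.rpow_mul hs.le]
  congr 1
  push_cast
  field_simp

end PureAndersonMotive

/-- Any `Fq`-embedding of `L` into `Ω` makes `Ω` a field over `Q_L`, hence over `A_L`, and the
absolute values of the roots of `P` are then read off from the lattice at infinity. The choice of
embedding is immaterial, since `P` has coefficients in `A`. -/
theorem theorem7p9 {Fq : Type u} [Field Fq] [Fintype Fq] (X : PointedCurve Fq)
    {L : Type*} [Field L] [Finite L] [Algebra Fq L]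
    (Ls : Type*) [Field Ls] [Algebra Fq Ls] [Algebra L Ls] [IsScalarTower Fq L Ls]
    [IsSepClosure L Ls]
    (c : X.A →ₐ[Fq] L) (r d : ℕ) {M : Type*} [AddCommGroup M] [Module (L ⊗[Fq] X.A) M]
    (𝓜 : PureAndersonMotive X c r d M) (w : ℚ) (hw : 𝓜.IsWeight w)
    (v : Ideal X.A) (hv : v.IsMaximal) (hvc : v ≠ RingHom.ker c) (i : ℕ) :
    ∃ (_ : Module.Finite (X.Qv v) (𝓜.RationalTateModule Ls v))
      (_ : Module.Free (X.Qv v) (𝓜.RationalTateModule Ls v))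
      (P : Polynomial X.A),
      P.map (algebraMap X.A (X.Qv v)) =
        (exteriorPower.map i (𝓜.rationalTateFrobenius Ls v)).charpoly ∧
      ∀ (Ω : Type w) [Field Ω] [Algebra X.Qinfty Ω] [IsAlgClosure X.Qinfty Ω]
        (abv : AbsoluteValue Ω ℝ) (_ : ∀ x, abv (algebraMap X.Qinfty Ω x) = X.absInfty x) (α : Ω),
        P.eval₂ ((algebraMap X.Qinfty Ω).comp X.embInfty) α = 0 →
          abv α = (Nat.card L : ℝ) ^ ((i * w : ℚ) : ℝ) := by
  have := 𝓜.finite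
  have := IsSepClosure.sep_closed (k := L) (K := Ls)
  obtain ⟨hfin, hfree, P, hP, hPK⟩ := 𝓜.exists_charpoly.{u, w} Ls v hv hvc i
  refine ⟨hfin, hfree, P, hP, fun Ω _ _ _ abv habv α hα => ?_⟩
  have : IsAlgClosed Ω := IsAlgClosure.isAlgClosed X.Qinfty
  let : Algebra Fq Ω := ((algebraMap X.Qinfty Ω).comp
    ((algebraMap X.Q X.Qinfty).comp (algebraMap Fq X.Q))).toAlgebra
  have : Module.Finite Fq L := Module.Finite.of_finite
  let f : X.Q →ₐ[Fq] Ω :=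
    { toRingHom := (algebraMap X.Qinfty Ω).comp (algebraMap X.Q X.Qinfty)
      commutes' := fun _ => rfl }
  -- On `L` this is some embedding into the algebraically closed field `Ω`; on `Q` it must be the
  -- given map through `Q_∞`, so that `abv` restricts to the normalized absolute value.
  let ρ : L ⊗[Fq] X.Q →ₐ[Fq] Ω := Algebra.TensorProduct.productMap IsAlgClosed.lift f
  let : Algebra (L ⊗[Fq] X.Q) Ω := ρ.toRingHom.toAlgebra
  let : Algebra (L ⊗[Fq] X.A) Ω :=
    (ρ.toRingHom.comp (algebraMap (L ⊗[Fq] X.A) (L ⊗[Fq] X.Q))).toAlgebra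
  have : IsScalarTower (L ⊗[Fq] X.A) (L ⊗[Fq] X.Q) Ω := .of_algebraMap_eq' rfl
  have hρ : ∀ x : X.Q, algebraMap (L ⊗[Fq] X.Q) Ω (1 ⊗ₜ x) =
      algebraMap X.Qinfty Ω (algebraMap X.Q X.Qinfty x) := fun x => by
    change ρ (1 ⊗ₜ x) = _
    rw [Algebra.TensorProduct.productMap_apply_tmul, map_one, one_mul]; rfl
  refine 𝓜.abv_eq_of_isRoot hw Ω abv (fun x => by rw [hρ, habv]) i α ?_
  rw [← hPK Ω, Polynomial.IsRoot, Polynomial.eval_map, ← hα]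
  congr 1
  ext a
  exact hρ (algebraMap X.A X.Q a)
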